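/- Let $p>3$ be a prime, let $C_p$ be the cyclic group of order $p$, and let \[M_1=\langle \rho,\sigma,\tau \mid \rho^p=\sigma^p=\tau^p=1,\ \sigma\rho=\rho\sigma,\ \tau\rho=\rho\tau,\ \tau\sigma=\rho\sigma\tau\rangle\] be the Heisenberg group of order $p^3$. A skew brace $(B,\oplus,\odot)$ is a set with two group structures such that $a\odot(b\oplus c)=(a\odot b)\ominus a\oplus(a\odot c)$ for all $a,b,c$; it is a $G$-skew brace of type $N$ if $(B,\odot)\cong G$ and $(B,\oplus)\cong N$. Isomorphisms of skew braces are the bijections that respect both operations, and $\mathrm{Aut}_{\mathcal{B}r}(B)$ is the group of automorphisms. Write $|\Theta(B)|$ for the number of distinct maps $\lambda_a\in\mathrm{Aut}(B,\oplus)$, $\lambda_a(b)=\ominus a\oplus(a\odot b)$, $a\in B$. For a group $N$ let $\mathrm{Hol}(N)=N\rtimes\mathrm{Aut}(N)$ act on $N$ by $(\eta\alpha)(x)=\eta\,\alpha(x)$. A subgroup $H$ of $\mathrm{Hol}(N)$ which acts regularly on $N$ is regarded as a skew brace of type $N$ with $(H,\odot)=H$ and with $\oplus$ transported from $N$ along $H\to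 N$, $g\mapsto g(1)$; along this bijection $\mathrm{Aut}_{\mathcal{B}r}(H)$ is identified with a subgroup of $\mathrm{Aut}(N)$. Let $\alpha_1,\alpha_2,\alpha_3\in\mathrm{Aut}(M_1)$ be given by $\alpha_1:\sigma\mapsto\rho\sigma,\ \tau\mapsto\tau$; $\alpha_2:\sigma\mapsto\sigma\tau,\ \tau\mapsto\tau$; $\alpha_3:\sigma\mapsto\sigma,\ \tau\mapsto\rho\tau$. A matrix $\begin{pmatrix}a&b\\c&d\end{pmatrix}\in\mathrm{GL}_2(\mathbb{F}_p)$ also denotes the automorphism $\sigma\mapsto\rho^{ac/2}\sigma^{a}\tau^{c}$, $\tau\mapsto\rho^{bd/2}\sigma^{b}\tau^{d}$ of $M_1$. Automorphisms are composed as maps acting on the left. (1) Up to isomorphism there are exactly $2(p-1)$ $M_1$-skew braces $B$ of type $M_1$ with $|\Theta(B)|=p$, and exactly two $C_p^3$-skew braces $B$ of type $M_1$ with $|\Theta(B)|=p$. (2) For all integers $a,b,c\ge 0$ the subgroup $\langle\rho,\tau,\sigma\alpha_1^a\alpha_2^b\alpha_3^c\rangle$ of $\mathrm{Hol}(M_1)$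 is regular. Every skew brace $B$ of type $M_1$ with $|\Theta(B)|=p$ is isomorphic to exactly one of \[\langle\rho,\tau,\sigma\alpha_3\rangle,\ \langle\rho,\tau,\sigma\alpha_2\alpha_3\rangle\ (\cong C_p^3);\] \[\langle\rho,\tau,\sigma\alpha_1\rangle,\ \langle\rho,\tau,\sigma\alpha_2\rangle,\ \langle\rho,\tau,\sigma\alpha_3^c\rangle,\ \langle\rho,\tau,\sigma\alpha_2\alpha_3^c\rangle\ (\cong M_1),\quad c=2,\dots,p-1,\] all of which are skew braces of type $M_1$ with $|\Theta|=p$ and with multiplicative group as indicated. (3) As subgroups of $\mathrm{Aut}(M_1)$, with the parameters $r_1,r_3,b_1,b_3,b_4$ ranging over the elements of $\mathbb{F}_p$ for which the matrix is invertible, \[\mathrm{Aut}_{\mathcal{B}r}(\langle\rho,\tau,\sigma\alpha_1\rangle)=\Big\{\alpha_1^{r_1}\alpha_3^{r_3}\begin{pmatrix}b_1&0\\b_3&b_1\end{pmatrix}\Big\},\qquad \mathrm{Aut}_{\mathcal{B}r}(\langle\rho,\tau,\sigma\alpha_2\rangle)=\Big\{\alpha_1^{r_1}\alpha_3^{\frac12(b_1-1)}\begin{pmatrix}b_1&0\\b_3&b_1^2\end{pmatrix}\Big\},\]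 and, for $c=1,\dots,p-1$, \[\mathrm{Aut}_{\mathcal{B}r}(\langle\rho,\tau,\sigma\alpha_3^c\rangle)=\Big\{\alpha_1^{r_1}\alpha_3^{r_3}\begin{pmatrix}b_1&0\\0&b_4\end{pmatrix}\Big\},\qquad \mathrm{Aut}_{\mathcal{B}r}(\langle\rho,\tau,\sigma\alpha_2\alpha_3^c\rangle)=\Big\{\alpha_1^{r_1}\alpha_3^{cb_1^{-1}b_3+\frac12(b_1-1)(c+1)}\begin{pmatrix}b_1&0\\b_3&b_1^2\end{pmatrix}\Big\}.\] (4) Let $L/K$ be a finite Galois extension of fields with Galois group $G$. A Hopf-Galois structure on $L/K$ is a finite-dimensional cocommutative $K$-Hopf algebra $H$ with an action on $L$ which makes $L$ an $H$-module algebra and for which $j:L\otimes_K H\to\mathrm{End}_K(L)$, $j(x\otimes h)(z)=x\,h(z)$, is bijective; such structures are counted up to isomorphisms of Hopf algebras that respect the actions. It is of type $M_1$ if it is of the form $L[N]^G$ with $N\cong M_1$, where $N$ is a regular subgroup of $\mathrm{Perm}(G)$ normalised by the left translations, $G$ acts on $L$ by automorphisms and on $N$ by conjugation with left translations, and $\sum_{n}c_n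 n\in L[N]^G$ acts on $L$ by $x\mapsto\sum_n c_n\,(n^{-1}(1_G))(x)$. Its skew brace is $B=G$ with $(B,\odot)=G$ and with $\oplus$ transported from $N$ along $n\mapsto n(1_G)$. If $G\cong M_1$, then there are exactly \[(p^3-p^2-1)(p+1)\] Hopf-Galois structures on $L/K$ of type $M_1$ with $|\Theta(B)|=p$. If $G\cong C_p^3$, then there are exactly \[(p^3-1)(p+1)p^2\] Hopf-Galois structures on $L/K$ of type $M_1$ with $|\Theta(B)|=p$. -/

import Mathlib

open scoped TensorProduct

universe u v w

/-! ### Skew braces -/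

/-- A skew (left) brace: a set with two group structures, here written `+` (not assumed
commutative) and `*`, such that `a * (b + c) = a * b - a + a * c`. -/
class SkewBrace (B : Type u) extends AddGroup B, Group B where
  brace_property : ∀ a b c : B, a * (b + c) = a * b + -a + a * c

namespace SkewBrace

variable {B : Type u} [SkewBrace B]

theorem mul_zero_eq (a : B) : a * (0 : B) = a := by
  have h := brace_property a 0 0
  rw [add_zero, add_assoc] at h
  have h2 : -a + a * 0 = 0 := left_eq_add.mp h
  exact (neg_add_eq_zero.mp h2).symm

theorem mul_neg_eq (a b : B) : a * (-b) = a + -(a * b) + a := by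
  have h := brace_property a b (-b)
  rw [add_neg_cancel, mul_zero_eq] at h
  have h2 : a * (-b) = -(a * b + -a) + a :=
    (neg_add_eq_iff_eq_add.mpr h).symm
  rw [h2, neg_add_rev, neg_neg]

theorem lam_mul_aux (a b c : B) :
    -(a * b) + a * b * c = -a + a * (-b + b * c) := by
  rw [brace_property, mul_neg_eq, mul_assoc]
  simp [add_assoc]

theorem lam_one_aux (c : B) : -(1 : B) + 1 * c = c := by
  have h := mul_zero_eq (1 : B)
  rw [one_mul] at h
  rw [one_mul, ← h, neg_zero, zero_add]

/-- `lam a b = -a + a * b`, an automorphism of the additive group. -/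
def lam (a : B) : B ≃+ B where
  toFun b := -a + a * b
  invFun b := -a⁻¹ + a⁻¹ * b
  left_inv b := by
    change -a⁻¹ + a⁻¹ * (-a + a * b) = b
    rw [← lam_mul_aux, inv_mul_cancel, lam_one_aux]
  right_inv b := by
    change -a + a * (-a⁻¹ + a⁻¹ * b) = b
    rw [← lam_mul_aux, mul_inv_cancel, lam_one_aux]
  map_add' b c := by
    rw [brace_property]
    simp [add_assoc]

variable (B) in
/-- The size of the image of the multiplicative group in the automorphism group of the additive
group, that is of the image under the projection `Θ : Hol(B,+) → Aut(B,+)` of the group of maps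
`b ↦ a * b`. -/
noncomputable def thetaCard : ℕ := Nat.card (Set.range (lam : B → (B ≃+ B)))

end SkewBrace

/-- Isomorphisms of skew braces: bijections that are homomorphisms for both group structures. -/
structure SkewBraceIso (B : Type u) (C : Type v) [SkewBrace B] [SkewBrace C] extends
    B ≃ C where
  map_add' : ∀ x y, toFun (x + y) = toFun x + toFun y
  map_mul' : ∀ x y, toFun (x * y) = toFun x * toFun y

namespace SkewBraceIso

variable {B C D : Type*} [SkewBrace B] [SkewBrace C] [SkewBrace D]

theorem toEquiv_injective :
    Function.Injective (SkewBraceIso.toEquiv : SkewBraceIso B C → (B ≃ C)) := by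
  rintro ⟨f, _, _⟩ ⟨g, _, _⟩ h
  cases h
  rfl

variable (B) in
/-- The identity isomorphism. -/
def refl : SkewBraceIso B B where
  toEquiv := Equiv.refl B
  map_add' _ _ := rfl
  map_mul' _ _ := rfl

/-- The inverse isomorphism. -/
def symm (f : SkewBraceIso B C) : SkewBraceIso C B where
  toEquiv := f.toEquiv.symm
  map_add' x y := f.toEquiv.injective (by
    have h := f.map_add' (f.toEquiv.symm x) (f.toEquiv.symm y)
    simpa using h.symm)
  map_mul' x y := f.toEquiv.injective (by
    have h := f.map_mul' (f.toEquiv.symm x) (f.toEquiv.symm y)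
    simpa using h.symm)

/-- Composition of isomorphisms: first `f`, then `g`. -/
def trans (f : SkewBraceIso B C) (g : SkewBraceIso C D) : SkewBraceIso B D where
  toEquiv := f.toEquiv.trans g.toEquiv
  map_add' x y := by
    have h1 := f.map_add' x y
    have h2 := g.map_add' (f.toEquiv x) (f.toEquiv y)
    exact (congrArg g.toEquiv h1).trans h2
  map_mul' x y := by
    have h1 := f.map_mul' x y
    have h2 := g.map_mul' (f.toEquiv x) (f.toEquiv y)
    exact (congrArg g.toEquiv h1).trans h2

/-- The automorphism group of a skew brace; the product is composition of maps. -/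
instance : Group (SkewBraceIso B B) where
  mul f g := g.trans f
  one := refl B
  inv f := f.symm
  mul_assoc _ _ _ := rfl
  one_mul _ := rfl
  mul_one _ := rfl
  inv_mul_cancel f := toEquiv_injective (Equiv.self_trans_symm f.toEquiv)

end SkewBraceIso

/-- A skew brace together with its underlying type. -/
structure BundledSkewBrace : Type (w + 1) where
  carrier : Type w
  [inst : SkewBrace carrier]

attribute [instance] BundledSkewBrace.inst

/-- The relation of being isomorphic skew braces. -/
instance BundledSkewBrace.setoid : Setoid BundledSkewBrace.{w} where
  r B C := Nonempty (SkewBraceIso B.carrier C.carrier)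
  iseqv := ⟨fun B => ⟨SkewBraceIso.refl B.carrier⟩, fun ⟨f⟩ => ⟨f.symm⟩,
    fun ⟨f⟩ ⟨g⟩ => ⟨f.trans g⟩⟩

/-- A `G`-skew brace of type `N`: the multiplicative group is isomorphic to `G` and the additive
group is isomorphic to `N`. -/
def IsSkewBraceOfType (B : Type*) [SkewBrace B] (G N : Type*) [Group G] [Group N] : Prop :=
  Nonempty (B ≃* G) ∧ Nonempty (B ≃+ Additive N)

/-- The isomorphism classes of `G`-skew braces `B` of type `N` with `|Θ(B)| = r`. -/
def skewBraceClasses (G N : Type*) [Group G] [Group N] (r : ℕ) :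
    Set (Quotient BundledSkewBrace.setoid.{w}) :=
  {q | ∃ B : BundledSkewBrace.{w}, Quotient.mk _ B = q ∧
    IsSkewBraceOfType B.carrier G N ∧ SkewBrace.thetaCard B.carrier = r}

/-! ### The holomorph and the skew brace of a regular subgroup -/

/-- The holomorph `N ⋊ Aut N`. -/
abbrev Hol (N : Type*) [Group N] : Type _ := N ⋊[MonoidHom.id (MulAut N)] MulAut N

/-- The action of the holomorph on `N`: `ηα` sends `x` to `η α(x)`. -/
def Hol.act {N : Type*} [Group N] (g : Hol N) (x : N) : N := g.left * g.right x

/-- A subgroup of the holomorph is regular if it acts freely and transitively on `N`. -/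
def Hol.IsRegular {N : Type*} [Group N] (H : Subgroup (Hol N)) : Prop :=
  ∀ x y : N, ∃! g : Hol N, g ∈ H ∧ Hol.act g x = y

namespace Hol

variable {N : Type*} [Group N]

/-- For a regular subgroup `H` of the holomorph, the bijection `H → N`, `g ↦ g(1)`. -/
noncomputable def orbitEquiv (H : Subgroup (Hol N)) (hH : IsRegular H) : H ≃ N :=
  Equiv.ofBijective (fun g => Hol.act (g : Hol N) 1) (by
    refine ⟨fun g h hgh => ?_, fun y => ?_⟩
    · exact Subtype.ext ((hH 1 (Hol.act (g : Hol N) 1)).unique ⟨g.2, rfl⟩ ⟨h.2, hgh.symm⟩)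
    · obtain ⟨g, ⟨hg, hy⟩, _⟩ := hH 1 y
      exact ⟨⟨g, hg⟩, hy⟩)

/-- The carrier of the skew brace given by a regular subgroup `H`. -/
def Brace (H : Subgroup (Hol N)) (_hH : IsRegular H) : Type _ := H

/-- The map `g ↦ g(1)` on the skew brace given by `H`. -/
noncomputable def Brace.psi (H : Subgroup (Hol N)) (hH : IsRegular H) : Brace H hH ≃ N :=
  orbitEquiv H hH

/-- The skew brace given by a regular subgroup `H`: its multiplicative group is `H`, and its
addition is transported from `N` along `g ↦ g(1)`. -/
noncomputable instance (H : Subgroup (Hol N)) (hH : IsRegular H) : SkewBrace (Brace H hH) where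
  toAddGroup := ((Brace.psi H hH).trans (Additive.ofMul : N ≃ Additive N)).addGroup
  toGroup := inferInstanceAs (Group H)
  brace_property := fun (a b c : H) => by
    let ψ : H ≃ N := orbitEquiv H hH
    have hmul : ∀ g h : H, ψ (g * h) = ψ g * (g : Hol N).right (ψ h) := by
      intro g h
      simp [ψ, orbitEquiv, Hol.act]
    change a * ψ.symm (ψ b * ψ c) =
      ψ.symm (ψ (ψ.symm (ψ (a * b) * ψ (ψ.symm (ψ a)⁻¹))) * ψ (a * c))
    apply ψ.injective
    simp only [Equiv.apply_symm_apply, hmul, map_mul]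
    group

theorem Brace.psi_add (H : Subgroup (Hol N)) (hH : IsRegular H) (x y : Brace H hH) :
    Brace.psi H hH (x + y) = Brace.psi H hH x * Brace.psi H hH y :=
  (Brace.psi H hH).apply_symm_apply _

/-- The automorphism group of the skew brace given by `H`, identified with a group of
automorphisms of `N` along the isomorphism `g ↦ g(1)` from its additive group to `N`. -/
noncomputable def Brace.autHom (H : Subgroup (Hol N)) (hH : IsRegular H) :
    SkewBraceIso (Brace H hH) (Brace H hH) →* MulAut N where
  toFun f :=
    { toEquiv := ((Brace.psi H hH).symm.trans f.toEquiv).trans (Brace.psi H hH)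
      map_mul' := fun x y => by
        have h1 : (Brace.psi H hH).symm (x * y) =
            (Brace.psi H hH).symm x + (Brace.psi H hH).symm y := by
          apply (Brace.psi H hH).injective
          simp [Brace.psi_add]
        have h2 := f.map_add' ((Brace.psi H hH).symm x) ((Brace.psi H hH).symm y)
        change Brace.psi H hH (f.toEquiv ((Brace.psi H hH).symm (x * y))) = _
        rw [h1]
        exact (congrArg (Brace.psi H hH) h2).trans (Brace.psi_add H hH _ _) }
  map_one' := by
    ext x
    exact (Brace.psi H hH).apply_symm_apply x
  map_mul' f g := by
    ext x
    change Brace.psi H hH (f.toEquiv (g.toEquiv ((Brace.psi H hH).symm x))) =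
      Brace.psi H hH (f.toEquiv ((Brace.psi H hH).symm
        (Brace.psi H hH (g.toEquiv ((Brace.psi H hH).symm x)))))
    rw [Equiv.symm_apply_apply]

end Hol

/-! ### The Heisenberg group -/

/-- The Heisenberg group of order `p ^ 3`,
`⟨ρ, σ, τ | ρ^p = σ^p = τ^p = 1, σρ = ρσ, τρ = ρτ, τσ = ρστ⟩`.
The triple `⟨x, y, z⟩` stands for the normal form `ρ^x σ^y τ^z`. -/
@[ext]
structure Heis (p : ℕ) where
  x : ZMod p
  y : ZMod p
  z : ZMod p

namespace Heis

variable {p : ℕ}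

instance : Group (Heis p) where
  mul u v := ⟨u.x + v.x + u.z * v.y, u.y + v.y, u.z + v.z⟩
  one := ⟨0, 0, 0⟩
  inv u := ⟨-u.x + u.y * u.z, -u.y, -u.z⟩
  mul_assoc u v w := by
    apply Heis.ext
    · change u.x + v.x + u.z * v.y + w.x + (u.z + v.z) * w.y =
        u.x + (v.x + w.x + v.z * w.y) + u.z * (v.y + w.y)
      ring
    · exact add_assoc _ _ _
    · exact add_assoc _ _ _
  one_mul u := by
    apply Heis.ext
    · change 0 + u.x + 0 * u.y = u.x
      ring
    · exact zero_add _
    · exact zero_add _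
  mul_one u := by
    apply Heis.ext
    · change u.x + 0 + u.z * 0 = u.x
      ring
    · exact add_zero _
    · exact add_zero _
  inv_mul_cancel u := by
    apply Heis.ext
    · change -u.x + u.y * u.z + u.x + -u.z * u.y = 0
      ring
    · exact neg_add_cancel _
    · exact neg_add_cancel _

theorem mul_def (u v : Heis p) :
    u * v = ⟨u.x + v.x + u.z * v.y, u.y + v.y, u.z + v.z⟩ := rfl

theorem one_def : (1 : Heis p) = ⟨0, 0, 0⟩ := rfl

/-- The generator `ρ`. -/
def rho (p : ℕ) : Heis p := ⟨1, 0, 0⟩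
/-- The generator `σ`. -/
def sigma (p : ℕ) : Heis p := ⟨0, 1, 0⟩
/-- The generator `τ`. -/
def tau (p : ℕ) : Heis p := ⟨0, 0, 1⟩

theorem rho_pow (n : ℕ) : rho p ^ n = ⟨n, 0, 0⟩ := by
  induction n with
  | zero => simp [one_def]
  | succ k ih => rw [pow_succ, ih, mul_def]; simp [rho]

theorem sigma_pow (n : ℕ) : sigma p ^ n = ⟨0, n, 0⟩ := by
  induction n with
  | zero => simp [one_def]
  | succ k ih => rw [pow_succ, ih, mul_def]; simp [sigma]

theorem tau_pow (n : ℕ) : tau p ^ n = ⟨0, 0, n⟩ := by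
  induction n with
  | zero => simp [one_def]
  | succ k ih => rw [pow_succ, ih, mul_def]; simp [tau]

/-- The defining relations hold. -/
theorem relations : rho p ^ p = 1 ∧ sigma p ^ p = 1 ∧ tau p ^ p = 1 ∧
    sigma p * rho p = rho p * sigma p ∧ tau p * rho p = rho p * tau p ∧
    tau p * sigma p = rho p * sigma p * tau p := by
  rw [rho_pow, sigma_pow, tau_pow]
  simp [one_def, mul_def, rho, sigma, tau]

/-- Every element has a normal form in the generators. -/
theorem normal_form [NeZero p] (v : Heis p) :
    v = rho p ^ v.x.val * sigma p ^ v.y.val * tau p ^ v.z.val := by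
  simp [rho_pow, sigma_pow, tau_pow, mul_def]

instance [NeZero p] : Finite (Heis p) :=
  Finite.of_injective (fun v : Heis p => (v.x, v.y, v.z)) (by
    rintro ⟨a, b, c⟩ ⟨a', b', c'⟩ h
    simpa using h)

variable [Fact p.Prime]

theorem two_ne_zero_of_lt (hp : 3 < p) : (2 : ZMod p) ≠ 0 := by
  intro h
  have h2 : ((2 : ℕ) : ZMod p) = 0 := by exact_mod_cast h
  rw [ZMod.natCast_eq_zero_iff] at h2
  have := Nat.le_of_dvd (by norm_num) h2
  omega

/-- The endomorphism with `σ ↦ ρ^b₁ σ^a₁ τ^a₃`, `τ ↦ ρ^b₂ σ^a₂ τ^a₄`, where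
`A = (a₁ a₂; a₃ a₄)`, written in normal forms. -/
def bracketHom (hp : 3 < p) (A : Matrix (Fin 2) (Fin 2) (ZMod p)) (b₁ b₂ : ZMod p) :
    Heis p →* Heis p where
  toFun v :=
    ⟨A.det * v.x + b₁ * v.y + 2⁻¹ * A 0 0 * A 1 0 * (v.y * (v.y - 1))
        + b₂ * v.z + 2⁻¹ * A 0 1 * A 1 1 * (v.z * (v.z - 1)) + A 0 1 * A 1 0 * (v.y * v.z),
      A 0 0 * v.y + A 0 1 * v.z,
      A 1 0 * v.y + A 1 1 * v.z⟩
  map_one' := by simp [one_def]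
  map_mul' u v := by
    have h2 := two_ne_zero_of_lt hp
    simp only [mul_def, Matrix.det_fin_two]
    ext
    · simp only
      field_simp
      ring
    · simp only
      ring
    · simp only
      ring

/-- The automorphism `[det A, b₁, b₂; 0, A]` of the Heisenberg group: the one with
`ρ ↦ ρ^(det A)`, `σ ↦ ρ^b₁ σ^a₁ τ^a₃`, `τ ↦ ρ^b₂ σ^a₂ τ^a₄` for `A = (a₁ a₂; a₃ a₄)`. -/
noncomputable def bracket (hp : 3 < p) (A : GL (Fin 2) (ZMod p)) (b₁ b₂ : ZMod p) :
    MulAut (Heis p) :=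
  MulEquiv.ofBijective (bracketHom hp A.val b₁ b₂) (by
    apply Function.Injective.bijective_of_finite
    rw [injective_iff_map_eq_one]
    intro v hv
    have hdet : A.val.det ≠ 0 := ((Matrix.isUnit_iff_isUnit_det _).mp A.isUnit).ne_zero
    simp only [bracketHom, MonoidHom.coe_mk, OneHom.coe_mk, one_def, Heis.mk.injEq] at hv
    obtain ⟨h1, h2, h3⟩ := hv
    have hd := Matrix.det_fin_two A.val
    have hy : v.y = 0 := by
      have : A.val.det * v.y = 0 := by
        rw [hd]
        linear_combination A.val 1 1 * h2 - A.val 0 1 * h3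
      exact (mul_eq_zero.mp this).resolve_left hdet
    have hz : v.z = 0 := by
      have : A.val.det * v.z = 0 := by
        rw [hd]
        linear_combination A.val 0 0 * h3 - A.val 1 0 * h2
      exact (mul_eq_zero.mp this).resolve_left hdet
    have hx : v.x = 0 := by
      rw [hy, hz] at h1
      have : A.val.det * v.x = 0 := by simpa using h1
      exact (mul_eq_zero.mp this).resolve_left hdet
    rw [one_def]
    ext <;> assumption)

theorem bracket_rho (hp : 3 < p) (A : GL (Fin 2) (ZMod p)) (b₁ b₂ : ZMod p) :
    bracket hp A b₁ b₂ (rho p) = ⟨A.val.det, 0, 0⟩ := by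
  simp [bracket, bracketHom, rho]

theorem bracket_sigma (hp : 3 < p) (A : GL (Fin 2) (ZMod p)) (b₁ b₂ : ZMod p) :
    bracket hp A b₁ b₂ (sigma p) = ⟨b₁, A.val 0 0, A.val 1 0⟩ := by
  simp [bracket, bracketHom, sigma]

theorem bracket_tau (hp : 3 < p) (A : GL (Fin 2) (ZMod p)) (b₁ b₂ : ZMod p) :
    bracket hp A b₁ b₂ (tau p) = ⟨b₂, A.val 0 1, A.val 1 1⟩ := by
  simp [bracket, bracketHom, tau]

/-- `α₁ : σ ↦ ρσ, τ ↦ τ`. -/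
noncomputable def alpha1 (hp : 3 < p) : MulAut (Heis p) := bracket hp 1 1 0

/-- `α₂ : σ ↦ στ, τ ↦ τ`. -/
noncomputable def alpha2 (hp : 3 < p) : MulAut (Heis p) :=
  bracket hp (Matrix.GeneralLinearGroup.mkOfDetNeZero !![1, 0; 1, 1] (by simp)) 0 0

/-- `α₃ : σ ↦ σ, τ ↦ ρτ`. -/
noncomputable def alpha3 (hp : 3 < p) : MulAut (Heis p) := bracket hp 1 0 1

/-- The automorphism corresponding to `A = (a b; c d)` in `GL₂`, namely
`[det A, ac/2, bd/2; 0, A]`. -/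
noncomputable def alphaGL (hp : 3 < p) (A : GL (Fin 2) (ZMod p)) : MulAut (Heis p) :=
  bracket hp A (A.val 0 0 * A.val 1 0 / 2) (A.val 0 1 * A.val 1 1 / 2)

/-- The subgroup `⟨ρ, τ, σ α₁^a α₂^b α₃^c⟩` of the holomorph of the Heisenberg group. -/
noncomputable def holSubgroup (hp : 3 < p) (i : ℕ × ℕ × ℕ) : Subgroup (Hol (Heis p)) :=
  Subgroup.closure {SemidirectProduct.inl (rho p), SemidirectProduct.inl (tau p),
    SemidirectProduct.inl (sigma p) *
      SemidirectProduct.inr (alpha1 hp ^ i.1 * alpha2 hp ^ i.2.1 * alpha3 hp ^ i.2.2)}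

end Heis

/-- The exponents `(a, b, c)` of the representatives `⟨ρ, τ, σα₃⟩`, `⟨ρ, τ, σα₂α₃⟩`. -/
def exponentsC : Set (ℕ × ℕ × ℕ) := {(0, 0, 1), (0, 1, 1)}

/-- The exponents `(a, b, c)` of the representatives `⟨ρ, τ, σα₁⟩`, `⟨ρ, τ, σα₂⟩` and
`⟨ρ, τ, σα₃^c⟩`, `⟨ρ, τ, σα₂α₃^c⟩` for `c = 2, …, p - 1`. -/
def exponentsM (p : ℕ) : Set (ℕ × ℕ × ℕ) :=
  {i | i = (1, 0, 0) ∨ i = (0, 1, 0) ∨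
    ∃ c : ℕ, 2 ≤ c ∧ c < p ∧ (i = (0, 0, c) ∨ i = (0, 1, c))}

/-- The elementary abelian group of order `p ^ 3`, in multiplicative notation. -/
abbrev ElemAb (p : ℕ) : Type := Multiplicative (Fin 3 → ZMod p)

/-! ### Hopf-Galois structures -/

/-- A Hopf-Galois structure on `L / K`: a finite-dimensional cocommutative `K`-Hopf algebra `H`
acting on `L` such that `L` is an `H`-module algebra and
`j : L ⊗ H → End_K(L)`, `j (x ⊗ h) (z) = x (h z)`, is bijective. -/
structure HopfGaloisStructure (K : Type u) (L : Type v) [Field K] [Field L] [Algebra K L] :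
    Type (max u (v + 1)) where
  H : Type v
  [ring : Ring H]
  [hopf : HopfAlgebra K H]
  [cocomm : Coalgebra.IsCocomm K H]
  [finite : Module.Finite K H]
  act : H →ₐ[K] Module.End K L
  act_mul : ∀ (h : H) (x y : L), act h (x * y) =
    LinearMap.mul' K L (TensorProduct.map (act.toLinearMap.flip x) (act.toLinearMap.flip y)
      (Coalgebra.comul (R := K) h))
  act_one : ∀ h : H, act h 1 = algebraMap K L (Coalgebra.counit (R := K) h)
  galois : Function.Bijective
    (LinearMap.mul' K (Module.End K L) ∘ₗ
      TensorProduct.map (Algebra.lmul K L).toLinearMap act.toLinearMap :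
        L ⊗[K] H →ₗ[K] Module.End K L)

attribute [instance] HopfGaloisStructure.ring HopfGaloisStructure.hopf
  HopfGaloisStructure.cocomm HopfGaloisStructure.finite

namespace HopfGaloisStructure

variable {K : Type u} {L : Type v} [Field K] [Field L] [Algebra K L]

/-- Two Hopf-Galois structures are the same if there is an isomorphism of Hopf algebras between
them which respects the actions on `L`. (A bialgebra isomorphism respects the antipodes.) -/
instance setoid : Setoid (HopfGaloisStructure K L) where
  r S T := ∃ e : S.H ≃ₐc[K] T.H, ∀ (h : S.H) (x : L), T.act (e h) x = S.act h x
  iseqv := by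
    refine ⟨fun S => ⟨BialgEquiv.refl K S.H, fun _ _ => rfl⟩, ?_, ?_⟩
    · rintro S T ⟨e, he⟩
      refine ⟨e.symm, fun h x => ?_⟩
      have h1 := he (e.symm h) x
      rw [← h1, BialgEquiv.apply_symm_apply]
    · rintro S T U ⟨e, he⟩ ⟨f, hf⟩
      exact ⟨e.trans f, fun h x => (hf (e h) x).trans (he h x)⟩

end HopfGaloisStructure

/-- A subgroup of `Perm X` is regular if it acts freely and transitively on `X`. -/
def IsRegularPerm {X : Type*} (N : Subgroup (Equiv.Perm X)) : Prop :=
  ∀ x y : X, ∃! n : Equiv.Perm X, n ∈ N ∧ n x = y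

/-- `N` is normalised by the left translations of `G`. -/
def IsNormalisedByLeft {G : Type*} [Group G] (N : Subgroup (Equiv.Perm G)) : Prop :=
  ∀ (g : G), ∀ n ∈ N, Equiv.mulLeft g * n * (Equiv.mulLeft g)⁻¹ ∈ N

/-- The Hopf-Galois structure `S` on `L / K`, with `G = Gal(L / K)`, is `L[N]^G`: the Hopf algebra
of `S` is isomorphic, through `ι`, to the `K`-Hopf algebra of the elements of the group algebra
`L[N]` fixed by `G`, where `G` acts on `L` by field automorphisms and on `N` by conjugation with
left translations, and `∑ c_n n` acts on `L` by `x ↦ ∑ c_n (n⁻¹(1))(x)`. -/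
def HopfGaloisStructure.IsFixedAlgebra {K : Type u} {L : Type v} [Field K] [Field L]
    [Algebra K L] (S : HopfGaloisStructure K L) (N : Subgroup (Equiv.Perm (L ≃ₐ[K] L))) : Prop :=
  ∃ ι : S.H →ₐ[K] MonoidAlgebra L N,
    Function.Injective ι ∧
    (∀ f : MonoidAlgebra L N, f ∈ Set.range ι ↔
      ∀ (g : L ≃ₐ[K] L) (n n' : N),
        (n' : Equiv.Perm (L ≃ₐ[K] L)) = Equiv.mulLeft g * n * (Equiv.mulLeft g)⁻¹ →
          f.coeff n' = g (f.coeff n)) ∧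
    (∀ h : S.H, Coalgebra.comul (R := L) (ι h) =
      TensorProduct.mapOfCompatibleSMul L K K (MonoidAlgebra L N) (MonoidAlgebra L N)
        (TensorProduct.map ι.toLinearMap ι.toLinearMap (Coalgebra.comul (R := K) h))) ∧
    (∀ h : S.H, Coalgebra.counit (R := L) (ι h) =
      algebraMap K L (Coalgebra.counit (R := K) h)) ∧
    (∀ (h : S.H) (x : L), S.act h x =
      (ι h).coeff.sum fun n c => c * ((n : Equiv.Perm (L ≃ₐ[K] L))⁻¹ 1) x)

namespace PermBrace

variable {G : Type*} [Group G]

/-- For a regular subgroup `N` of `Perm G`, the bijection `N → G`, `n ↦ n(1)`. -/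
noncomputable def orbitEquiv (N : Subgroup (Equiv.Perm G)) (hN : IsRegularPerm N) : N ≃ G :=
  Equiv.ofBijective (fun n => (n : Equiv.Perm G) 1) (by
    refine ⟨fun n m hnm => ?_, fun y => ?_⟩
    · exact Subtype.ext ((hN 1 ((n : Equiv.Perm G) 1)).unique ⟨n.2, rfl⟩ ⟨m.2, hnm.symm⟩)
    · obtain ⟨n, ⟨hn, hy⟩, _⟩ := hN 1 y
      exact ⟨⟨n, hn⟩, hy⟩)

/-- The carrier of the skew brace given by a regular subgroup `N` of `Perm G` which is normalised
by the left translations. -/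
def Carrier (N : Subgroup (Equiv.Perm G)) (_hN : IsRegularPerm N)
    (_hl : IsNormalisedByLeft N) : Type _ := G

/-- The skew brace given by a regular subgroup `N` of `Perm G` which is normalised by the left
translations: its multiplicative group is `G`, and its addition is transported from `N` along the
bijection `n ↦ n(1)`. -/
noncomputable instance (N : Subgroup (Equiv.Perm G)) (hN : IsRegularPerm N)
    (hl : IsNormalisedByLeft N) : SkewBrace (Carrier N hN hl) where
  toAddGroup := ((orbitEquiv N hN).symm.trans (Additive.ofMul : N ≃ Additive N)).addGroup
  toGroup := inferInstanceAs (Group G)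
  brace_property := fun (a b c : G) => by
    let φ : N ≃ G := orbitEquiv N hN
    have hφ : ∀ n : N, φ n = (n : Equiv.Perm G) 1 := fun n => rfl
    have hs : ∀ g : G, ((φ.symm g : N) : Equiv.Perm G) 1 = g := fun g => φ.apply_symm_apply g
    change a * φ (φ.symm b * φ.symm c) =
      φ (φ.symm (φ (φ.symm (a * b) * φ.symm (φ (φ.symm a)⁻¹))) * φ.symm (a * c))
    simp only [Equiv.symm_apply_apply]
    let m : N := ⟨_, hl a _ (φ.symm b).2⟩
    have hm : ∀ x : G, (m : Equiv.Perm G) (a * x) = a * ((φ.symm b : N) : Equiv.Perm G) x := by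
      intro x
      simp [m, Equiv.Perm.mul_apply]
    have hm2 : m * φ.symm a = φ.symm (a * b) := by
      apply φ.injective
      have h1 := hm 1
      rw [mul_one, hs b] at h1
      rw [φ.apply_symm_apply, hφ]
      change (m : Equiv.Perm G) (((φ.symm a : N) : Equiv.Perm G) 1) = _
      rw [hs a]
      exact h1
    rw [← hm2, mul_inv_cancel_right]
    change a * ((φ.symm b : N) : Equiv.Perm G) (((φ.symm c : N) : Equiv.Perm G) 1) =
      (m : Equiv.Perm G) (((φ.symm (a * c) : N) : Equiv.Perm G) 1)
    rw [hs, hs, hm]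

end PermBrace

/-- The Hopf-Galois structures on `L / K` (up to isomorphism) which are of type `M` and whose
skew brace `B` has `|Θ(B)| = r`. -/
def hopfGaloisClasses (K : Type u) (L : Type v) [Field K] [Field L] [Algebra K L]
    (M : Type*) [Group M] (r : ℕ) : Set (Quotient (HopfGaloisStructure.setoid (K := K) (L := L))) :=
  {q | ∃ S : HopfGaloisStructure K L, Quotient.mk _ S = q ∧
    ∃ (N : Subgroup (Equiv.Perm (L ≃ₐ[K] L))) (hN : IsRegularPerm N) (hl : IsNormalisedByLeft N),
      S.IsFixedAlgebra N ∧ Nonempty (N ≃* M) ∧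
        SkewBrace.thetaCard (PermBrace.Carrier N hN hl) = r}

/-!
A skew brace of type `N` is a gamma function `γ : N → Aut N`, up to conjugation by `Aut N`. On the
Heisenberg group, `|Θ| = p` makes `γ` a nontrivial map with values in a group of order `p`, and an
automorphism carries it to one that factors through the exponent `y` of `σ`, with `σ` acting by
`σ ↦ ρ^r σ τ^t`, `τ ↦ ρ^s τ`. The conditions under which an automorphism intertwines two of these
are polynomial equations in `r`, `s`, `t`; they yield the normal forms and, for equal parameters,
the automorphism groups.

By Galois descent the Hopf-Galois structures `L[N]^G` correspond to the regular subgroups `N` of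
`Perm G` normalised by the left translations. Those with skew brace `B` are parametrised by the
isomorphisms `G ≃* B` modulo the automorphisms of `B`, so there are `|Aut G| / |Aut B|` of them.
-/

section GaloisDescent

variable {K L V A : Type*} [Field K] [Field L] [Algebra K L] [AddCommGroup V] [Module K V]
  [Module L V] [IsScalarTower K L V] [AddCommGroup A] [Module K A]

theorem isBaseChange_of_linearIndependent_of_span_eq_top {ι : Type*} {f : A →ₗ[K] V}
    (b : Module.Basis ι K A) (hli : LinearIndependent L (f ∘ b))
    (hsp : Submodule.span L (Set.range f) = ⊤) : IsBaseChange L f := by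
  have hspan : ⊤ ≤ Submodule.span L (Set.range (f ∘ b)) := by
    rw [← hsp, Submodule.span_le]
    rintro _ ⟨a, rfl⟩
    have ha : f a ∈ Submodule.span K (Set.range (f ∘ b)) := by
      rw [Set.range_comp, Submodule.span_image, b.span_eq]
      exact Submodule.mem_map_of_mem Submodule.mem_top
    exact Submodule.span_le_restrictScalars K L _ ha
  refine IsBaseChange.of_equiv
    ((b.baseChange L).equiv (Module.Basis.mk hli hspan) (Equiv.refl ι)) fun a => ?_
  let e := (b.baseChange L).equiv (Module.Basis.mk hli hspan) (Equiv.refl ι)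
  suffices e.toLinearMap.restrictScalars K ∘ₗ TensorProduct.mk K L A 1 = f from
    LinearMap.congr_fun this a
  refine b.ext fun i => ?_
  simpa using (b.baseChange L).equiv_apply i (Module.Basis.mk hli hspan) (Equiv.refl ι)

theorem injective_of_isBaseChange {f : A →ₗ[K] V} (hf : IsBaseChange L f) :
    Function.Injective f := by
  have : ⇑f = hf.equiv ∘ TensorProduct.mk K L A 1 := by
    ext a
    simp
  rw [this]
  exact hf.equiv.injective.comp (Module.Flat.tensorProduct_mk_injective K A L)

theorem semilinearMap_ext_of_isBaseChange {W : Type*} [AddCommGroup W] [Module L W] {σ : L →+* L}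
    {f : A →ₗ[K] V} (hf : IsBaseChange L f) {S T : V →ₛₗ[σ] W} (h : ∀ a, S (f a) = T (f a)) :
    S = T := by
  ext v
  refine hf.inductionOn v _ ?_ h (fun c v hv => ?_) fun v w hv hw => ?_
  · rw [map_zero, map_zero]
  · rw [map_smulₛₗ, map_smulₛₗ, hv]
  · rw [map_add, map_add, hv, hw]

theorem mem_range_of_isBaseChange [FiniteDimensional K L] [IsGalois K L] {f : A →ₗ[K] V}
    (hf : IsBaseChange L f) (T : (g : L ≃ₐ[K] L) → V →ₛₗ[(g : L →+* L)] V)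
    (hT : ∀ g a, T g (f a) = f a) {v : V} (hv : ∀ g, T g v = v) : v ∈ Set.range f := by
  let b := Module.Free.chooseBasis K A
  let B := hf.basis b
  have hB (i) : B i = f (b i) := hf.basis_apply b i
  have hcoord (i) : B.repr v i ∈ Set.range (algebraMap K L) := by
    rw [IsGalois.mem_range_algebraMap_iff_fixed]
    intro g
    have hmap : (B.repr v).sum (fun j c => Finsupp.single j (g c)) = B.repr v := by
      apply B.repr.symm.injective
      conv_rhs => rw [B.repr.symm_apply_apply, ← hv g, ← B.linearCombination_repr v]
      simp only [Finsupp.linearCombination_apply, Finsupp.sum, map_sum, map_smulₛₗ, hB, hT]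
      simp [hB]
    conv_rhs => rw [← hmap]
    simp [Finsupp.sum_apply, Finsupp.single_apply]
  choose c hc using hcoord
  rw [← LinearMap.coe_range, SetLike.mem_coe, ← B.linearCombination_repr v,
    Finsupp.linearCombination_apply]
  refine Submodule.sum_mem _ fun i _ => ?_
  simp only [← hc, hB, algebraMap_smul]
  exact Submodule.smul_mem _ _ ⟨b i, rfl⟩

variable (K L V) in
/-- A semilinear action of the automorphism group of `L / K` on an `L`-vector space `V`, the datum
from which Galois descent reconstructs a `K`-form of `V`. -/
structure SemilinearAction where
  map : (g : L ≃ₐ[K] L) → V →ₛₗ[(g : L →+* L)] V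
  map_one : ∀ v, map 1 v = v
  map_mul : ∀ g h v, map (g * h) v = map g (map h v)

namespace SemilinearAction

variable (ρ : SemilinearAction K L V)

/-- The `K`-subspace of the vectors fixed by a semilinear action, i.e. the `K`-form of `V`. -/
def fixed : Submodule K V where
  carrier := {v | ∀ g, ρ.map g v = v}
  add_mem' hv hw g := by rw [_root_.map_add, hv g, hw g]
  zero_mem' g := map_zero _
  smul_mem' c v hv g := by
    rw [← algebraMap_smul L c v, map_smulₛₗ, hv g]
    simp

theorem sum_smul_map_mem_fixed [FiniteDimensional K L] (c : L) (v : V) :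
    ∑ g : L ≃ₐ[K] L, g c • ρ.map g v ∈ ρ.fixed := by
  intro h
  rw [map_sum]
  refine Fintype.sum_equiv (Equiv.mulLeft h) _ _ fun g => ?_
  rw [map_smulₛₗ, ← ρ.map_mul]
  rfl

/- Apply `Tr (z · _)` to the coefficients of a relation over `L`: the result is a relation over `K`,
and the trace form is nondegenerate. -/
theorem linearIndependent_of_mem_fixed [FiniteDimensional K L] [IsGalois K L] {ι : Type*}
    {v : ι → V} (hv : ∀ i, v i ∈ ρ.fixed) (h : LinearIndependent K v) : LinearIndependent L v := by
  rw [linearIndependent_iff'] at h ⊢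
  intro s c hc i hi
  have hrel (z : L) (g : L ≃ₐ[K] L) : ∑ j ∈ s, g (z * c j) • v j = 0 := by
    rw [← map_zero (ρ.map g), ← smul_zero z, ← hc, Finset.smul_sum, map_sum]
    refine Finset.sum_congr rfl fun j _ => ?_
    rw [smul_smul, map_smulₛₗ, hv j g]
    rfl
  have htrace (z : L) : Algebra.trace K L (z * c i) = 0 := by
    refine h s (fun j => Algebra.trace K L (z * c j)) ?_ i hi
    simp_rw [← algebraMap_smul L (Algebra.trace K L _), trace_eq_sum_automorphisms,
      Finset.sum_smul]
    rw [Finset.sum_comm]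
    exact Finset.sum_eq_zero fun g _ => hrel z g
  refine (traceForm_nondegenerate K L).2 (c i) fun z => ?_
  rw [Algebra.traceForm_apply, htrace]

/- A functional which kills the averages `∑ g c • ρ g v` for all `c` kills each `ρ g v`, by
Dedekind's independence of the automorphisms `g`. -/
theorem span_fixed [FiniteDimensional K L] : Submodule.span L (ρ.fixed : Set V) = ⊤ := by
  by_contra hne
  obtain ⟨φ, hφ, hle⟩ := Submodule.exists_le_ker_of_lt_top _ (lt_top_iff_ne_top.mpr hne)
  refine hφ (LinearMap.ext fun v => ?_)
  have hind := linearIndependent_toLinearMap K L L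
  have hind := hind.comp _ (algEquivEquivAlgHom K L).injective
  rw [Fintype.linearIndependent_iff] at hind
  have h1 := hind (fun g => φ (ρ.map g v)) (LinearMap.ext fun c => ?_) 1
  · rwa [ρ.map_one] at h1
  · have := hle (Submodule.subset_span (ρ.sum_smul_map_mem_fixed c v))
    rw [LinearMap.mem_ker, map_sum] at this
    rw [LinearMap.sum_apply, LinearMap.zero_apply, ← this]
    refine Finset.sum_congr rfl fun g _ => ?_
    rw [map_smul, smul_eq_mul, mul_comm]
    rfl

theorem isBaseChange_subtype_fixed [FiniteDimensional K L] [IsGalois K L] :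
    IsBaseChange L ρ.fixed.subtype := by
  let b := Module.Free.chooseBasis K ρ.fixed
  refine isBaseChange_of_linearIndependent_of_span_eq_top b
    (ρ.linearIndependent_of_mem_fixed (fun i => (b i).2)
      (b.linearIndependent.map' _ (Submodule.ker_subtype _))) ?_
  rw [Submodule.coe_subtype, Subtype.range_coe, ρ.span_fixed]

end SemilinearAction

end GaloisDescent

section TensorForm

variable {K : Type*} (L : Type*) [Field K] [Field L] [Algebra K L]
  {A B C V W X : Type*} [AddCommGroup A] [Module K A] [AddCommGroup B] [Module K B]
  [AddCommGroup C] [Module K C] [AddCommGroup V] [Module K V] [Module L V] [IsScalarTower K L V]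
  [AddCommGroup W] [Module K W] [Module L W] [IsScalarTower K L W]
  [AddCommGroup X] [Module K X] [Module L X] [IsScalarTower K L X]

/-- For `K`-forms `f : A → V` and `g : B → W` of `L`-vector spaces, the `K`-form
`A ⊗[K] B → V ⊗[L] W` of their tensor product. -/
noncomputable def tensorForm (f : A →ₗ[K] V) (g : B →ₗ[K] W) : A ⊗[K] B →ₗ[K] V ⊗[L] W :=
  TensorProduct.mapOfCompatibleSMul L K K V W ∘ₗ TensorProduct.map f g

variable {L}

@[simp]
theorem tensorForm_tmul (f : A →ₗ[K] V) (g : B →ₗ[K] W) (a : A) (b : B) :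
    tensorForm L f g (a ⊗ₜ b) = f a ⊗ₜ g b := rfl

theorem isBaseChange_tensorForm {f : A →ₗ[K] V} {g : B →ₗ[K] W} (hf : IsBaseChange L f)
    (hg : IsBaseChange L g) : IsBaseChange L (tensorForm L f g) := by
  let e := TensorProduct.AlgebraTensorModule.distribBaseChange K L A B ≪≫ₗ
    TensorProduct.congr hf.equiv hg.equiv
  refine IsBaseChange.of_equiv e fun t => ?_
  induction t with
  | zero => simp
  | add s t hs ht => rw [TensorProduct.tmul_add, map_add, map_add, hs, ht]
  | tmul a b => simp [e]

theorem tensorForm_map {A' B' V' W' : Type*} [AddCommGroup A'] [Module K A'] [AddCommGroup B']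
    [Module K B'] [AddCommGroup V'] [Module K V'] [Module L V'] [IsScalarTower K L V']
    [AddCommGroup W'] [Module K W'] [Module L W'] [IsScalarTower K L W']
    {f : A →ₗ[K] V} {g : B →ₗ[K] W} {f' : A' →ₗ[K] V'} {g' : B' →ₗ[K] W'}
    {a : A →ₗ[K] A'} {b : B →ₗ[K] B'} {σ : L →+* L} {v : V →ₛₗ[σ] V'} {w : W →ₛₗ[σ] W'}
    (hv : ∀ x, f' (a x) = v (f x)) (hw : ∀ y, g' (b y) = w (g y)) (t : A ⊗[K] B) :
    tensorForm L f' g' (TensorProduct.map a b t) = TensorProduct.map v w (tensorForm L f g t) := by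
  induction t with
  | zero => simp
  | add s t hs ht => simp only [map_add, hs, ht]
  | tmul x y => simp [hv, hw]

theorem tensorForm_rTensor {f : A →ₗ[K] V} {f' : C →ₗ[K] X} {a : A →ₗ[K] C} {v : V →ₗ[L] X}
    (hv : ∀ x, f' (a x) = v (f x)) (g : B →ₗ[K] W) (t : A ⊗[K] B) :
    tensorForm L f' g (a.rTensor B t) = v.rTensor W (tensorForm L f g t) :=
  tensorForm_map (σ := .id L) (b := .id) (w := .id) hv (fun _ => rfl) t

theorem tensorForm_lTensor {g : B →ₗ[K] W} {g' : C →ₗ[K] X} {b : B →ₗ[K] C} {w : W →ₗ[L] X}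
    (hw : ∀ y, g' (b y) = w (g y)) (f : A →ₗ[K] V) (t : A ⊗[K] B) :
    tensorForm L f g' (b.lTensor A t) = w.lTensor V (tensorForm L f g t) :=
  tensorForm_map (σ := .id L) (f := f) (f' := f) (a := .id) (v := .id) (fun _ => rfl) hw t

theorem tensorForm_assoc (f : A →ₗ[K] V) (g : B →ₗ[K] W) (h : C →ₗ[K] X)
    (t : (A ⊗[K] B) ⊗[K] C) :
    tensorForm L f (tensorForm L g h) (TensorProduct.assoc K A B C t) =
      TensorProduct.assoc L V W X (tensorForm L (tensorForm L f g) h t) := by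
  suffices tensorForm L f (tensorForm L g h) ∘ₗ (TensorProduct.assoc K A B C).toLinearMap =
      (TensorProduct.assoc L V W X).toLinearMap.restrictScalars K ∘ₗ
        tensorForm L (tensorForm L f g) h from LinearMap.congr_fun this t
  ext a b c
  rfl

theorem tensorForm_comm (f : A →ₗ[K] V) (g : B →ₗ[K] W) (t : A ⊗[K] B) :
    tensorForm L g f (TensorProduct.comm K A B t) =
      TensorProduct.comm L V W (tensorForm L f g t) := by
  induction t with
  | zero => simp
  | add s t hs ht => simp only [map_add, hs, ht]
  | tmul a b => rfl

theorem lid_tensorForm (f : A →ₗ[K] V) (t : K ⊗[K] A) :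
    TensorProduct.lid L V (tensorForm L (Algebra.linearMap K L) f t) =
      f (TensorProduct.lid K A t) := by
  induction t with
  | zero => simp
  | add s t hs ht => simp only [map_add, hs, ht]
  | tmul c a => simp

theorem rid_tensorForm (f : A →ₗ[K] V) (t : A ⊗[K] K) :
    TensorProduct.rid L V (tensorForm L f (Algebra.linearMap K L) t) =
      f (TensorProduct.rid K A t) := by
  induction t with
  | zero => simp
  | add s t hs ht => simp only [map_add, hs, ht]
  | tmul a c => simp

end TensorForm

section HopfForm

variable {K : Type*} (L : Type*) [Field K] [Field L] [Algebra K L] {A H : Type*} [Ring A]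
  [Algebra K A] [Ring H] [HopfAlgebra L H] [Algebra K H] [IsScalarTower K L H]

theorem tensorForm_mul (ι : A →ₐ[K] H) (s t : A ⊗[K] A) :
    tensorForm L ι.toLinearMap ι.toLinearMap (s * t) =
      tensorForm L ι.toLinearMap ι.toLinearMap s * tensorForm L ι.toLinearMap ι.toLinearMap t :=
  map_mul ((Algebra.TensorProduct.mapOfCompatibleSMul L K K H H).comp
    (Algebra.TensorProduct.map ι ι)) s t

theorem mul'_tensorForm (ι : A →ₐ[K] H) (t : A ⊗[K] A) :
    LinearMap.mul' L H (tensorForm L ι.toLinearMap ι.toLinearMap t) =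
      ι (LinearMap.mul' K A t) := by
  induction t with
  | zero => simp
  | add s t hs ht => simp only [map_add, hs, ht]
  | tmul a b => simp

/-- A `K`-algebra map `ι : A → H` to an `L`-Hopf algebra is a `K`-form of `H` if it induces
`L ⊗[K] A ≅ H` and the structure maps of `H` are defined over `K`. -/
structure IsHopfForm (ι : A →ₐ[K] H) : Prop where
  isBaseChange : IsBaseChange L ι.toLinearMap
  comul_mem (a : A) : Coalgebra.comul (R := L) (ι a) ∈
    LinearMap.range (tensorForm L ι.toLinearMap ι.toLinearMap)
  counit_mem (a : A) : Coalgebra.counit (R := L) (ι a) ∈ LinearMap.range (Algebra.linearMap K L)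
  antipode_mem (a : A) : HopfAlgebra.antipode L (ι a) ∈ LinearMap.range ι.toLinearMap

namespace IsHopfForm

variable {L} {ι : A →ₐ[K] H} (hι : IsHopfForm L ι)

include hι

theorem injective : Function.Injective ι := injective_of_isBaseChange hι.isBaseChange

theorem tensorForm_injective :
    Function.Injective (tensorForm L ι.toLinearMap ι.toLinearMap) :=
  injective_of_isBaseChange (isBaseChange_tensorForm hι.isBaseChange hι.isBaseChange)

omit hι in
theorem linearMap_injective : Function.Injective (Algebra.linearMap K L) :=
  FaithfulSMul.algebraMap_injective K L

/-- The comultiplication of a `K`-form of a Hopf algebra. -/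
noncomputable def comul : A →ₗ[K] A ⊗[K] A :=
  (((Coalgebra.comul (R := L) (A := H)).restrictScalars K) ∘ₗ ι.toLinearMap).codRestrictOfInjective
    _ hι.tensorForm_injective hι.comul_mem

theorem tensorForm_comul (a : A) : tensorForm L ι.toLinearMap ι.toLinearMap (hι.comul a) =
    Coalgebra.comul (R := L) (ι a) :=
  LinearMap.codRestrictOfInjective_comp_apply _ _ hι.tensorForm_injective hι.comul_mem a

/-- The counit of a `K`-form of a Hopf algebra. -/
noncomputable def counit : A →ₗ[K] K :=
  (((Coalgebra.counit (R := L) (A := H)).restrictScalars K) ∘ₗ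
    ι.toLinearMap).codRestrictOfInjective _ linearMap_injective hι.counit_mem

theorem algebraMap_counit (a : A) :
    Algebra.linearMap K L (hι.counit a) = Coalgebra.counit (R := L) (ι a) :=
  LinearMap.codRestrictOfInjective_comp_apply _ _ linearMap_injective hι.counit_mem a

theorem comul_one : hι.comul 1 = 1 := by
  apply hι.tensorForm_injective
  rw [hι.tensorForm_comul, map_one, Bialgebra.comul_one]
  rw [Algebra.TensorProduct.one_def, Algebra.TensorProduct.one_def, tensorForm_tmul]
  simp

theorem comul_mul (a b : A) : hι.comul (a * b) = hι.comul a * hι.comul b := by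
  apply hι.tensorForm_injective
  simp only [tensorForm_mul, hι.tensorForm_comul, map_mul, Bialgebra.comul_mul]

theorem counit_one : hι.counit 1 = 1 := by
  apply linearMap_injective (K := K) (L := L)
  rw [hι.algebraMap_counit, map_one, Bialgebra.counit_one, Algebra.linearMap_apply, map_one]

theorem counit_mul (a b : A) : hι.counit (a * b) = hι.counit a * hι.counit b := by
  apply linearMap_injective (K := K) (L := L)
  rw [hι.algebraMap_counit, map_mul, Bialgebra.counit_mul, ← hι.algebraMap_counit,
    ← hι.algebraMap_counit, Algebra.linearMap_apply, Algebra.linearMap_apply,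
    Algebra.linearMap_apply, map_mul]

/-- The antipode of a `K`-form of a Hopf algebra. -/
noncomputable def antipode : A →ₗ[K] A :=
  (((HopfAlgebra.antipode L (A := H)).restrictScalars K) ∘ₗ ι.toLinearMap).codRestrictOfInjective
    ι.toLinearMap hι.injective hι.antipode_mem

theorem apply_antipode (a : A) :
    ι.toLinearMap (hι.antipode a) = HopfAlgebra.antipode L (ι.toLinearMap a) :=
  LinearMap.codRestrictOfInjective_comp_apply _ ι.toLinearMap hι.injective hι.antipode_mem a

theorem coassoc (a : A) : TensorProduct.assoc K A A A (hι.comul.rTensor A (hι.comul a)) =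
    hι.comul.lTensor A (hι.comul a) := by
  apply injective_of_isBaseChange (isBaseChange_tensorForm hι.isBaseChange
    (isBaseChange_tensorForm hι.isBaseChange hι.isBaseChange))
  rw [tensorForm_assoc,
    tensorForm_rTensor (L := L) (f := ι.toLinearMap) (v := Coalgebra.comul) hι.tensorForm_comul,
    tensorForm_lTensor (g := ι.toLinearMap) (w := Coalgebra.comul) hι.tensorForm_comul,
    hι.tensorForm_comul]
  exact Coalgebra.coassoc_apply (ι a)

theorem rTensor_counit_comul (a : A) : hι.counit.rTensor A (hι.comul a) = 1 ⊗ₜ a := by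
  apply (TensorProduct.lid K A).injective
  apply hι.injective
  have h := lid_tensorForm (L := L) ι.toLinearMap (hι.counit.rTensor A (hι.comul a))
  rw [tensorForm_rTensor (f := ι.toLinearMap) (v := Coalgebra.counit) hι.algebraMap_counit,
    hι.tensorForm_comul, Coalgebra.rTensor_counit_comul] at h
  simpa using h.symm

theorem lTensor_counit_comul (a : A) : hι.counit.lTensor A (hι.comul a) = a ⊗ₜ 1 := by
  apply (TensorProduct.rid K A).injective
  apply hι.injective
  have h := rid_tensorForm (L := L) ι.toLinearMap (hι.counit.lTensor A (hι.comul a))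
  rw [tensorForm_lTensor (g := ι.toLinearMap) (w := Coalgebra.counit) hι.algebraMap_counit,
    hι.tensorForm_comul, Coalgebra.lTensor_counit_comul] at h
  simpa using h.symm

theorem mul'_rTensor_antipode_comul (a : A) :
    LinearMap.mul' K A (hι.antipode.rTensor A (hι.comul a)) =
      algebraMap K A (hι.counit a) := by
  apply hι.injective
  rw [← mul'_tensorForm L, tensorForm_rTensor hι.apply_antipode, hι.tensorForm_comul,
    HopfAlgebra.mul_antipode_rTensor_comul_apply, ← hι.algebraMap_counit, ι.commutes,
    Algebra.linearMap_apply, ← IsScalarTower.algebraMap_apply]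

theorem mul'_lTensor_antipode_comul (a : A) :
    LinearMap.mul' K A (hι.antipode.lTensor A (hι.comul a)) =
      algebraMap K A (hι.counit a) := by
  apply hι.injective
  rw [← mul'_tensorForm L, tensorForm_lTensor hι.apply_antipode, hι.tensorForm_comul,
    HopfAlgebra.mul_antipode_lTensor_comul_apply, ← hι.algebraMap_counit, ι.commutes,
    Algebra.linearMap_apply, ← IsScalarTower.algebraMap_apply]

/-- The coalgebra structure of a `K`-form of a Hopf algebra. -/
noncomputable abbrev coalgebra : Coalgebra K A where
  comul := hι.comul
  counit := hι.counit
  coassoc := LinearMap.ext hι.coassoc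
  rTensor_counit_comp_comul := LinearMap.ext hι.rTensor_counit_comul
  lTensor_counit_comp_comul := LinearMap.ext hι.lTensor_counit_comul

/-- The Hopf algebra structure of a `K`-form of a Hopf algebra. -/
noncomputable abbrev hopfAlgebra : HopfAlgebra K A where
  toBialgebra :=
    letI := hι.coalgebra
    Bialgebra.mk' K A
      hι.counit_one (hι.counit_mul _ _) hι.comul_one (hι.comul_mul _ _)
  antipode := hι.antipode
  mul_antipode_rTensor_comul := LinearMap.ext hι.mul'_rTensor_antipode_comul
  mul_antipode_lTensor_comul := LinearMap.ext hι.mul'_lTensor_antipode_comul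

theorem isCocomm [Coalgebra.IsCocomm L H] :
    letI := hι.hopfAlgebra
    Coalgebra.IsCocomm K A := by
  let := hι.hopfAlgebra
  refine ⟨LinearMap.ext fun a => hι.tensorForm_injective ?_⟩
  calc tensorForm L ι.toLinearMap ι.toLinearMap (TensorProduct.comm K A A (hι.comul a))
      = TensorProduct.comm L H H (Coalgebra.comul (ι a)) := by
        rw [tensorForm_comm, hι.tensorForm_comul]
    _ = tensorForm L ι.toLinearMap ι.toLinearMap (hι.comul a) := by
        rw [Coalgebra.comm_comul, hι.tensorForm_comul]

end IsHopfForm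

end HopfForm

section GroupAlgebra

open MonoidAlgebra

variable {K L N : Type*} [Field K] [Field L] [Algebra K L] [Group N]

/-- The semilinear action on the group algebra `L[N]` by the Galois action on the coefficients and
an action `φ` on the group `N`. -/
noncomputable def groupAlgebraAction (φ : (L ≃ₐ[K] L) →* MulAut N) :
    SemilinearAction K L (MonoidAlgebra L N) where
  map g :=
    { toFun f := mapDomainRingHom L (φ g : N →* N) (mapRingHom N (g : L →+* L) f)
      map_add' f f' := by rw [map_add, map_add]
      map_smul' c f := by
        induction f using MonoidAlgebra.induction_linear with
        | zero => simp
        | add f f' hf hf' => simp only [smul_add, map_add, hf, hf']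
        | single n d => simp }
  map_one f := by
    induction f using MonoidAlgebra.induction_linear with
    | zero => simp
    | add f f' hf hf' => rw [map_add, hf, hf']
    | single n d => simp
  map_mul g h f := by
    induction f using MonoidAlgebra.induction_linear with
    | zero => simp
    | add f f' hf hf' => simp only [map_add, hf, hf']
    | single n d => simp

variable (φ : (L ≃ₐ[K] L) →* MulAut N)

@[simp]
theorem groupAlgebraAction_single (g : L ≃ₐ[K] L) (n : N) (c : L) :
    (groupAlgebraAction φ).map g (single n c) = single (φ g n) (g c) := by
  simp [groupAlgebraAction]

theorem coeff_groupAlgebraAction (g : L ≃ₐ[K] L) (f : MonoidAlgebra L N) (n : N) :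
    ((groupAlgebraAction φ).map g f).coeff (φ g n) = g (f.coeff n) := by
  induction f using MonoidAlgebra.induction_linear with
  | zero => simp
  | add f f' hf hf' => simp [hf, hf']
  | single m d => classical simp [Finsupp.single_apply, apply_ite g]

theorem groupAlgebraAction_map_one (g : L ≃ₐ[K] L) :
    (groupAlgebraAction φ).map g (1 : MonoidAlgebra L N) = 1 := by
  simp [MonoidAlgebra.one_def]

theorem groupAlgebraAction_map_mul (g : L ≃ₐ[K] L) (f f' : MonoidAlgebra L N) :
    (groupAlgebraAction φ).map g (f * f') =
      (groupAlgebraAction φ).map g f * (groupAlgebraAction φ).map g f' :=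
  map_mul ((mapDomainRingHom L (φ g : N →* N)).comp (mapRingHom N (g : L →+* L))) f f'

theorem comul_groupAlgebraAction (g : L ≃ₐ[K] L) (f : MonoidAlgebra L N) :
    Coalgebra.comul (R := L) ((groupAlgebraAction φ).map g f) =
      TensorProduct.map ((groupAlgebraAction φ).map g) ((groupAlgebraAction φ).map g)
        (Coalgebra.comul (R := L) f) := by
  induction f using MonoidAlgebra.induction_linear with
  | zero => simp
  | add f f' hf hf' => simp only [map_add, hf, hf']
  | single n c => simp [comul_single]

theorem counit_groupAlgebraAction (g : L ≃ₐ[K] L) (f : MonoidAlgebra L N) :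
    Coalgebra.counit (R := L) ((groupAlgebraAction φ).map g f) =
      g (Coalgebra.counit (R := L) f) := by
  induction f using MonoidAlgebra.induction_linear with
  | zero => simp
  | add f f' hf hf' => simp only [map_add, hf, hf']
  | single n c => simp [counit_single]

theorem antipode_groupAlgebraAction (g : L ≃ₐ[K] L) (f : MonoidAlgebra L N) :
    HopfAlgebra.antipode L ((groupAlgebraAction φ).map g f) =
      (groupAlgebraAction φ).map g (HopfAlgebra.antipode L f) := by
  induction f using MonoidAlgebra.induction_linear with
  | zero => simp
  | add f f' hf hf' => simp only [map_add, hf, hf']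
  | single n c => simp [antipode_single]

/-- The fixed algebra `L[N]^G` of the Galois group `G` of `L / K`, acting on the coefficients and
through `φ` on `N`. -/
noncomputable def fixedAlgebra : Subalgebra K (MonoidAlgebra L N) :=
  (groupAlgebraAction φ).fixed.toSubalgebra
    (fun g => groupAlgebraAction_map_one φ g)
    (fun f f' hf hf' g => by rw [groupAlgebraAction_map_mul, hf g, hf' g])

theorem mem_fixedAlgebra {f : MonoidAlgebra L N} :
    f ∈ fixedAlgebra φ ↔ ∀ g n, f.coeff (φ g n) = g (f.coeff n) := by
  refine forall_congr' fun g => ⟨fun hf n => ?_, fun hf => ?_⟩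
  · rw [← coeff_groupAlgebraAction φ, hf]
  · ext n
    obtain ⟨m, rfl⟩ := (φ g).surjective n
    rw [coeff_groupAlgebraAction, hf]

theorem isHopfForm_fixedAlgebra [FiniteDimensional K L] [IsGalois K L] :
    IsHopfForm L (fixedAlgebra φ).val := by
  have hbc : IsBaseChange L (fixedAlgebra φ).val.toLinearMap :=
    (groupAlgebraAction φ).isBaseChange_subtype_fixed
  have hfix (g : L ≃ₐ[K] L) (a : fixedAlgebra φ) : (groupAlgebraAction φ).map g a = a := a.2 g
  refine ⟨hbc, fun a => ?_, fun a => ?_, fun a => ?_⟩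
  · refine mem_range_of_isBaseChange (isBaseChange_tensorForm hbc hbc)
      (fun g => TensorProduct.map ((groupAlgebraAction φ).map g) ((groupAlgebraAction φ).map g))
      (fun g t => ?_) fun g => ?_
    · have h (a : fixedAlgebra φ) : (fixedAlgebra φ).val.toLinearMap (LinearMap.id (R := K) a) =
          (groupAlgebraAction φ).map g a := (hfix g a).symm
      exact (tensorForm_map h h t).symm.trans (by rw [TensorProduct.map_id, LinearMap.id_apply])
    · rw [← comul_groupAlgebraAction, Subalgebra.val_apply, hfix]
  · refine (IsGalois.mem_range_algebraMap_iff_fixed _).2 fun g => ?_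
    rw [← counit_groupAlgebraAction φ, Subalgebra.val_apply, hfix]
  · refine mem_range_of_isBaseChange hbc (groupAlgebraAction φ).map hfix fun g => ?_
    rw [← antipode_groupAlgebraAction, Subalgebra.val_apply, hfix]

end GroupAlgebra

section LeftTranslations

variable {G : Type*} [Group G] {N : Subgroup (Equiv.Perm G)}

/-- The action of `G` on a group of permutations of `G` by conjugation with left translations. -/
def conjLeft (hl : IsNormalisedByLeft N) : G →* MulAut N where
  toFun g :=
    { toFun n := ⟨Equiv.mulLeft g * n * (Equiv.mulLeft g)⁻¹, hl g n n.2⟩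
      invFun n := ⟨Equiv.mulLeft g⁻¹ * n * (Equiv.mulLeft g⁻¹)⁻¹, hl g⁻¹ n n.2⟩
      left_inv n := by ext; simp
      right_inv n := by ext; simp
      map_mul' m n := by ext; simp }
  map_one' := by ext; simp
  map_mul' g h := by ext; simp [mul_assoc]

theorem coe_conjLeft (hl : IsNormalisedByLeft N) (g : G) (n : N) :
    (conjLeft hl g n : Equiv.Perm G) = Equiv.mulLeft g * n * (Equiv.mulLeft g)⁻¹ := rfl

/-- The element `n⁻¹(1)` of `G` through which the permutation `n` acts in a Hopf-Galois
structure. -/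
def invApplyOne (n : N) : G := (n : Equiv.Perm G)⁻¹ 1

theorem invApplyOne_bijective (hN : IsRegularPerm N) :
    Function.Bijective (invApplyOne : N → G) :=
  (PermBrace.orbitEquiv N hN).bijective.comp (Equiv.inv N).bijective

theorem inv_apply_eq_mul_invApplyOne (hl : IsNormalisedByLeft N) (n : N) (g : G) :
    (n : Equiv.Perm G)⁻¹ g = g * invApplyOne (conjLeft hl g⁻¹ n) := by
  rw [invApplyOne, coe_conjLeft]
  simp

theorem invApplyOne_mul_conjLeft (hl : IsNormalisedByLeft N) (n m : N) :
    invApplyOne (n * conjLeft hl (invApplyOne n) m) = invApplyOne n * invApplyOne m := by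
  have h := inv_apply_eq_mul_invApplyOne hl (conjLeft hl (invApplyOne n) m) (invApplyOne n)
  rw [← MulAut.mul_apply, ← map_mul, inv_mul_cancel, map_one, MulAut.one_apply] at h
  rw [← h]
  simp [invApplyOne]

theorem eq_of_conjLeft_equivariant {N' : Subgroup (Equiv.Perm G)} {hl : IsNormalisedByLeft N}
    {hl' : IsNormalisedByLeft N'} (β : N ≃ N') (hβ : ∀ n, invApplyOne (β n) = invApplyOne n)
    (hconj : ∀ g n, β (conjLeft hl g n) = conjLeft hl' g (β n)) : N = N' := by
  have hval (n : N) : (β n : Equiv.Perm G) = n := by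
    refine inv_injective (Equiv.ext fun g => ?_)
    rw [inv_apply_eq_mul_invApplyOne hl', ← hconj, hβ, ← inv_apply_eq_mul_invApplyOne]
  ext n
  constructor
  · intro hn
    have hmem := (β ⟨n, hn⟩).2
    rwa [hval] at hmem
  · intro hn
    have hmem := (β.symm ⟨n, hn⟩).2
    rwa [← hval, β.apply_symm_apply] at hmem

end LeftTranslations

section HopfGalois

open MonoidAlgebra

variable {K : Type u} {L : Type v} [Field K] [Field L] [Algebra K L]

/-- The action on `L` of the group algebra `L[N]` of a group of permutations of the Galois group:
the permutation `n` acts as the automorphism `n⁻¹(1)`. It is multiplicative on `L[N]^G` only. -/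
noncomputable def permAction (N : Subgroup (Equiv.Perm (L ≃ₐ[K] L))) :
    MonoidAlgebra L N →ₗ[L] Module.End K L :=
  Finsupp.linearCombination L (fun n : N => (invApplyOne n).toLinearMap) ∘ₗ
    (coeffLinearEquiv L).toLinearMap

variable {N : Subgroup (Equiv.Perm (L ≃ₐ[K] L))}

theorem permAction_apply (f : MonoidAlgebra L N) (x : L) :
    permAction N f x = f.coeff.sum fun n c => c * invApplyOne n x := by
  simp [permAction, Finsupp.linearCombination_apply, Finsupp.sum]

@[simp]
theorem permAction_single (n : N) (c x : L) :
    permAction N (single n c) x = c * invApplyOne n x := by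
  simp [permAction_apply]

theorem permAction_one : permAction N 1 = 1 := by
  ext x
  simp [MonoidAlgebra.one_def, invApplyOne]

theorem permAction_bijective [FiniteDimensional K L] [IsGalois K L] (hN : IsRegularPerm N) :
    Function.Bijective (permAction N) := by
  have hind : LinearIndependent L fun n : N => (invApplyOne n).toLinearMap :=
    (linearIndependent_toLinearMap K L L).comp
      (fun n : N => ((invApplyOne n : L ≃ₐ[K] L) : L →ₐ[K] L))
      ((algEquivEquivAlgHom K L).injective.comp (invApplyOne_bijective hN).injective)
  have hinj : Function.Injective (permAction N) :=
    Function.Injective.comp (g := Finsupp.linearCombination L _) hind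
      (coeffLinearEquiv L).injective
  refine ⟨hinj, (LinearMap.injective_iff_surjective_of_finrank_eq_finrank ?_).mp hinj⟩
  have := Fintype.ofFinite N
  rw [(coeffLinearEquiv L).finrank_eq, Module.finrank_finsupp_self, Module.finrank_linearMap_self,
    ← IsGalois.card_aut_eq_finrank K L, Fintype.card_eq_nat_card,
    Nat.card_congr (Equiv.ofBijective _ (invApplyOne_bijective hN))]

theorem permAction_single_mul (hl : IsNormalisedByLeft N) (n : N) (c : L)
    (f : MonoidAlgebra L N) :
    permAction N (single n c * (groupAlgebraAction (conjLeft hl)).map (invApplyOne n) f) =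
      permAction N (single n c) * permAction N f := by
  induction f using MonoidAlgebra.induction_linear with
  | zero => simp
  | add f f' hf hf' => simp only [map_add, mul_add, hf, hf']
  | single m d =>
    ext x
    simp [single_mul_single, invApplyOne_mul_conjLeft, mul_assoc]

theorem permAction_mul {hl : IsNormalisedByLeft N} (f : MonoidAlgebra L N)
    {f' : MonoidAlgebra L N} (hf' : f' ∈ fixedAlgebra (conjLeft hl)) :
    permAction N (f * f') = permAction N f * permAction N f' := by
  induction f using MonoidAlgebra.induction_linear with
  | zero => simp
  | add f g hf hg => simp only [map_add, add_mul, hf, hg]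
  | single n c =>
    rw [← permAction_single_mul hl]
    congr 2
    exact (hf' _).symm

theorem permAction_apply_mul (f : MonoidAlgebra L N) (x y : L) :
    permAction N f (x * y) = LinearMap.mul' L L
      (TensorProduct.map ((permAction N).flip x) ((permAction N).flip y)
        (Coalgebra.comul (R := L) f)) := by
  induction f using MonoidAlgebra.induction_linear with
  | zero => simp
  | add f f' hf hf' => simp only [map_add, LinearMap.add_apply, hf, hf']
  | single n c => simp [comul_single, mul_left_comm]

theorem permAction_apply_one (f : MonoidAlgebra L N) :
    permAction N f 1 = Coalgebra.counit (R := L) f := by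
  induction f using MonoidAlgebra.induction_linear with
  | zero => simp
  | add f f' hf hf' => simp only [map_add, LinearMap.add_apply, hf, hf']
  | single n c => simp [counit_single]

theorem bijective_mul'_map_permAction [FiniteDimensional K L] [IsGalois K L]
    (hN : IsRegularPerm N) {A : Type*} [AddCommGroup A] [Module K A]
    {ι : A →ₗ[K] MonoidAlgebra L N} (hι : IsBaseChange L ι) :
    Function.Bijective (LinearMap.mul' K (Module.End K L) ∘ₗ
      TensorProduct.map (Algebra.lmul K L).toLinearMap
        ((permAction N).restrictScalars K ∘ₗ ι) : L ⊗[K] A →ₗ[K] Module.End K L) := by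
  convert (permAction_bijective hN).comp hι.equiv.bijective
  ext t x
  induction t with
  | zero => simp
  | add s t hs ht => simp_all
  | tmul c a => simp

theorem mul'_map_tensorForm {A : Type*} [AddCommGroup A] [Module K A]
    {V : Type*} [AddCommGroup V] [Module K V] [Module L V] [IsScalarTower K L V]
    (ι : A →ₗ[K] V) (f g : V →ₗ[L] L) (t : A ⊗[K] A) :
    LinearMap.mul' L L (TensorProduct.map f g (tensorForm L ι ι t)) =
      LinearMap.mul' K L (TensorProduct.map (f.restrictScalars K ∘ₗ ι)
        (g.restrictScalars K ∘ₗ ι) t) := by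
  induction t with
  | zero => simp
  | add s t hs ht => simp only [map_add, hs, ht]
  | tmul a b => simp

theorem mem_fixedAlgebra_conjLeft (hl : IsNormalisedByLeft N) {f : MonoidAlgebra L N} :
    f ∈ fixedAlgebra (conjLeft hl) ↔ ∀ (g : L ≃ₐ[K] L) (n n' : N),
      (n' : Equiv.Perm (L ≃ₐ[K] L)) = Equiv.mulLeft g * n * (Equiv.mulLeft g)⁻¹ →
        f.coeff n' = g (f.coeff n) := by
  simp only [mem_fixedAlgebra, ← coe_conjLeft hl, Subtype.coe_inj, forall_eq]

section Existence

variable [FiniteDimensional K L] [IsGalois K L]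

/-- The Hopf-Galois structure `L[N]^G`. -/
noncomputable def fixedHopfGaloisStructure (hN : IsRegularPerm N) (hl : IsNormalisedByLeft N) :
    HopfGaloisStructure K L :=
  letI := (isHopfForm_fixedAlgebra (conjLeft hl)).hopfAlgebra
  { H := fixedAlgebra (conjLeft hl)
    cocomm := (isHopfForm_fixedAlgebra (conjLeft hl)).isCocomm
    finite :=
      have : Module.Finite K (MonoidAlgebra L N) := Module.Finite.trans L _
      inferInstance
    act := AlgHom.ofLinearMap
      ((permAction N).restrictScalars K ∘ₗ (fixedAlgebra (conjLeft hl)).val.toLinearMap)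
      permAction_one (fun f f' => permAction_mul _ f'.2)
    act_mul := fun f x y => by
      refine (permAction_apply_mul (f : MonoidAlgebra L N) x y).trans ?_
      rw [← Subalgebra.val_apply, ← (isHopfForm_fixedAlgebra (conjLeft hl)).tensorForm_comul,
        mul'_map_tensorForm]
      rfl
    act_one := fun f => (permAction_apply_one (f : MonoidAlgebra L N)).trans
      ((isHopfForm_fixedAlgebra (conjLeft hl)).algebraMap_counit f).symm
    galois :=
      bijective_mul'_map_permAction hN (isHopfForm_fixedAlgebra (conjLeft hl)).isBaseChange }

theorem isFixedAlgebra_fixedHopfGaloisStructure (hN : IsRegularPerm N)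
    (hl : IsNormalisedByLeft N) : (fixedHopfGaloisStructure hN hl).IsFixedAlgebra N := by
  have hform := isHopfForm_fixedAlgebra (conjLeft hl)
  exact ⟨(fixedAlgebra (conjLeft hl)).val, Subtype.val_injective,
    fun f => (SetLike.ext_iff.mp (fixedAlgebra (conjLeft hl)).range_val f).trans
      (mem_fixedAlgebra_conjLeft hl),
    fun a => (hform.tensorForm_comul a).symm, fun a => (hform.algebraMap_counit a).symm,
    fun a x => permAction_apply _ x⟩

end Existence

theorem range_eq_fixedAlgebra (hl : IsNormalisedByLeft N) {A : Type*} [Ring A] [Algebra K A]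
    {ι : A →ₐ[K] MonoidAlgebra L N} (h : ∀ f : MonoidAlgebra L N, f ∈ Set.range ι ↔
      ∀ (g : L ≃ₐ[K] L) (n n' : N),
        (n' : Equiv.Perm (L ≃ₐ[K] L)) = Equiv.mulLeft g * n * (Equiv.mulLeft g)⁻¹ →
          f.coeff n' = g (f.coeff n)) : ι.range = fixedAlgebra (conjLeft hl) := by
  ext f
  rw [mem_fixedAlgebra_conjLeft, ← h]
  rfl

theorem permAction_mapDomain {N' : Subgroup (Equiv.Perm (L ≃ₐ[K] L))} {β : N → N'}
    (hβ : ∀ n, invApplyOne (β n) = invApplyOne n) (f : MonoidAlgebra L N) :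
    permAction N' (mapDomainLinearMap L L β f) = permAction N f := by
  ext x
  induction f using MonoidAlgebra.induction_linear with
  | zero => simp
  | add f f' hf hf' => simp only [map_add, LinearMap.add_apply, hf, hf']
  | single n c => simp [hβ]

section Uniqueness

variable [FiniteDimensional K L] [IsGalois K L]

theorem isBaseChange_of_range_eq_fixedAlgebra {hl : IsNormalisedByLeft N} {A : Type*} [Ring A]
    [Algebra K A] {ι : A →ₐ[K] MonoidAlgebra L N} (hinj : Function.Injective ι)
    (hrange : ι.range = fixedAlgebra (conjLeft hl)) : IsBaseChange L ι.toLinearMap := by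
  let e := (AlgEquiv.ofInjective ι hinj).trans (Subalgebra.equivOfEq _ _ hrange)
  have he : ι.toLinearMap =
      (fixedAlgebra (conjLeft hl)).val.toLinearMap ∘ₗ e.toLinearEquiv.toLinearMap := rfl
  rw [he]
  exact IsBaseChange.comp_equiv _ _ (isHopfForm_fixedAlgebra (conjLeft hl)).isBaseChange

theorem equiv_of_isFixedAlgebra (hl : IsNormalisedByLeft N) {S T : HopfGaloisStructure K L}
    (hS : S.IsFixedAlgebra N) (hT : T.IsFixedAlgebra N) : S ≈ T := by
  obtain ⟨ι, hι, hιrange, hιcomul, hιcounit, hιact⟩ := hS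
  obtain ⟨κ, hκ, hκrange, hκcomul, hκcounit, hκact⟩ := hT
  have hκbc := isBaseChange_of_range_eq_fixedAlgebra hκ (range_eq_fixedAlgebra hl hκrange)
  have hrange : ι.range = κ.range :=
    (range_eq_fixedAlgebra hl hιrange).trans (range_eq_fixedAlgebra hl hκrange).symm
  let e : S.H ≃ₐ[K] T.H := (AlgEquiv.ofInjective ι hι).trans
    ((Subalgebra.equivOfEq _ _ hrange).trans (AlgEquiv.ofInjective κ hκ).symm)
  have he (a : S.H) : κ (e a) = ι a :=
    congrArg Subtype.val ((AlgEquiv.ofInjective κ hκ).apply_symm_apply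
      (Subalgebra.equivOfEq _ _ hrange (AlgEquiv.ofInjective ι hι a)))
  refine ⟨BialgEquiv.ofAlgEquiv e (AlgHom.ext fun a => ?_) (AlgHom.ext fun a => ?_),
    fun a x => ?_⟩
  · apply (algebraMap K L).injective
    change algebraMap K L (Coalgebra.counit (R := K) (e a)) =
      algebraMap K L (Coalgebra.counit (R := K) a)
    rw [← hκcounit, ← hιcounit, he]
  · apply injective_of_isBaseChange (isBaseChange_tensorForm hκbc hκbc)
    have hmap := tensorForm_map (f := ι.toLinearMap) (g := ι.toLinearMap)
      (a := e.toLinearMap) (b := e.toLinearMap) (f' := κ.toLinearMap) (g' := κ.toLinearMap)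
      (v := LinearMap.id (R := L)) (w := .id) he he (Coalgebra.comul a)
    rw [TensorProduct.map_id] at hmap
    exact hmap.trans ((hιcomul a).symm.trans ((congrArg _ (he a).symm).trans (hκcomul (e a))))
  · change T.act (e a) x = _
    rw [hιact, hκact, he]

/- Matching the permutations that act by the same automorphism identifies the two fixed algebras,
hence is equivariant, as each fixed algebra spans its group algebra. -/
theorem eq_of_isFixedAlgebra {N' : Subgroup (Equiv.Perm (L ≃ₐ[K] L))}
    (hN : IsRegularPerm N) (hl : IsNormalisedByLeft N) (hN' : IsRegularPerm N')
    (hl' : IsNormalisedByLeft N') {S T : HopfGaloisStructure K L} (hST : S ≈ T)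
    (hS : S.IsFixedAlgebra N) (hT : T.IsFixedAlgebra N') : N = N' := by
  obtain ⟨ι, hι, hιrange, -, -, hιact⟩ := hS
  obtain ⟨κ, -, hκrange, -, -, hκact⟩ := hT
  obtain ⟨e, he⟩ := hST
  have hιrange := range_eq_fixedAlgebra hl hιrange
  have hκrange := range_eq_fixedAlgebra hl' hκrange
  let β : N ≃ N' := (Equiv.ofBijective _ (invApplyOne_bijective hN)).trans
    (Equiv.ofBijective _ (invApplyOne_bijective hN')).symm
  have hβ (n : N) : invApplyOne (β n) = invApplyOne n :=
    (Equiv.ofBijective _ (invApplyOne_bijective hN')).apply_symm_apply (invApplyOne n)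
  let F := mapDomainLinearMap L L β
  have hFι (a : S.H) : F (ι a) = κ (e a) := by
    refine (permAction_bijective hN').injective (LinearMap.ext fun x => ?_)
    calc permAction N' (F (ι a)) x = permAction N (ι a) x := by rw [permAction_mapDomain hβ]
      _ = S.act a x := (permAction_apply _ x).trans (hιact a x).symm
      _ = T.act (e a) x := (he a x).symm
      _ = permAction N' (κ (e a)) x := (hκact (e a) x).trans (permAction_apply _ x).symm
  have hF (g : L ≃ₐ[K] L) : F ∘ₛₗ (groupAlgebraAction (conjLeft hl)).map g =
      (groupAlgebraAction (conjLeft hl')).map g ∘ₛₗ F := by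
    refine semilinearMap_ext_of_isBaseChange
      (isBaseChange_of_range_eq_fixedAlgebra hι hιrange) fun a => ?_
    have hιfix : (groupAlgebraAction (conjLeft hl)).map g (ι a) = ι a :=
      hιrange.le (ι.mem_range_self a) g
    have hκfix : (groupAlgebraAction (conjLeft hl')).map g (κ (e a)) = κ (e a) :=
      hκrange.le (κ.mem_range_self (e a)) g
    simp only [LinearMap.comp_apply, AlgHom.toLinearMap_apply, hιfix, hFι, hκfix]
  refine eq_of_conjLeft_equivariant (hl := hl) (hl' := hl') β hβ fun g n => ?_
  have h := LinearMap.congr_fun (hF g) (single n 1)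
  simpa [F, MonoidAlgebra.single_left_inj] using h

/-- The regular subgroups of `Perm G` normalised by the left translations which are isomorphic to
`M` and whose skew brace `B` has `|Θ(B)| = r`; they parametrise `hopfGaloisClasses` when `G` is the
Galois group. -/
def PermBrace.subgroupsOfType (G M : Type*) [Group G] [Group M] (r : ℕ) :
    Set (Subgroup (Equiv.Perm G)) :=
  {N | ∃ (hN : IsRegularPerm N) (hl : IsNormalisedByLeft N),
    Nonempty (N ≃* M) ∧ SkewBrace.thetaCard (Carrier N hN hl) = r}

theorem ncard_hopfGaloisClasses (M : Type*) [Group M] (r : ℕ) :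
    (hopfGaloisClasses K L M r).ncard = (PermBrace.subgroupsOfType (L ≃ₐ[K] L) M r).ncard := by
  symm
  refine Set.ncard_congr
    (fun N hN => Quotient.mk _ (fixedHopfGaloisStructure hN.choose hN.choose_spec.choose))
    ?_ ?_ ?_
  · intro N hN
    exact ⟨_, rfl, N, hN.choose, hN.choose_spec.choose,
      isFixedAlgebra_fixedHopfGaloisStructure _ _, hN.choose_spec.choose_spec⟩
  · intro N N' hN hN' h
    exact eq_of_isFixedAlgebra hN.choose hN.choose_spec.choose hN'.choose
      hN'.choose_spec.choose (Quotient.exact h)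
      (isFixedAlgebra_fixedHopfGaloisStructure _ _)
      (isFixedAlgebra_fixedHopfGaloisStructure _ _)
  · rintro _ ⟨S, rfl, N, hN, hl, hS, hM⟩
    exact ⟨N, ⟨hN, hl, hM⟩, Quotient.sound
      (equiv_of_isFixedAlgebra hl (isFixedAlgebra_fixedHopfGaloisStructure hN hl) hS)⟩

end Uniqueness

end HopfGalois

section SkewBraces

namespace SkewBrace

variable {B : Type*} [SkewBrace B]

theorem one_eq_zero : (1 : B) = 0 := by
  rw [← mul_zero_eq (1 : B), one_mul]

theorem lam_mul (a b c : B) : lam (a * b) c = lam a (lam b c) :=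
  lam_mul_aux a b c

theorem add_lam (a b : B) : a + lam a b = a * b :=
  add_neg_cancel_left a (a * b)

end SkewBrace

instance instSkewBraceULift {B : Type u} [SkewBrace B] : SkewBrace (ULift.{w} B) where
  brace_property a b c := ULift.ext _ _ (SkewBrace.brace_property a.down b.down c.down)

namespace SkewBraceIso

variable {B C D : Type*} [SkewBrace B] [SkewBrace C] [SkewBrace D]

/-- The isomorphism of multiplicative groups underlying an isomorphism of skew braces. -/
def mulEquiv (f : SkewBraceIso B C) : B ≃* C where
  toEquiv := f.toEquiv
  map_mul' := f.map_mul'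

/-- The isomorphism of additive groups underlying an isomorphism of skew braces. -/
def addEquiv (f : SkewBraceIso B C) : B ≃+ C where
  toEquiv := f.toEquiv
  map_add' := f.map_add'

/-- Isomorphisms from `B` to `D` and those from `C` to `D` correspond along an isomorphism of `B`
with `C`. -/
def congrLeft (f : SkewBraceIso B C) : SkewBraceIso B D ≃ SkewBraceIso C D where
  toFun g := f.symm.trans g
  invFun g := f.trans g
  left_inv g := toEquiv_injective (Equiv.ext fun b =>
    congrArg g.toEquiv (f.toEquiv.symm_apply_apply b))
  right_inv g := toEquiv_injective (Equiv.ext fun c =>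
    congrArg g.toEquiv (f.toEquiv.apply_symm_apply c))

variable (B) in
/-- A skew brace is isomorphic to its lift to another universe. -/
def ulift : SkewBraceIso (ULift.{w} B) B where
  toEquiv := Equiv.ulift
  map_add' _ _ := rfl
  map_mul' _ _ := rfl

instance [Finite B] [Finite C] : Finite (SkewBraceIso B C) :=
  .of_injective _ toEquiv_injective

end SkewBraceIso

end SkewBraces

section GammaFunctions

variable {N : Type*} [Group N] {γ δ : N → MulAut N}

/-- A gamma function on a group `N`: a map `γ : N → Aut N` for which `u * γ u v` is a second group
operation on `N`, which then forms a skew brace with the first one as addition. -/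
def IsGammaFunction (γ : N → MulAut N) : Prop :=
  ∀ u v, γ (u * γ u v) = γ u * γ v

/-- The automorphism `φ` of `N` is an isomorphism between the skew braces with gamma functions `γ`
and `δ`. -/
def Intertwines (γ δ : N → MulAut N) (φ : MulAut N) : Prop :=
  ∀ u v, φ (γ u v) = δ (φ u) (φ v)

/-- The gamma function transported along an automorphism. -/
def conjGamma (φ : MulAut N) (γ : N → MulAut N) (u : N) : MulAut N :=
  φ * γ (φ⁻¹ u) * φ⁻¹

theorem intertwines_conjGamma (φ : MulAut N) : Intertwines γ (conjGamma φ γ) φ := fun u v => by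
  simp [conjGamma]

theorem Intertwines.trans {ε : N → MulAut N} {φ ψ : MulAut N} (hφ : Intertwines γ δ φ)
    (hψ : Intertwines δ ε ψ) : Intertwines γ ε (ψ * φ) := fun u v => by
  simp only [MulAut.mul_apply, hφ u v, hψ (φ u) (φ v)]

namespace IsGammaFunction

theorem conj (hγ : IsGammaFunction γ) (φ : MulAut N) : IsGammaFunction (conjGamma φ γ) := by
  intro u v
  simp only [conjGamma, MulAut.mul_apply, map_mul, MulAut.inv_apply_self, hγ (φ⁻¹ u) (φ⁻¹ v)]
  group

theorem map_one (hγ : IsGammaFunction γ) : γ 1 = 1 := by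
  have h := hγ 1 1
  rw [_root_.map_one, one_mul] at h
  exact left_eq_mul.mp h

theorem map_mul_of_eq_one (hγ : IsGammaFunction γ) {u : N} (hu : γ u = 1) (v : N) :
    γ (u * v) = γ v := by
  simpa only [hu, MulAut.one_apply, one_mul] using hγ u v

theorem map_inv_apply_inv (hγ : IsGammaFunction γ) (u : N) : γ ((γ u)⁻¹ u⁻¹) = (γ u)⁻¹ := by
  have h := hγ u ((γ u)⁻¹ u⁻¹)
  rw [MulAut.apply_inv_self, mul_inv_cancel, hγ.map_one] at h
  exact (inv_eq_of_mul_eq_one_right h.symm).symm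

theorem eq_iff (hγ : IsGammaFunction γ) {u v : N} : γ u = γ v ↔ γ (u * v⁻¹) = 1 := by
  constructor
  · intro h
    have huv := hγ u ((γ v)⁻¹ v⁻¹)
    rwa [h, MulAut.apply_inv_self, hγ.map_inv_apply_inv, mul_inv_cancel] at huv
  · intro h
    simpa only [inv_mul_cancel_right] using hγ.map_mul_of_eq_one h v

/-- The kernel of a gamma function, which is a subgroup for the first operation. -/
def ker (hγ : IsGammaFunction γ) : Subgroup N where
  carrier := {u | γ u = 1}
  one_mem' := hγ.map_one
  mul_mem' {u v} hu hv := (hγ.map_mul_of_eq_one hu v).trans hv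
  inv_mem' {u} hu := by
    have h := hγ.map_mul_of_eq_one hu u⁻¹
    rw [mul_inv_cancel, hγ.map_one] at h
    exact h.symm

theorem mem_ker (hγ : IsGammaFunction γ) {u : N} : u ∈ hγ.ker ↔ γ u = 1 := Iff.rfl

/-- The image of a gamma function. -/
def range (hγ : IsGammaFunction γ) : Subgroup (MulAut N) where
  carrier := Set.range γ
  one_mem' := ⟨1, hγ.map_one⟩
  mul_mem' := by
    rintro _ _ ⟨u, rfl⟩ ⟨v, rfl⟩
    exact ⟨_, hγ u v⟩
  inv_mem' := by
    rintro _ ⟨u, rfl⟩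
    exact ⟨_, hγ.map_inv_apply_inv u⟩

theorem index_ker (hγ : IsGammaFunction γ) : hγ.ker.index = Nat.card (Set.range γ) := by
  have h : QuotientGroup.rightRel hγ.ker = Setoid.ker γ := Setoid.ext fun u v => by
    rw [QuotientGroup.rightRel_apply, mem_ker, ← hγ.eq_iff, Setoid.ker_def, eq_comm]
  rw [← Nat.card_congr (Setoid.quotientKerEquivRange γ), ← h]
  exact Nat.card_congr (QuotientGroup.quotientRightRelEquivQuotientLeftRel _).symm

theorem pow_card_range_eq_one (hγ : IsGammaFunction γ) (u : N) :
    γ u ^ Nat.card (Set.range γ) = 1 :=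
  congrArg Subtype.val (pow_card_eq_one' (x := (⟨γ u, u, rfl⟩ : hγ.range)))

end IsGammaFunction

end GammaFunctions

section BraceCharts

variable {N : Type*} [Group N] {γ δ : N → MulAut N} {B C : Type*} [SkewBrace B] [SkewBrace C]

/-- A chart of a skew brace `B`: a bijection with the group `N` under which the addition of `B`
becomes the operation of `N` and the multiplication becomes `u * γ u v`. -/
structure BraceChart (B : Type*) [SkewBrace B] (γ : N → MulAut N) extends B ≃ N where
  map_add' : ∀ b c, toFun (b + c) = toFun b * toFun c
  map_mul' : ∀ b c, toFun (b * c) = toFun b * γ (toFun b) (toFun c)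

namespace BraceChart

theorem map_add (e : BraceChart B γ) (b c : B) :
    e.toEquiv (b + c) = e.toEquiv b * e.toEquiv c := e.map_add' b c

theorem map_mul (e : BraceChart B γ) (b c : B) :
    e.toEquiv (b * c) = e.toEquiv b * γ (e.toEquiv b) (e.toEquiv c) := e.map_mul' b c

/-- A chart as an isomorphism of the additive group. -/
def addEquiv (e : BraceChart B γ) : B ≃+ Additive N where
  toEquiv := e.toEquiv.trans Additive.ofMul
  map_add' := e.map_add

theorem symm_mul (e : BraceChart B γ) (u v : N) :
    e.toEquiv.symm (u * v) = e.toEquiv.symm u + e.toEquiv.symm v :=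
  _root_.map_add e.addEquiv.symm (Additive.ofMul u) (Additive.ofMul v)

theorem map_lam (e : BraceChart B γ) (b c : B) :
    e.toEquiv (SkewBrace.lam b c) = γ (e.toEquiv b) (e.toEquiv c) :=
  mul_left_cancel (a := e.toEquiv b) (by rw [← e.map_add, SkewBrace.add_lam, e.map_mul])

theorem isGammaFunction (e : BraceChart B γ) : IsGammaFunction γ := by
  intro u v
  obtain ⟨b, rfl⟩ := e.toEquiv.surjective u
  obtain ⟨c, rfl⟩ := e.toEquiv.surjective v
  refine MulEquiv.ext fun w => ?_
  obtain ⟨d, rfl⟩ := e.toEquiv.surjective w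
  rw [← e.map_mul, ← e.map_lam, SkewBrace.lam_mul, e.map_lam, e.map_lam, MulAut.mul_apply]

theorem thetaCard_eq (e : BraceChart B γ) : SkewBrace.thetaCard B = Nat.card (Set.range γ) := by
  let T : AddAut B ≃ MulAut N := (AddAut.congr e.addEquiv).toEquiv.trans MulEquiv.toAdditive.symm
  have hT : T ∘ SkewBrace.lam = γ ∘ e.toEquiv := funext fun b => MulEquiv.ext fun u =>
    (e.map_lam b _).trans (congrArg _ (e.toEquiv.apply_symm_apply u))
  rw [← e.toEquiv.surjective.range_comp γ, ← hT, Set.range_comp, SkewBrace.thetaCard,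
    Nat.card_image_of_injective T.injective]

/-- An isomorphism of skew braces, read in charts. -/
def autOfIso (e : BraceChart B γ) (e' : BraceChart C δ) (f : SkewBraceIso B C) : MulAut N :=
  MulEquiv.toAdditive.symm ((e.addEquiv.symm.trans f.addEquiv).trans e'.addEquiv)

theorem autOfIso_apply (e : BraceChart B γ) (e' : BraceChart C δ) (f : SkewBraceIso B C) (b : B) :
    e.autOfIso e' f (e.toEquiv b) = e'.toEquiv (f.toEquiv b) :=
  congrArg (e'.toEquiv ∘ f.toEquiv) (e.toEquiv.symm_apply_apply b)

theorem intertwines_autOfIso (e : BraceChart B γ) (e' : BraceChart C δ) (f : SkewBraceIso B C) :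
    Intertwines γ δ (e.autOfIso e' f) := by
  intro u v
  obtain ⟨b, rfl⟩ := e.toEquiv.surjective u
  obtain ⟨c, rfl⟩ := e.toEquiv.surjective v
  have h : e'.toEquiv (f.toEquiv (b * c)) = e'.toEquiv (f.toEquiv b * f.toEquiv c) :=
    congrArg e'.toEquiv (f.map_mul' b c)
  rw [e'.map_mul, ← autOfIso_apply e e' f, ← autOfIso_apply e e' f, ← autOfIso_apply e e' f,
    e.map_mul, _root_.map_mul] at h
  exact mul_left_cancel h

/-- The isomorphism of skew braces which an intertwining automorphism becomes in charts. -/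
def isoOfAut (e : BraceChart B γ) (e' : BraceChart C δ) (φ : MulAut N)
    (hφ : Intertwines γ δ φ) : SkewBraceIso B C where
  toEquiv := (e.toEquiv.trans φ.toEquiv).trans e'.toEquiv.symm
  map_add' b c := by
    change e'.toEquiv.symm (φ (e.toEquiv (b + c))) = _
    rw [e.map_add, _root_.map_mul, e'.symm_mul]
    rfl
  map_mul' b c := e'.toEquiv.injective (by
    change e'.toEquiv (e'.toEquiv.symm (φ (e.toEquiv (b * c)))) =
      e'.toEquiv (e'.toEquiv.symm (φ (e.toEquiv b)) * e'.toEquiv.symm (φ (e.toEquiv c)))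
    simp only [e'.map_mul, e.map_mul, Equiv.apply_symm_apply, _root_.map_mul, hφ _ _])

/-- Isomorphisms of skew braces are the intertwining automorphisms of the group of the charts. -/
def isoEquiv (e : BraceChart B γ) (e' : BraceChart C δ) :
    SkewBraceIso B C ≃ {φ | Intertwines γ δ φ} where
  toFun f := ⟨e.autOfIso e' f, e.intertwines_autOfIso e' f⟩
  invFun φ := e.isoOfAut e' φ.1 φ.2
  left_inv f := SkewBraceIso.toEquiv_injective (Equiv.ext fun b =>
    (congrArg e'.toEquiv.symm (e.autOfIso_apply e' f b)).trans (e'.toEquiv.symm_apply_apply _))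
  right_inv φ := Subtype.ext (MulEquiv.ext fun u => by
    obtain ⟨b, rfl⟩ := e.toEquiv.surjective u
    exact (e.autOfIso_apply e' _ b).trans (e'.toEquiv.apply_symm_apply _))

theorem nonempty_iso_iff (e : BraceChart B γ) (e' : BraceChart C δ) :
    Nonempty (SkewBraceIso B C) ↔ ∃ φ, Intertwines γ δ φ :=
  (e.isoEquiv e').nonempty_congr.trans nonempty_subtype

/-- A chart of the target of an isomorphism gives one of the source. -/
def comp (e : BraceChart C γ) (f : SkewBraceIso B C) : BraceChart B γ where
  toEquiv := f.toEquiv.trans e.toEquiv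
  map_add' b c := (congrArg e.toEquiv (f.map_add' b c)).trans (e.map_add _ _)
  map_mul' b c := (congrArg e.toEquiv (f.map_mul' b c)).trans (e.map_mul _ _)

/-- A chart with values in another group `M`, read off from a bijection that is a homomorphism for
the second group operation on `N`. -/
def mulEquiv {M : Type*} [Group M] (e : BraceChart B γ) (f : N ≃ M)
    (hf : ∀ u v, f (u * γ u v) = f u * f v) : B ≃* M where
  toEquiv := e.toEquiv.trans f
  map_mul' b c := (congrArg f (e.map_mul b c)).trans (hf _ _)

/-- Every identification of the additive group of a skew brace with `N` is a chart. -/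
def ofAddEquiv (e : B ≃+ Additive N) : BraceChart B fun u => MulEquiv.toAdditive.symm
    (AddAut.congr e (SkewBrace.lam (e.symm (Additive.ofMul u)))) where
  toEquiv := e.toEquiv.trans Additive.toMul
  map_add' := _root_.map_add e
  map_mul' b c := by
    change e (b * c) = e b + e (SkewBrace.lam (e.symm (e b)) (e.symm (e c)))
    rw [e.symm_apply_apply, e.symm_apply_apply, ← _root_.map_add, SkewBrace.add_lam]

end BraceChart

end BraceCharts

section RegularSubgroups

variable {N : Type*} [Group N] {γ : N → MulAut N}

/-- The subgroup of the holomorph that is the graph of a gamma function. -/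
def graphSubgroup (hγ : IsGammaFunction γ) : Subgroup (Hol N) where
  carrier := {g | g.right = γ g.left}
  one_mem' := hγ.map_one.symm
  mul_mem' {g h} hg hh := by
    change g.right * h.right = γ (g.left * g.right h.left)
    rw [hg, hh, hγ]
  inv_mem' {g} hg := by
    change g.right⁻¹ = γ (g.right⁻¹ g.left⁻¹)
    rw [hg, hγ.map_inv_apply_inv]

theorem mem_graphSubgroup (hγ : IsGammaFunction γ) {g : Hol N} :
    g ∈ graphSubgroup hγ ↔ g.right = γ g.left := Iff.rfl

theorem isRegular_graphSubgroup (hγ : IsGammaFunction γ) :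
    Hol.IsRegular (graphSubgroup hγ) := by
  intro x y
  have h : γ (y * γ y ((γ x)⁻¹ x⁻¹)) = γ y * (γ x)⁻¹ := by rw [hγ, hγ.map_inv_apply_inv]
  refine ⟨⟨y * γ y ((γ x)⁻¹ x⁻¹), γ y * (γ x)⁻¹⟩, ⟨h.symm, ?_⟩, ?_⟩
  · simp [Hol.act]
  · rintro g ⟨hg, rfl⟩
    rw [mem_graphSubgroup] at hg
    have hright : γ (Hol.act g x) * (γ x)⁻¹ = g.right := by
      rw [Hol.act, hg, hγ, mul_inv_cancel_right]
    refine SemidirectProduct.ext ?_ hright.symm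
    change _ = Hol.act g x * (γ (Hol.act g x) * (γ x)⁻¹) x⁻¹
    rw [hright, map_inv, Hol.act, mul_inv_cancel_right]

namespace Hol.Brace

variable {H : Subgroup (Hol N)} (hH : Hol.IsRegular H)

theorem psi_apply (b : H) : psi H hH b = (b : Hol N).left := by
  change (b : Hol N).left * (b : Hol N).right 1 = _
  rw [map_one, mul_one]

/-- The chart `g ↦ g(1)` of the skew brace given by a regular subgroup. -/
noncomputable def chart (hHγ : ∀ g ∈ H, g.right = γ g.left) : BraceChart (Hol.Brace H hH) γ where
  toEquiv := psi H hH
  map_add' := psi_add H hH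
  map_mul' (b c : H) := by
    change psi H hH (b * c : H) = psi H hH b * γ (psi H hH b) (psi H hH c)
    rw [psi_apply, psi_apply, psi_apply, ← hHγ _ b.2]
    rfl

theorem autHom_injective : Function.Injective (autHom H hH) := by
  intro f g h
  refine SkewBraceIso.toEquiv_injective (Equiv.ext fun b => (psi H hH).injective ?_)
  have hb := DFunLike.congr_fun h (psi H hH b)
  change psi H hH (f.toEquiv ((psi H hH).symm (psi H hH b))) =
    psi H hH (g.toEquiv ((psi H hH).symm (psi H hH b))) at hb
  rwa [Equiv.symm_apply_apply] at hb

theorem range_autHom (hHγ : ∀ g ∈ H, g.right = γ g.left) :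
    Set.range (autHom H hH) = {φ | Intertwines γ γ φ} := by
  have h : autHom H hH = Subtype.val ∘ (chart hH hHγ).isoEquiv (chart hH hHγ) := rfl
  rw [h, EquivLike.range_comp, Subtype.range_coe]

end Hol.Brace

end RegularSubgroups

section HeisenbergAutomorphisms

namespace Heis

variable {p : ℕ}

theorem mul_x (u v : Heis p) : (u * v).x = u.x + v.x + u.z * v.y := rfl
theorem mul_y (u v : Heis p) : (u * v).y = u.y + v.y := rfl
theorem mul_z (u v : Heis p) : (u * v).z = u.z + v.z := rfl
theorem inv_x (u : Heis p) : (u⁻¹).x = -u.x + u.y * u.z := rfl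
theorem inv_y (u : Heis p) : (u⁻¹).y = -u.y := rfl
theorem inv_z (u : Heis p) : (u⁻¹).z = -u.z := rfl

theorem rho_eq_commutator : rho p = tau p * sigma p * (sigma p * tau p)⁻¹ := by
  ext <;> simp [rho, tau, sigma, mul_def, inv_x, inv_y, inv_z]

variable [Fact p.Prime]

theorem hom_ext {M : Type*} [Group M] {f g : Heis p →* M} (hσ : f (sigma p) = g (sigma p))
    (hτ : f (tau p) = g (tau p)) : f = g := by
  have hρ : f (rho p) = g (rho p) := by
    simp only [rho_eq_commutator, map_mul, map_inv, hσ, hτ]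
  ext v
  rw [normal_form v]
  simp only [map_mul, map_pow, hρ, hσ, hτ]

theorem mulAut_ext {f g : MulAut (Heis p)} (hσ : f (sigma p) = g (sigma p))
    (hτ : f (tau p) = g (tau p)) : f = g :=
  MulEquiv.toMonoidHom_injective (hom_ext hσ hτ)

theorem mulAut_ext_iff {f g : MulAut (Heis p)} :
    f = g ↔ f (sigma p) = g (sigma p) ∧ f (tau p) = g (tau p) :=
  ⟨fun h => h ▸ ⟨rfl, rfl⟩, fun h => mulAut_ext h.1 h.2⟩

variable (hp : 3 < p)

theorem bracket_apply (A : GL (Fin 2) (ZMod p)) (b₁ b₂ : ZMod p) (v : Heis p) :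
    bracket hp A b₁ b₂ v =
      ⟨A.val.det * v.x + b₁ * v.y + 2⁻¹ * A.val 0 0 * A.val 1 0 * (v.y * (v.y - 1))
        + b₂ * v.z + 2⁻¹ * A.val 0 1 * A.val 1 1 * (v.z * (v.z - 1))
        + A.val 0 1 * A.val 1 0 * (v.y * v.z),
      A.val 0 0 * v.y + A.val 0 1 * v.z,
      A.val 1 0 * v.y + A.val 1 1 * v.z⟩ := rfl

theorem exists_eq_bracket (φ : MulAut (Heis p)) : ∃ A b₁ b₂, φ = bracket hp A b₁ b₂ := by
  let M : Matrix (Fin 2) (Fin 2) (ZMod p) :=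
    !![(φ (sigma p)).y, (φ (tau p)).y; (φ (sigma p)).z, (φ (tau p)).z]
  have hρ : φ (rho p) = ⟨M.det, 0, 0⟩ := by
    rw [rho_eq_commutator]
    simp only [map_mul, map_inv]
    ext
    · simp only [mul_x, mul_y, mul_z, inv_x, inv_y, M, Matrix.det_fin_two_of]
      ring
    · simp only [mul_y, inv_y]
      ring
    · simp only [mul_z, inv_z]
      ring
  have hM : M.det ≠ 0 := by
    intro h0
    have h1 : φ (rho p) = φ 1 := by rw [hρ, h0, map_one, one_def]
    exact one_ne_zero (congrArg Heis.x (φ.injective h1))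
  refine ⟨.mkOfDetNeZero M hM, (φ (sigma p)).x, (φ (tau p)).x, mulAut_ext ?_ ?_⟩
  · rw [bracket_sigma]
    rfl
  · rw [bracket_tau]
    rfl

theorem bracket_injective {A A' : GL (Fin 2) (ZMod p)} {b₁ b₂ b₁' b₂' : ZMod p}
    (h : bracket hp A b₁ b₂ = bracket hp A' b₁' b₂') : A = A' ∧ b₁ = b₁' ∧ b₂ = b₂' := by
  have hσ := DFunLike.congr_fun h (sigma p)
  have hτ := DFunLike.congr_fun h (tau p)
  rw [bracket_sigma, bracket_sigma, Heis.mk.injEq] at hσ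
  rw [bracket_tau, bracket_tau, Heis.mk.injEq] at hτ
  refine ⟨Units.ext ?_, hσ.1, hτ.1⟩
  rw [Matrix.eta_fin_two A.val, Matrix.eta_fin_two A'.val, hσ.2.1, hσ.2.2, hτ.2.1, hτ.2.2]

/-- The parametrisation of the automorphism group by invertible matrices and pairs of scalars. -/
noncomputable def bracketEquiv :
    GL (Fin 2) (ZMod p) × ZMod p × ZMod p ≃ MulAut (Heis p) :=
  Equiv.ofBijective (fun d => bracket hp d.1 d.2.1 d.2.2)
    ⟨fun d d' h => by
      obtain ⟨h1, h2, h3⟩ := bracket_injective hp h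
      exact Prod.ext h1 (Prod.ext h2 h3),
    fun φ => by
      obtain ⟨A, b₁, b₂, rfl⟩ := exists_eq_bracket hp φ
      exact ⟨(A, b₁, b₂), rfl⟩⟩

include hp in
theorem card_mulAut : Nat.card (MulAut (Heis p)) = (p - 1) ^ 2 * (p + 1) * p ^ 3 := by
  rw [← Nat.card_congr (bracketEquiv hp), Nat.card_prod, Nat.card_prod, Matrix.card_GL_field]
  obtain ⟨q, rfl⟩ : ∃ q, p = q + 1 := ⟨p - 1, by omega⟩
  have h1 : (q + 1) ^ 2 - 1 = q * (q + 2) := by rw [Nat.sub_eq_of_eq_add]; ring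
  have h2 : (q + 1) ^ 2 - (q + 1) = q * (q + 1) := by rw [Nat.sub_eq_of_eq_add]; ring
  simp only [Fin.prod_univ_two, ZMod.card, Nat.card_eq_fintype_card, Fin.val_zero, Fin.val_one,
    pow_zero, pow_one, h1, h2, Nat.add_sub_cancel]
  ring

theorem det_ne_zero (A : GL (Fin 2) (ZMod p)) : A.val.det ≠ 0 :=
  ((Matrix.isUnit_iff_isUnit_det _).mp A.isUnit).ne_zero

/-- The lower triangular matrix with diagonal entries `a`, `d` and third entry `c`. -/
noncomputable def lowerGL (a d : (ZMod p)ˣ) (c : ZMod p) : GL (Fin 2) (ZMod p) :=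
  .mkOfDetNeZero !![(a : ZMod p), 0; c, d] (by simp)

theorem lowerGL_val (a d : (ZMod p)ˣ) (c : ZMod p) :
    (lowerGL a d c).val = !![(a : ZMod p), 0; c, d] := rfl

end Heis

/-- The parameters of the unipotent automorphism `σ ↦ ρ^r σ τ^t`, `τ ↦ ρ^s τ` of the Heisenberg
group. -/
@[ext]
structure UnipParam (p : ℕ) where
  t : ZMod p
  r : ZMod p
  s : ZMod p

instance (p : ℕ) : Zero (UnipParam p) := ⟨⟨0, 0, 0⟩⟩

namespace Heis

variable {p : ℕ} [Fact p.Prime] (hp : 3 < p) (P Q : UnipParam p)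

/-- The `k`-th power of the automorphism `σ ↦ ρ^r σ τ^t`, `τ ↦ ρ^s τ`; the exponent only matters
modulo `p`. -/
noncomputable def unip (k : ZMod p) : MulAut (Heis p) :=
  bracket hp (lowerGL 1 1 (k * P.t)) (k * P.r + 2⁻¹ * (k * (k - 1)) * (P.t * P.s)) (k * P.s)

theorem unip_apply (k : ZMod p) (v : Heis p) :
    unip hp P k v =
      ⟨v.x + (k * P.r + 2⁻¹ * (k * (k - 1)) * (P.t * P.s)) * v.y
        + 2⁻¹ * (k * P.t) * (v.y * (v.y - 1)) + k * P.s * v.z, v.y, k * P.t * v.y + v.z⟩ := by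
  rw [unip, bracket_apply, lowerGL_val]
  simp

theorem unip_apply_y (k : ZMod p) (v : Heis p) : (unip hp P k v).y = v.y := by
  rw [unip_apply]

theorem unip_sigma (k : ZMod p) : unip hp P k (sigma p) =
    ⟨k * P.r + 2⁻¹ * (k * (k - 1)) * (P.t * P.s), 1, k * P.t⟩ := by
  simp [unip_apply, sigma]

theorem unip_tau (k : ZMod p) : unip hp P k (tau p) = ⟨k * P.s, 0, 1⟩ := by
  simp [unip_apply, tau]

theorem unip_add (k l : ZMod p) : unip hp P (k + l) = unip hp P k * unip hp P l := by
  have h2 := two_ne_zero_of_lt hp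
  ext v : 1
  rw [MulAut.mul_apply, unip_apply, unip_apply, unip_apply]
  ext
  · field_simp
    ring
  · rfl
  · ring

theorem unip_zero : unip hp P 0 = 1 := by
  ext v : 1
  simp [unip_apply]

theorem unip_natCast_mul (n : ℕ) (k : ZMod p) : unip hp P (n * k) = unip hp P k ^ n := by
  induction n with
  | zero => rw [Nat.cast_zero, zero_mul, unip_zero, pow_zero]
  | succ n ih => rw [Nat.cast_succ, add_mul, one_mul, unip_add, ih, pow_succ]

theorem unip_natCast (n : ℕ) : unip hp P n = unip hp P 1 ^ n := by
  rw [← unip_natCast_mul, mul_one]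

variable {P Q}

theorem eq_zero_of_unip_eq_one (hP : P ≠ 0) {k : ZMod p} (h : unip hp P k = 1) : k = 0 := by
  by_contra hk
  have hσ := DFunLike.congr_fun h (sigma p)
  have hτ := DFunLike.congr_fun h (tau p)
  rw [unip_sigma, MulAut.one_apply, sigma, Heis.mk.injEq] at hσ
  rw [unip_tau, MulAut.one_apply, tau, Heis.mk.injEq] at hτ
  have ht : P.t = 0 := (mul_eq_zero.mp hσ.2.2).resolve_left hk
  have hs : P.s = 0 := (mul_eq_zero.mp hτ.1).resolve_left hk
  have hr : P.r = 0 := by simpa [ht, hk] using hσ.1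
  exact hP (UnipParam.ext ht hr hs)

theorem unip_injective (hP : P ≠ 0) : Function.Injective (unip hp P) := by
  intro k l h
  have hkl := unip_add hp P (k - l) l
  rw [sub_add_cancel, h] at hkl
  exact sub_eq_zero.mp (eq_zero_of_unip_eq_one hp hP (right_eq_mul.mp hkl))

variable (P) in
/-- The gamma function which factors through the coordinate `y` and sends `σ` to the unipotent
automorphism with parameters `P`. -/
noncomputable def unipGamma (u : Heis p) : MulAut (Heis p) := unip hp P u.y

variable (P) in
theorem isGammaFunction_unipGamma : IsGammaFunction (unipGamma hp P) := fun u v => by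
  rw [unipGamma, unipGamma, unipGamma, mul_y, unip_apply_y, unip_add]

theorem card_range_unipGamma (hP : P ≠ 0) : Nat.card (Set.range (unipGamma hp P)) = p := by
  have hy : Function.Surjective (Heis.y : Heis p → ZMod p) := fun k => ⟨⟨0, k, 0⟩, rfl⟩
  have h : unipGamma hp P = unip hp P ∘ Heis.y := rfl
  rw [h, hy.range_comp, ← Set.image_univ, Nat.card_image_of_injective (unip_injective hp hP),
    Nat.card_univ, Nat.card_zmod]

theorem tau_y_eq_zero_of_intertwines (hQ : Q ≠ 0) {φ : MulAut (Heis p)}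
    (h : Intertwines (unipGamma hp P) (unipGamma hp Q) φ) : (φ (tau p)).y = 0 := by
  refine eq_zero_of_unip_eq_one hp hQ (MulEquiv.ext fun v => ?_)
  obtain ⟨v, rfl⟩ := φ.surjective v
  refine (h (tau p) v).symm.trans ?_
  rw [unipGamma, tau, unip_zero]
  rfl

theorem intertwines_unipGamma_iff_semiconjBy {φ : MulAut (Heis p)} {a : ZMod p}
    (hφ : ∀ u, (φ u).y = a * u.y) :
    Intertwines (unipGamma hp P) (unipGamma hp Q) φ ↔ SemiconjBy φ (unip hp P 1) (unip hp Q a) := by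
  constructor
  · intro h
    refine MulEquiv.ext fun v => (h (sigma p) v).trans ?_
    rw [unipGamma, hφ, sigma, mul_one]
    rfl
  · intro h u v
    have hu := DFunLike.congr_fun (h.pow_right u.y.val).eq v
    rw [← unip_natCast_mul, ← unip_natCast_mul, ZMod.natCast_zmod_val, mul_one, mul_comm] at hu
    rw [unipGamma, unipGamma, hφ]
    exact hu

theorem semiconjBy_bracket_iff {A : GL (Fin 2) (ZMod p)} (hA : A.val 0 1 = 0) (b₁ b₂ : ZMod p) :
    SemiconjBy (bracket hp A b₁ b₂) (unip hp P 1) (unip hp Q (A.val 0 0)) ↔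
      A.val 1 1 * P.t = A.val 0 0 ^ 2 * Q.t ∧ P.s = Q.s ∧
        A.val 0 0 * A.val 1 1 * P.r + b₂ * P.t = A.val 0 0 ^ 2 * Q.r +
          2⁻¹ * (A.val 0 0 ^ 2 * (A.val 0 0 - 1)) * (Q.t * (Q.s + 1)) +
          A.val 0 0 * A.val 1 0 * Q.s := by
  have h2 := two_ne_zero_of_lt hp
  have hdet := det_ne_zero A
  rw [Matrix.det_fin_two, hA, zero_mul, sub_zero] at hdet
  rw [SemiconjBy, mulAut_ext_iff, MulAut.mul_apply, MulAut.mul_apply, MulAut.mul_apply,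
    MulAut.mul_apply, unip_sigma, unip_tau, bracket_sigma, bracket_tau, bracket_apply,
    bracket_apply, unip_apply, unip_apply, Heis.mk.injEq, Heis.mk.injEq]
  simp only [hA, Matrix.det_fin_two]
  constructor
  · rintro ⟨⟨hσ₁, -, hσ₃⟩, hτ₁, -, -⟩
    refine ⟨by linear_combination hσ₃, mul_left_cancel₀ hdet (by linear_combination hτ₁), ?_⟩
    field_simp at hσ₁ ⊢
    linear_combination hσ₁
  · rintro ⟨ht, hs, hr⟩
    refine ⟨⟨?_, by ring, by linear_combination ht⟩, by rw [hs]; ring, by ring, by ring⟩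
    field_simp at hr ⊢
    linear_combination hr

theorem intertwines_unipGamma_bracket_iff (hQ : Q ≠ 0) (A : GL (Fin 2) (ZMod p)) (b₁ b₂ : ZMod p) :
    Intertwines (unipGamma hp P) (unipGamma hp Q) (bracket hp A b₁ b₂) ↔
      A.val 0 1 = 0 ∧ A.val 1 1 * P.t = A.val 0 0 ^ 2 * Q.t ∧ P.s = Q.s ∧
        A.val 0 0 * A.val 1 1 * P.r + b₂ * P.t = A.val 0 0 ^ 2 * Q.r +
          2⁻¹ * (A.val 0 0 ^ 2 * (A.val 0 0 - 1)) * (Q.t * (Q.s + 1)) +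
          A.val 0 0 * A.val 1 0 * Q.s := by
  have hiff (hA : A.val 0 1 = 0) := intertwines_unipGamma_iff_semiconjBy hp (P := P) (Q := Q)
    (φ := bracket hp A b₁ b₂) (a := A.val 0 0) fun u => by rw [bracket_apply, hA]; ring
  constructor
  · intro h
    have hA : A.val 0 1 = 0 := by simpa [bracket_tau] using tau_y_eq_zero_of_intertwines hp hQ h
    exact ⟨hA, (semiconjBy_bracket_iff hp hA b₁ b₂).mp ((hiff hA).mp h)⟩
  · rintro ⟨hA, h⟩
    exact (hiff hA).mpr ((semiconjBy_bracket_iff hp hA b₁ b₂).mpr h)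

end Heis

end HeisenbergAutomorphisms

section MultiplicativeGroup

namespace Heis

variable {p : ℕ}

/-- The coordinates of the normal form, as a bijection with the space of triples. -/
def coordEquiv : Heis p ≃ (Fin 3 → ZMod p) where
  toFun u := ![u.x, u.y, u.z]
  invFun w := ⟨w 0, w 1, w 2⟩
  right_inv w := by
    funext i
    fin_cases i <;> rfl

theorem natCard : Nat.card (Heis p) = p ^ 3 := by
  rw [Nat.card_congr coordEquiv, Nat.card_fun, Nat.card_zmod, Nat.card_fin]

theorem natCast_ne_zero_of_lt {c : ℕ} (hc : 0 < c) (hcp : c < p) : (c : ZMod p) ≠ 0 :=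
  (ZMod.natCast_eq_zero_iff c p).not.mpr (Nat.not_dvd_of_pos_of_lt hc hcp)

variable [Fact p.Prime]

theorem six_ne_zero_of_lt (hp : 3 < p) : (6 : ZMod p) ≠ 0 := by
  rw [show (6 : ZMod p) = 2 * (3 : ℕ) by norm_num]
  exact mul_ne_zero (two_ne_zero_of_lt hp) (natCast_ne_zero_of_lt three_pos hp)

theorem not_nonempty_mulEquiv_elemAb : ¬ Nonempty (Heis p ≃* ElemAb p) := by
  rintro ⟨f⟩
  have h : tau p * sigma p = sigma p * tau p :=
    f.injective (by rw [map_mul, map_mul, mul_comm])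
  simpa [mul_x, tau, sigma] using congrArg Heis.x h

variable (hp : 3 < p) (P : UnipParam p)

/-- New coordinates on the skew brace with gamma function `unipGamma hp P`, in which its
multiplication becomes bilinear: in the coordinates `x`, `y`, `z` the multiplication is a polynomial
2-cocycle, and one subtracts the polynomials in `y` whose coboundaries are its terms that are not
bilinear. -/
def straighten (u : Heis p) : Heis p :=
  ⟨u.x - P.s * u.y * (u.z - 2⁻¹ * P.t * u.y ^ 2) - 6⁻¹ * (P.t * (1 + P.s)) * u.y ^ 3
    - 2⁻¹ * (P.r - 2⁻¹ * (P.t * (1 + P.s))) * u.y ^ 2, u.y, u.z - 2⁻¹ * P.t * u.y ^ 2⟩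

theorem straighten_mul (u v : Heis p) :
    straighten P (u * unipGamma hp P u v) =
      ⟨(straighten P u).x + (straighten P v).x + (1 - P.s) * (straighten P u).z * v.y, u.y + v.y,
        (straighten P u).z + (straighten P v).z⟩ := by
  have h2 := two_ne_zero_of_lt hp
  have h6 := six_ne_zero_of_lt hp
  rw [unipGamma, unip_apply]
  simp only [straighten, mul_def, Heis.mk.injEq, true_and]
  constructor <;> field_simp <;> ring

theorem straighten_injective : Function.Injective (straighten P) := by
  intro u v h
  rw [straighten, straighten, Heis.mk.injEq] at h
  obtain ⟨hx, hy, hz⟩ := h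
  rw [hy] at hz hx
  rw [hz] at hx
  exact Heis.ext (by linear_combination hx) hy (by linear_combination hz)

variable {hp P} {B : Type*} [SkewBrace B]

theorem isSkewBraceOfType_heis (e : BraceChart B (unipGamma hp P)) (hs : P.s ≠ 1) :
    IsSkewBraceOfType B (Heis p) (Heis p) := by
  have hs' : 1 - P.s ≠ 0 := sub_ne_zero.mpr hs.symm
  let f (u : Heis p) : Heis p :=
    ⟨(1 - P.s)⁻¹ * (straighten P u).x, u.y, (straighten P u).z⟩
  have hf : Function.Injective f := by
    intro u v h
    rw [Heis.mk.injEq] at h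
    exact straighten_injective P (Heis.ext (mul_left_cancel₀ (inv_ne_zero hs') h.1) h.2.1 h.2.2)
  refine ⟨⟨e.mulEquiv (.ofBijective f hf.bijective_of_finite) fun u v => ?_⟩, ⟨e.addEquiv⟩⟩
  let w := straighten P (u * unipGamma hp P u v)
  change (⟨(1 - P.s)⁻¹ * w.x, w.y, w.z⟩ : Heis p) = f u * f v
  rw [show w = _ from straighten_mul hp P u v, mul_def, Heis.mk.injEq]
  refine ⟨?_, rfl, rfl⟩
  simp only [f]
  field_simp

theorem isSkewBraceOfType_elemAb (e : BraceChart B (unipGamma hp P)) (hs : P.s = 1) :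
    IsSkewBraceOfType B (ElemAb p) (Heis p) := by
  let f : Heis p ≃ ElemAb p :=
    ((Equiv.ofBijective _ (straighten_injective P).bijective_of_finite).trans coordEquiv).trans
      Multiplicative.ofAdd
  refine ⟨⟨e.mulEquiv f fun u v => ?_⟩, ⟨e.addEquiv⟩⟩
  change Multiplicative.ofAdd (coordEquiv (straighten P (u * unipGamma hp P u v))) =
    Multiplicative.ofAdd (coordEquiv (straighten P u) + coordEquiv (straighten P v))
  rw [straighten_mul, hs, sub_self, zero_mul, zero_mul, add_zero]
  congr 1
  funext i
  fin_cases i <;> rfl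

end Heis

end MultiplicativeGroup

section RepresentativeSubgroups

namespace Heis

variable {p : ℕ} [Fact p.Prime] (hp : 3 < p)

theorem alpha1_eq_unip : alpha1 hp = unip hp ⟨0, 1, 0⟩ 1 := by
  rw [mulAut_ext_iff, alpha1, bracket_sigma, bracket_tau, unip_sigma, unip_tau]
  simp

theorem alpha2_eq_unip : alpha2 hp = unip hp ⟨1, 0, 0⟩ 1 := by
  rw [mulAut_ext_iff, alpha2, bracket_sigma, bracket_tau, unip_sigma, unip_tau]
  simp [Matrix.GeneralLinearGroup.mkOfDetNeZero]

theorem alpha3_eq_unip : alpha3 hp = unip hp ⟨0, 0, 1⟩ 1 := by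
  rw [mulAut_ext_iff, alpha3, bracket_sigma, bracket_tau, unip_sigma, unip_tau]
  simp

end Heis

/-- The parameters of the unipotent automorphism `α₁^a α₂^b α₃^c`, where `i = (a, b, c)`. -/
def UnipParam.ofExponents (p : ℕ) (i : ℕ × ℕ × ℕ) : UnipParam p := ⟨i.2.1, i.1, i.2.2⟩

namespace Heis

variable {p : ℕ} [Fact p.Prime] (hp : 3 < p) (i : ℕ × ℕ × ℕ)

theorem alpha_pow_mul_eq_unip : alpha1 hp ^ i.1 * alpha2 hp ^ i.2.1 * alpha3 hp ^ i.2.2 =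
    unip hp (.ofExponents p i) 1 := by
  rw [alpha1_eq_unip, alpha2_eq_unip, alpha3_eq_unip, ← unip_natCast, ← unip_natCast,
    ← unip_natCast, mulAut_ext_iff]
  simp only [MulAut.mul_apply, unip_apply]
  simp [UnipParam.ofExponents, sigma, tau]

/-- The gamma function of the skew brace given by `⟨ρ, τ, σ α₁^a α₂^b α₃^c⟩`. -/
noncomputable abbrev exponentGamma : Heis p → MulAut (Heis p) :=
  unipGamma hp (.ofExponents p i)

theorem isGammaFunction_exponentGamma : IsGammaFunction (exponentGamma hp i) :=
  isGammaFunction_unipGamma hp _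

variable {hp i}

theorem holSubgroup_le_graphSubgroup :
    holSubgroup hp i ≤ graphSubgroup (isGammaFunction_exponentGamma hp i) := by
  rw [holSubgroup, Subgroup.closure_le]
  rintro g (rfl | rfl | rfl)
  · exact (unip_zero hp _).symm
  · exact (unip_zero hp _).symm
  · rw [alpha_pow_mul_eq_unip]
    simp [mem_graphSubgroup, unipGamma, sigma]

theorem inl_mem_holSubgroup {v : Heis p} (hv : v.y = 0) :
    SemidirectProduct.inl v ∈ holSubgroup hp i := by
  have hρ : SemidirectProduct.inl (rho p) ∈ holSubgroup hp i := Subgroup.subset_closure (.inl rfl)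
  have hτ : SemidirectProduct.inl (tau p) ∈ holSubgroup hp i :=
    Subgroup.subset_closure (.inr (.inl rfl))
  rw [normal_form v, hv, ZMod.val_zero, pow_zero, mul_one, map_mul, map_pow, map_pow]
  exact mul_mem (pow_mem hρ _) (pow_mem hτ _)

theorem left_y_mul_of_mem {g : Hol (Heis p)}
    (hg : g ∈ graphSubgroup (isGammaFunction_exponentGamma hp i)) (h : Hol (Heis p)) :
    (g * h).left.y = g.left.y + h.left.y := by
  change (g.left * g.right h.left).y = _
  rw [mul_y, (mem_graphSubgroup _).mp hg, exponentGamma, unipGamma, unip_apply_y]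

theorem left_y_pow_of_mem {g : Hol (Heis p)}
    (hg : g ∈ graphSubgroup (isGammaFunction_exponentGamma hp i)) (n : ℕ) :
    (g ^ n).left.y = n * g.left.y := by
  induction n with
  | zero => rw [Nat.cast_zero, zero_mul]; rfl
  | succ n ih => rw [pow_succ', left_y_mul_of_mem hg, ih, Nat.cast_succ]; ring

theorem holSubgroup_eq_graphSubgroup :
    holSubgroup hp i = graphSubgroup (isGammaFunction_exponentGamma hp i) := by
  refine le_antisymm holSubgroup_le_graphSubgroup fun g hg => ?_
  obtain ⟨w, hw, hwy⟩ : ∃ w ∈ holSubgroup hp i, w.left.y = 1 :=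
    ⟨_, Subgroup.subset_closure (Or.inr (Or.inr rfl)), by
      rw [alpha_pow_mul_eq_unip]
      simp [sigma]⟩
  set n := g.left.y.val
  set h := g * (w ^ n)⁻¹ with hdef
  have hw' := holSubgroup_le_graphSubgroup hw
  have hh : h ∈ graphSubgroup (isGammaFunction_exponentGamma hp i) :=
    mul_mem hg (inv_mem (pow_mem hw' n))
  have hgh : g = h * w ^ n := by rw [hdef, inv_mul_cancel_right]
  have hy : h.left.y = 0 := by
    have hsum := left_y_mul_of_mem hh (w ^ n)
    rw [← hgh, left_y_pow_of_mem hw', hwy, mul_one, ZMod.natCast_zmod_val] at hsum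
    exact right_eq_add.mp hsum
  have hinl : h = SemidirectProduct.inl h.left :=
    SemidirectProduct.ext rfl (by
      rw [(mem_graphSubgroup _).mp hh, exponentGamma, unipGamma, hy, unip_zero,
        SemidirectProduct.right_inl])
  rw [hgh, hinl]
  exact mul_mem (inl_mem_holSubgroup hy) (pow_mem hw n)

theorem isRegular_holSubgroup : Hol.IsRegular (holSubgroup hp i) := by
  rw [holSubgroup_eq_graphSubgroup]
  exact isRegular_graphSubgroup _

theorem right_eq_of_mem_holSubgroup : ∀ g ∈ holSubgroup hp i, g.right = exponentGamma hp i g.left :=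
  holSubgroup_le_graphSubgroup

end Heis

end RepresentativeSubgroups

section Representatives

theorem mem_exponents_iff {p : ℕ} (hp : 3 < p) {a b c : ℕ} : (a, b, c) ∈ exponentsM p ∪ exponentsC ↔
    (a = 1 ∧ b = 0 ∧ c = 0) ∨ (a = 0 ∧ b = 1 ∧ c < p) ∨ (a = 0 ∧ b = 0 ∧ 1 ≤ c ∧ c < p) := by
  simp only [exponentsM, exponentsC, Set.mem_union, Set.mem_ofPred_eq, Set.mem_insert_iff,
    Set.mem_singleton_iff, Prod.mk.injEq]
  constructor
  · rintro ((h | h | ⟨d, h⟩) | h | h) <;> omega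
  · intro h
    by_cases hc : 2 ≤ c
    · exact Or.inl (Or.inr (Or.inr ⟨c, by omega⟩))
    · omega

variable {p : ℕ} [Fact p.Prime] (hp : 3 < p)

namespace UnipParam

include hp in
theorem ofExponents_ne_zero {i : ℕ × ℕ × ℕ} (hi : i ∈ exponentsM p ∪ exponentsC) :
    ofExponents p i ≠ 0 := by
  obtain ⟨a, b, c⟩ := i
  intro h
  have ht : (b : ZMod p) = 0 := congrArg t h
  have hr : (a : ZMod p) = 0 := congrArg r h
  have hs : (c : ZMod p) = 0 := congrArg s h
  rcases (mem_exponents_iff hp).mp hi with ⟨rfl, -, -⟩ | ⟨-, rfl, -⟩ | ⟨-, -, hc, hcp⟩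
  · simp at hr
  · simp at ht
  · exact Heis.natCast_ne_zero_of_lt hc hcp hs

theorem ofExponents_s_of_mem_exponentsC {i : ℕ × ℕ × ℕ} (hi : i ∈ exponentsC) :
    (ofExponents p i).s = 1 := by
  rcases hi with rfl | rfl <;> exact Nat.cast_one

include hp in
theorem ofExponents_s_of_mem_exponentsM {i : ℕ × ℕ × ℕ} (hi : i ∈ exponentsM p) :
    (ofExponents p i).s ≠ 1 := by
  intro h
  have hlt : i.2.2 < p ∧ i.2.2 ≠ 1 := by
    rcases hi with rfl | rfl | ⟨c, hc, hcp, rfl | rfl⟩ <;> dsimp only <;> omega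
  exact hlt.2 (CharP.natCast_injOn_Iio (ZMod p) p hlt.1 (by omega : 1 < p)
    (h.trans Nat.cast_one.symm))

end UnipParam

namespace Heis

theorem eq_of_intertwines {i j : ℕ × ℕ × ℕ} (hi : i ∈ exponentsM p ∪ exponentsC)
    (hj : j ∈ exponentsM p ∪ exponentsC) {φ : MulAut (Heis p)}
    (hφ : Intertwines (exponentGamma hp i) (exponentGamma hp j) φ) : i = j := by
  obtain ⟨A, b₁, b₂, rfl⟩ := exists_eq_bracket hp φ
  rw [intertwines_unipGamma_bracket_iff hp (UnipParam.ofExponents_ne_zero hp hj)] at hφ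
  obtain ⟨hA, ht, hs, -⟩ := hφ
  have hdet := det_ne_zero A
  rw [Matrix.det_fin_two, hA, zero_mul, sub_zero] at hdet
  have ha := left_ne_zero_of_mul hdet
  have hd := right_ne_zero_of_mul hdet
  obtain ⟨a, b, c⟩ := i
  obtain ⟨a', b', c'⟩ := j
  simp only [UnipParam.ofExponents] at ht hs
  rw [mem_exponents_iff hp] at hi hj
  have hc : c = c' := CharP.natCast_injOn_Iio (ZMod p) p (by grind) (by grind) hs
  have hb : b = b' := by
    rcases (by omega : b = 0 ∨ b = 1) with rfl | rfl <;>
      rcases (by omega : b' = 0 ∨ b' = 1) with rfl | rfl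
    · rfl
    · simp only [Nat.cast_zero, mul_zero, Nat.cast_one, mul_one] at ht
      exact absurd ht.symm (pow_ne_zero 2 ha)
    · simp [hd] at ht
    · rfl
  have ha' : a = a' := by omega
  rw [ha', hb, hc]

theorem exists_intertwines {P : UnipParam p} (hP : P ≠ 0) :
    ∃ i ∈ exponentsM p ∪ exponentsC, ∃ φ, Intertwines (unipGamma hp P) (exponentGamma hp i) φ := by
  obtain ⟨t, r, s⟩ := P
  suffices h : ∃ i ∈ exponentsM p ∪ exponentsC, ∃ (A : GL (Fin 2) (ZMod p)) (b₂ : ZMod p),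
      Intertwines (unipGamma hp ⟨t, r, s⟩) (exponentGamma hp i) (bracket hp A 0 b₂) by
    obtain ⟨i, hi, A, b₂, hφ⟩ := h
    exact ⟨i, hi, _, hφ⟩
  rcases eq_or_ne t 0 with rfl | ht
  · rcases eq_or_ne s 0 with rfl | hs
    · have hr : r ≠ 0 := by
        rintro rfl
        exact hP rfl
      have hi : (1, 0, 0) ∈ exponentsM p ∪ exponentsC := (mem_exponents_iff hp).mpr (by simp)
      refine ⟨_, hi, .mkOfDetNeZero !![1, 0; 0, r⁻¹] (by simp [hr]), 0, ?_⟩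
      rw [intertwines_unipGamma_bracket_iff hp (UnipParam.ofExponents_ne_zero hp hi)]
      simp [Matrix.GeneralLinearGroup.mkOfDetNeZero, UnipParam.ofExponents, hr]
    · have hi : (0, 0, s.val) ∈ exponentsM p ∪ exponentsC := (mem_exponents_iff hp).mpr
        (.inr (.inr ⟨rfl, rfl, ZMod.val_pos.mpr hs, s.val_lt⟩))
      refine ⟨_, hi, .mkOfDetNeZero !![1, 0; r / s, 1] (by simp), 0, ?_⟩
      rw [intertwines_unipGamma_bracket_iff hp (UnipParam.ofExponents_ne_zero hp hi)]
      simp [Matrix.GeneralLinearGroup.mkOfDetNeZero, UnipParam.ofExponents, hs]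
  · have hi : (0, 1, s.val) ∈ exponentsM p ∪ exponentsC := (mem_exponents_iff hp).mpr
      (.inr (.inl ⟨rfl, rfl, s.val_lt⟩))
    refine ⟨_, hi, .mkOfDetNeZero !![1, 0; 0, t⁻¹] (by simp [ht]), -(t⁻¹ * r) * t⁻¹, ?_⟩
    rw [intertwines_unipGamma_bracket_iff hp (UnipParam.ofExponents_ne_zero hp hi)]
    simp [Matrix.GeneralLinearGroup.mkOfDetNeZero, UnipParam.ofExponents, ht]

end Heis

end Representatives

section IndexSubgroups

namespace Heis

variable {p : ℕ} [Fact p.Prime]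

/-- The homomorphism to the additive group of `𝔽_p` which sends `σ` to `a` and `τ` to `b`. -/
def linHom (a b : ZMod p) : Heis p →* Multiplicative (ZMod p) where
  toFun v := Multiplicative.ofAdd (a * v.y + b * v.z)
  map_one' := by simp [one_def]
  map_mul' u v := by
    rw [← ofAdd_add, mul_y, mul_z]
    congr 1
    ring

theorem exists_eq_linHom (f : Heis p →* Multiplicative (ZMod p)) : ∃ a b, f = linHom a b :=
  ⟨(f (sigma p)).toAdd, (f (tau p)).toAdd,
    hom_ext (by simp [linHom, sigma]) (by simp [linHom, tau])⟩

theorem exists_ker_linHom_eq {H : Subgroup (Heis p)} (hH : H.index = p) :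
    ∃ a b, (linHom a b).ker = H := by
  have hp : p.Prime := Fact.out
  have hn : H.Normal := by
    apply Subgroup.normal_of_index_eq_minFac_card
    rw [hH, natCard, hp.pow_minFac three_ne_zero]
  let e : Heis p ⧸ H ≃* Multiplicative (ZMod p) := mulEquivOfPrimeCardEq hH (Nat.card_zmod p)
  obtain ⟨a, b, hab⟩ := exists_eq_linHom (e.toMonoidHom.comp (QuotientGroup.mk' H))
  refine ⟨a, b, ?_⟩
  rw [← hab]
  exact (MonoidHom.ker_mulEquiv_comp _ e).trans (QuotientGroup.ker_mk' H)

theorem exists_mulAut_y_eq (hp : 3 < p) {a b : ZMod p} (hab : a ≠ 0 ∨ b ≠ 0) :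
    ∃ φ : MulAut (Heis p), ∀ v, (φ v).y = a * v.y + b * v.z := by
  obtain ⟨A, ha, hb⟩ : ∃ A : GL (Fin 2) (ZMod p), A.val 0 0 = a ∧ A.val 0 1 = b := by
    rcases hab with ha | hb
    · exact ⟨.mkOfDetNeZero !![a, b; 0, 1] (by simp [ha]), rfl, rfl⟩
    · exact ⟨.mkOfDetNeZero !![a, b; 1, 0] (by simp [hb]), rfl, rfl⟩
  exact ⟨bracket hp A 0 0, fun v => by rw [bracket_apply, ha, hb]⟩

theorem exists_mulAut_mem_iff_y_eq_zero (hp : 3 < p) {H : Subgroup (Heis p)} (hH : H.index = p) :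
    ∃ φ : MulAut (Heis p), ∀ v, v ∈ H ↔ (φ v).y = 0 := by
  obtain ⟨a, b, rfl⟩ := exists_ker_linHom_eq hH
  have hab : a ≠ 0 ∨ b ≠ 0 := by
    by_contra! h
    have htop : (linHom a b).ker = ⊤ := by
      ext v
      simp [linHom, MonoidHom.mem_ker, h]
    rw [htop, Subgroup.index_top] at hH
    omega
  obtain ⟨φ, hφ⟩ := exists_mulAut_y_eq hp hab
  exact ⟨φ, fun v => by rw [hφ]; exact ofAdd_eq_one⟩

end Heis

end IndexSubgroups

section GammaFunctionsWithLargeKernel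

namespace Heis

variable {p : ℕ} [Fact p.Prime] (hp : 3 < p)

theorem pow_apply_y {φ : MulAut (Heis p)} {a : ZMod p} (hy : ∀ v, (φ v).y = a * v.y) (n : ℕ)
    (v : Heis p) : ((φ ^ n) v).y = a ^ n * v.y := by
  induction n with
  | zero => simp
  | succ n ih => rw [pow_succ', MulAut.mul_apply, hy, ih, pow_succ', mul_assoc]

theorem pow_apply_z {φ : MulAut (Heis p)} {a d : ZMod p} (hy : ∀ v, (φ v).y = a * v.y)
    (hz : ∀ v, v.y = 0 → (φ v).z = d * v.z) (n : ℕ) {v : Heis p} (hv : v.y = 0) :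
    ((φ ^ n) v).z = d ^ n * v.z := by
  induction n with
  | zero => simp
  | succ n ih =>
    rw [pow_succ', MulAut.mul_apply, hz _ (by rw [pow_apply_y hy, hv, mul_zero]), ih, pow_succ',
      mul_assoc]

theorem exists_eq_unip {φ : MulAut (Heis p)} (hφ : φ ^ p = 1) (hτ : (φ (tau p)).y = 0) :
    ∃ P : UnipParam p, φ = unip hp P 1 := by
  obtain ⟨A, b₁, b₂, rfl⟩ := exists_eq_bracket hp φ
  have hA : A.val 0 1 = 0 := by rwa [bracket_tau] at hτ
  have hy (v : Heis p) : (bracket hp A b₁ b₂ v).y = A.val 0 0 * v.y := by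
    simp [bracket_apply, hA]
  have hz (v : Heis p) (hv : v.y = 0) : (bracket hp A b₁ b₂ v).z = A.val 1 1 * v.z := by
    simp [bracket_apply, hv]
  have h00 : A.val 0 0 = 1 := by
    have h := pow_apply_y hy p (sigma p)
    rw [hφ, MulAut.one_apply, ZMod.pow_card] at h
    simpa [sigma] using h.symm
  have h11 : A.val 1 1 = 1 := by
    have h := pow_apply_z hy hz p (v := tau p) rfl
    rw [hφ, MulAut.one_apply, ZMod.pow_card] at h
    simpa [tau] using h.symm
  refine ⟨⟨A.val 1 0, b₁, b₂⟩, mulAut_ext ?_ ?_⟩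
  · rw [bracket_sigma, unip_sigma, h00]
    simp
  · rw [bracket_tau, unip_tau, hA, h11, one_mul]

theorem exists_eq_unipGamma {γ : Heis p → MulAut (Heis p)} (hγ : IsGammaFunction γ)
    (hpow : ∀ u, γ u ^ p = 1) (hker : ∀ v, γ v = 1 ↔ v.y = 0) :
    ∃ P : UnipParam p, P ≠ 0 ∧ γ = unipGamma hp P := by
  have heq (u v : Heis p) : γ u = γ v ↔ u.y = v.y := by
    rw [hγ.eq_iff, hker, mul_y, inv_y, ← sub_eq_add_neg, sub_eq_zero]
  have hτ : (γ (sigma p) (tau p)).y = 0 := by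
    have h := hγ (sigma p) (tau p)
    rw [(hker (tau p)).mpr rfl, mul_one, heq, mul_y] at h
    exact left_eq_add.mp h.symm
  obtain ⟨P, hP⟩ := exists_eq_unip hp (hpow (sigma p)) hτ
  have hnat (n : ℕ) : γ ⟨0, n, 0⟩ = unip hp P n := by
    induction n with
    | zero =>
      rw [Nat.cast_zero, unip_zero]
      exact (hker _).mpr rfl
    | succ n ih =>
      rw [Nat.cast_succ, add_comm, unip_add, ← ih, ← hP, ← hγ, heq, mul_y, hP, unip_apply_y]
      rfl
  refine ⟨P, ?_, funext fun u => ?_⟩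
  · rintro rfl
    have hσ : γ (sigma p) = 1 := by
      rw [hP, mulAut_ext_iff, unip_sigma, unip_tau]
      simp [sigma, tau, show (0 : UnipParam p) = ⟨0, 0, 0⟩ from rfl]
    exact one_ne_zero ((hker _).mp hσ)
  · rw [unipGamma, ← ZMod.natCast_zmod_val u.y, ← hnat, heq, ZMod.natCast_zmod_val]

theorem exists_intertwines_unipGamma {γ : Heis p → MulAut (Heis p)} (hγ : IsGammaFunction γ)
    (hcard : Nat.card (Set.range γ) = p) :
    ∃ P : UnipParam p, P ≠ 0 ∧ ∃ φ, Intertwines γ (unipGamma hp P) φ := by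
  obtain ⟨φ, hφ⟩ := exists_mulAut_mem_iff_y_eq_zero hp (hγ.index_ker.trans hcard)
  have hpow (u : Heis p) : conjGamma φ γ u ^ p = 1 := by
    have hu := hγ.pow_card_range_eq_one (φ⁻¹ u)
    rw [hcard] at hu
    rw [conjGamma, conj_pow, hu, mul_one, mul_inv_cancel]
  have hker (v : Heis p) : conjGamma φ γ v = 1 ↔ v.y = 0 := by
    rw [conjGamma, mul_inv_eq_one, mul_eq_left, ← hγ.mem_ker, hφ, MulAut.apply_inv_self]
  obtain ⟨P, hP, h⟩ := exists_eq_unipGamma hp (hγ.conj φ) hpow hker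
  exact ⟨P, hP, φ, h ▸ intertwines_conjGamma φ⟩

theorem exists_intertwines_exponentGamma {γ : Heis p → MulAut (Heis p)} (hγ : IsGammaFunction γ)
    (hcard : Nat.card (Set.range γ) = p) :
    ∃ i ∈ exponentsM p ∪ exponentsC, ∃ φ, Intertwines γ (exponentGamma hp i) φ := by
  obtain ⟨P, hP, φ, hφ⟩ := exists_intertwines_unipGamma hp hγ hcard
  obtain ⟨i, hi, ψ, hψ⟩ := exists_intertwines hp hP
  exact ⟨i, hi, ψ * φ, hφ.trans hψ⟩

end Heis

end GammaFunctionsWithLargeKernel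

section LowerTriangularAutomorphisms

namespace Heis

variable {p : ℕ} [Fact p.Prime]

theorem exists_eq_lowerGL {A : GL (Fin 2) (ZMod p)} (hA : A.val 0 1 = 0) :
    ∃ a d c, A = lowerGL a d c := by
  have hdet := det_ne_zero A
  rw [Matrix.det_fin_two, hA, zero_mul, sub_zero] at hdet
  refine ⟨.mk0 _ (left_ne_zero_of_mul hdet), .mk0 _ (right_ne_zero_of_mul hdet), A.val 1 0,
    Units.ext ((Matrix.eta_fin_two A.val).trans ?_)⟩
  rw [hA]
  rfl

theorem lowerGL_injective {a d a' d' : (ZMod p)ˣ} {c c' : ZMod p}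
    (h : lowerGL a d c = lowerGL a' d' c') : a = a' ∧ d = d' ∧ c = c' := by
  have hval := congrArg Units.val h
  rw [lowerGL_val, lowerGL_val] at hval
  exact ⟨Units.ext (congrFun₂ hval 0 0), Units.ext (congrFun₂ hval 1 1), congrFun₂ hval 1 0⟩

theorem exists_val_eq_and_iff {a c d : ZMod p} {q : GL (Fin 2) (ZMod p) → Prop} :
    (∃ A : GL (Fin 2) (ZMod p), A.val = !![a, 0; c, d] ∧ q A) ↔
      ∃ a' d' : (ZMod p)ˣ, (a' : ZMod p) = a ∧ (d' : ZMod p) = d ∧ q (lowerGL a' d' c) := by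
  constructor
  · rintro ⟨A, hA, hq⟩
    obtain ⟨a', d', c', rfl⟩ := exists_eq_lowerGL (A := A) (by rw [hA]; rfl)
    rw [lowerGL_val] at hA
    obtain rfl : c' = c := congrFun₂ hA 1 0
    exact ⟨a', d', congrFun₂ hA 0 0, congrFun₂ hA 1 1, hq⟩
  · rintro ⟨a', d', rfl, rfl, hq⟩
    exact ⟨_, lowerGL_val a' d' c, hq⟩

variable (hp : 3 < p)

/-- The automorphism `α₁^r₁ α₃^r₃ A` of the Heisenberg group, where `A` is the lower triangular
matrix with diagonal entries `a`, `d` and third entry `c`. -/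
noncomputable def lowerAut (a d : (ZMod p)ˣ) (c r₁ r₃ : ZMod p) : MulAut (Heis p) :=
  alpha1 hp ^ r₁.val * alpha3 hp ^ r₃.val * alphaGL hp (lowerGL a d c)

theorem lowerAut_eq_bracket (a d : (ZMod p)ˣ) (c r₁ r₃ : ZMod p) : lowerAut hp a d c r₁ r₃ =
    bracket hp (lowerGL a d c) (a * c / 2 + r₁ * a + r₃ * c) (r₃ * d) := by
  rw [lowerAut, alpha1_eq_unip, alpha3_eq_unip, ← unip_natCast, ← unip_natCast, alphaGL]
  simp only [ZMod.natCast_zmod_val, mulAut_ext_iff, MulAut.mul_apply, bracket_sigma, bracket_tau,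
    unip_apply, lowerGL_val]
  constructor
  · ext <;> simp
    ring
  · ext <;> simp

theorem lowerAut_injective {a d a' d' : (ZMod p)ˣ} {c r₁ r₃ c' r₁' r₃' : ZMod p}
    (h : lowerAut hp a d c r₁ r₃ = lowerAut hp a' d' c' r₁' r₃') :
    a = a' ∧ d = d' ∧ c = c' ∧ r₁ = r₁' ∧ r₃ = r₃' := by
  rw [lowerAut_eq_bracket, lowerAut_eq_bracket] at h
  obtain ⟨hA, h₁, h₂⟩ := bracket_injective hp h
  obtain ⟨rfl, rfl, rfl⟩ := lowerGL_injective hA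
  obtain rfl := mul_right_cancel₀ d.ne_zero h₂
  exact ⟨rfl, rfl, rfl, mul_right_cancel₀ a.ne_zero (add_left_cancel (add_right_cancel h₁)), rfl⟩

theorem bracket_lowerGL_eq_lowerAut (a d : (ZMod p)ˣ) (c b₁ b₂ : ZMod p) :
    bracket hp (lowerGL a d c) b₁ b₂ =
      lowerAut hp a d c ((b₁ - a * c / 2 - b₂ / d * c) / a) (b₂ / d) := by
  rw [lowerAut_eq_bracket, div_mul_cancel₀ _ d.ne_zero, div_mul_cancel₀ _ a.ne_zero]
  congr 1
  ring

variable {P : UnipParam p}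

theorem intertwines_unipGamma_self_iff (hP : P ≠ 0) {φ : MulAut (Heis p)} :
    Intertwines (unipGamma hp P) (unipGamma hp P) φ ↔ ∃ a d c r₁ r₃, lowerAut hp a d c r₁ r₃ = φ ∧
      d * P.t = a ^ 2 * P.t ∧ a * d * P.r + r₃ * d * P.t = a ^ 2 * P.r +
        2⁻¹ * (a ^ 2 * (a - 1)) * (P.t * (P.s + 1)) + a * c * P.s := by
  have hiff (a d : (ZMod p)ˣ) (c b₁ b₂ : ZMod p) :=
    intertwines_unipGamma_bracket_iff hp (P := P) hP (lowerGL a d c) b₁ b₂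
  constructor
  · intro h
    obtain ⟨A, b₁, b₂, rfl⟩ := exists_eq_bracket hp φ
    obtain ⟨a, d, c, rfl⟩ :=
      exists_eq_lowerGL ((intertwines_unipGamma_bracket_iff hp hP _ _ _).mp h).1
    obtain ⟨-, ht, -, hr⟩ := (hiff a d c b₁ b₂).mp h
    refine ⟨a, d, c, _, _, (bracket_lowerGL_eq_lowerAut hp a d c b₁ b₂).symm, ht, ?_⟩
    rw [div_mul_cancel₀ _ d.ne_zero]
    exact hr
  · rintro ⟨a, d, c, r₁, r₃, rfl, ht, hr⟩
    rw [lowerAut_eq_bracket]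
    exact (hiff _ _ _ _ _).mpr ⟨rfl, ht, rfl, hr⟩

end Heis

end LowerTriangularAutomorphisms

section AutomorphismGroups

namespace Heis

variable {p : ℕ} [Fact p.Prime] (hp : 3 < p)

theorem setOf_intertwines_alpha1 {r : ZMod p} (hr : r ≠ 0) :
    {φ | Intertwines (unipGamma hp ⟨0, r, 0⟩) (unipGamma hp ⟨0, r, 0⟩) φ} =
      Set.range fun k : (ZMod p)ˣ × ZMod p × ZMod p × ZMod p =>
        lowerAut hp k.1 k.1 k.2.1 k.2.2.1 k.2.2.2 := by
  ext φ
  rw [Set.mem_ofPred_eq, intertwines_unipGamma_self_iff hp fun h => hr (congrArg UnipParam.r h)]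
  simp only [mul_zero, zero_mul, add_zero, true_and, Set.mem_range, Prod.exists]
  constructor
  · rintro ⟨a, d, c, r₁, r₃, rfl, h⟩
    obtain rfl : a = d := Units.ext (mul_left_cancel₀ a.ne_zero
      ((pow_two _).symm.trans (mul_right_cancel₀ hr h).symm))
    exact ⟨a, c, r₁, r₃, rfl⟩
  · rintro ⟨a, c, r₁, r₃, rfl⟩
    exact ⟨a, a, c, r₁, r₃, rfl, by rw [pow_two]⟩

theorem setOf_intertwines_alpha3 {s : ZMod p} (hs : s ≠ 0) :
    {φ | Intertwines (unipGamma hp ⟨0, 0, s⟩) (unipGamma hp ⟨0, 0, s⟩) φ} =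
      Set.range fun k : (ZMod p)ˣ × (ZMod p)ˣ × ZMod p × ZMod p =>
        lowerAut hp k.1 k.2.1 0 k.2.2.1 k.2.2.2 := by
  ext φ
  rw [Set.mem_ofPred_eq, intertwines_unipGamma_self_iff hp fun h => hs (congrArg UnipParam.s h)]
  simp only [mul_zero, zero_mul, add_zero, zero_add, true_and, Set.mem_range, Prod.exists]
  constructor
  · rintro ⟨a, d, c, r₁, r₃, rfl, h⟩
    obtain rfl : c = 0 := by simpa [hs] using h.symm
    exact ⟨a, d, r₁, r₃, rfl⟩
  · rintro ⟨a, d, r₁, r₃, rfl⟩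
    exact ⟨a, d, 0, r₁, r₃, rfl, by rw [mul_zero, zero_mul]⟩

theorem setOf_intertwines_alpha2_alpha3 (s : ZMod p) :
    {φ | Intertwines (unipGamma hp ⟨1, 0, s⟩) (unipGamma hp ⟨1, 0, s⟩) φ} =
      Set.range fun k : (ZMod p)ˣ × ZMod p × ZMod p =>
        lowerAut hp k.1 (k.1 ^ 2) k.2.1 k.2.2
          (s * (k.1 : ZMod p)⁻¹ * k.2.1 + 2⁻¹ * (k.1 - 1) * (s + 1)) := by
  ext φ
  rw [Set.mem_ofPred_eq,
    intertwines_unipGamma_self_iff hp fun h => one_ne_zero (congrArg UnipParam.t h)]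
  simp only [mul_zero, mul_one, one_mul, zero_add, Set.mem_range, Prod.exists]
  constructor
  · rintro ⟨a, d, c, r₁, r₃, rfl, hd, h⟩
    obtain rfl : a ^ 2 = d := Units.ext (hd ▸ Units.val_pow_eq_pow_val a 2)
    refine ⟨a, c, r₁, congrArg _ (mul_right_cancel₀ (a ^ 2).ne_zero (.trans ?_ h.symm))⟩
    rw [Units.val_pow_eq_pow_val]
    field_simp
    ring
  · rintro ⟨a, c, r₁, rfl⟩
    refine ⟨a, a ^ 2, c, r₁, _, rfl, Units.val_pow_eq_pow_val a 2, ?_⟩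
    rw [Units.val_pow_eq_pow_val]
    field_simp
    ring

theorem card_intertwines_alpha1 {r : ZMod p} (hr : r ≠ 0) :
    Nat.card {φ | Intertwines (unipGamma hp ⟨0, r, 0⟩) (unipGamma hp ⟨0, r, 0⟩) φ} =
      (p - 1) * p ^ 3 := by
  rw [setOf_intertwines_alpha1 hp hr, Nat.card_range_of_injective]
  · simp only [Nat.card_eq_fintype_card, Fintype.card_prod, ZMod.card, ZMod.card_units]
    ring
  · rintro ⟨a, c, r₁, r₃⟩ ⟨a', c', r₁', r₃'⟩ h
    obtain ⟨rfl, -, rfl, rfl, rfl⟩ := lowerAut_injective hp h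
    rfl

theorem card_intertwines_alpha3 {s : ZMod p} (hs : s ≠ 0) :
    Nat.card {φ | Intertwines (unipGamma hp ⟨0, 0, s⟩) (unipGamma hp ⟨0, 0, s⟩) φ} =
      (p - 1) ^ 2 * p ^ 2 := by
  rw [setOf_intertwines_alpha3 hp hs, Nat.card_range_of_injective]
  · simp only [Nat.card_eq_fintype_card, Fintype.card_prod, ZMod.card, ZMod.card_units]
    ring
  · rintro ⟨a, d, r₁, r₃⟩ ⟨a', d', r₁', r₃'⟩ h
    obtain ⟨rfl, rfl, -, rfl, rfl⟩ := lowerAut_injective hp h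
    rfl

theorem card_intertwines_alpha2_alpha3 (s : ZMod p) :
    Nat.card {φ | Intertwines (unipGamma hp ⟨1, 0, s⟩) (unipGamma hp ⟨1, 0, s⟩) φ} =
      (p - 1) * p ^ 2 := by
  rw [setOf_intertwines_alpha2_alpha3, Nat.card_range_of_injective]
  · simp only [Nat.card_eq_fintype_card, Fintype.card_prod, ZMod.card, ZMod.card_units]
    ring
  · rintro ⟨a, c, r₁⟩ ⟨a', c', r₁'⟩ h
    obtain ⟨rfl, -, rfl, rfl, -⟩ := lowerAut_injective hp h
    rfl

theorem setOf_alphaGL_scalar_eq_range :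
    {α | ∃ (r₁ r₃ b₁ b₃ : ZMod p) (A : GL (Fin 2) (ZMod p)), A.val = !![b₁, 0; b₃, b₁] ∧
      α = alpha1 hp ^ r₁.val * alpha3 hp ^ r₃.val * alphaGL hp A} =
    Set.range fun k : (ZMod p)ˣ × ZMod p × ZMod p × ZMod p =>
      lowerAut hp k.1 k.1 k.2.1 k.2.2.1 k.2.2.2 := by
  ext φ
  simp only [Set.mem_ofPred_eq, exists_val_eq_and_iff, Set.mem_range, Prod.exists]
  constructor
  · rintro ⟨r₁, r₃, b₁, b₃, a, d, rfl, hd, rfl⟩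
    obtain rfl := Units.ext hd
    exact ⟨d, b₃, r₁, r₃, rfl⟩
  · rintro ⟨a, c, r₁, r₃, rfl⟩
    exact ⟨r₁, r₃, a, c, a, a, rfl, rfl, rfl⟩

theorem setOf_alphaGL_diagonal_eq_range :
    {α | ∃ (r₁ r₃ b₁ b₄ : ZMod p) (A : GL (Fin 2) (ZMod p)), A.val = !![b₁, 0; 0, b₄] ∧
      α = alpha1 hp ^ r₁.val * alpha3 hp ^ r₃.val * alphaGL hp A} =
    Set.range fun k : (ZMod p)ˣ × (ZMod p)ˣ × ZMod p × ZMod p =>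
      lowerAut hp k.1 k.2.1 0 k.2.2.1 k.2.2.2 := by
  ext φ
  simp only [Set.mem_ofPred_eq, exists_val_eq_and_iff, Set.mem_range, Prod.exists]
  constructor
  · rintro ⟨r₁, r₃, b₁, b₄, a, d, rfl, rfl, rfl⟩
    exact ⟨a, d, r₁, r₃, rfl⟩
  · rintro ⟨a, d, r₁, r₃, rfl⟩
    exact ⟨r₁, r₃, a, d, a, d, rfl, rfl, rfl⟩

theorem setOf_alphaGL_sq_eq_range (f : ZMod p → ZMod p → ZMod p) :
    {α | ∃ (r₁ b₁ b₃ : ZMod p) (A : GL (Fin 2) (ZMod p)), A.val = !![b₁, 0; b₃, b₁ ^ 2] ∧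
      α = alpha1 hp ^ r₁.val * alpha3 hp ^ (f b₁ b₃).val * alphaGL hp A} =
    Set.range fun k : (ZMod p)ˣ × ZMod p × ZMod p =>
      lowerAut hp k.1 (k.1 ^ 2) k.2.1 k.2.2 (f k.1 k.2.1) := by
  ext φ
  simp only [Set.mem_ofPred_eq, exists_val_eq_and_iff, Set.mem_range, Prod.exists]
  constructor
  · rintro ⟨r₁, b₁, b₃, a, d, rfl, hd, rfl⟩
    obtain rfl : a ^ 2 = d := Units.ext ((Units.val_pow_eq_pow_val a 2).trans hd.symm)
    exact ⟨a, b₃, r₁, rfl⟩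
  · rintro ⟨a, c, r₁, rfl⟩
    exact ⟨r₁, a, c, a, a ^ 2, rfl, Units.val_pow_eq_pow_val a 2, rfl⟩

end Heis

end AutomorphismGroups

section Classification

namespace Heis

variable {p : ℕ} [Fact p.Prime] (hp : 3 < p)

/-- The skew brace given by the regular subgroup `⟨ρ, τ, σ α₁^a α₂^b α₃^c⟩` of the holomorph, where
`i = (a, b, c)`. -/
abbrev StdBrace (i : ℕ × ℕ × ℕ) : Type :=
  Hol.Brace (holSubgroup hp i) isRegular_holSubgroup

/-- The chart of `StdBrace` with values in the Heisenberg group. -/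
noncomputable def stdChart (i : ℕ × ℕ × ℕ) : BraceChart (StdBrace hp i) (exponentGamma hp i) :=
  Hol.Brace.chart isRegular_holSubgroup right_eq_of_mem_holSubgroup

variable {hp}

theorem eq_of_stdBrace_iso {i j : ℕ × ℕ × ℕ} (hi : i ∈ exponentsM p ∪ exponentsC)
    (hj : j ∈ exponentsM p ∪ exponentsC)
    (h : Nonempty (SkewBraceIso (StdBrace hp i) (StdBrace hp j))) : i = j := by
  obtain ⟨φ, hφ⟩ := ((stdChart hp i).nonempty_iso_iff (stdChart hp j)).mp h
  exact eq_of_intertwines hp hi hj hφ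

theorem isSkewBraceOfType_stdBrace_heis {i : ℕ × ℕ × ℕ} (hi : i ∈ exponentsM p) :
    IsSkewBraceOfType (StdBrace hp i) (Heis p) (Heis p) :=
  isSkewBraceOfType_heis (stdChart hp i) (UnipParam.ofExponents_s_of_mem_exponentsM hp hi)

theorem isSkewBraceOfType_stdBrace_elemAb {i : ℕ × ℕ × ℕ} (hi : i ∈ exponentsC) :
    IsSkewBraceOfType (StdBrace hp i) (ElemAb p) (Heis p) :=
  isSkewBraceOfType_elemAb (stdChart hp i) (UnipParam.ofExponents_s_of_mem_exponentsC hi)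

theorem thetaCard_of_stdBrace_iso {B : Type*} [SkewBrace B] {i : ℕ × ℕ × ℕ}
    (hi : i ∈ exponentsM p ∪ exponentsC) (f : SkewBraceIso B (StdBrace hp i)) :
    SkewBrace.thetaCard B = p :=
  ((stdChart hp i).comp f).thetaCard_eq.trans
    (card_range_unipGamma hp (UnipParam.ofExponents_ne_zero hp hi))

variable (hp)

theorem exists_stdBrace_iso {B : Type*} [SkewBrace B] (e : Nonempty (B ≃+ Additive (Heis p)))
    (hB : SkewBrace.thetaCard B = p) :
    ∃ i ∈ exponentsM p ∪ exponentsC, Nonempty (SkewBraceIso B (StdBrace hp i)) := by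
  obtain ⟨e⟩ := e
  let c := BraceChart.ofAddEquiv e
  obtain ⟨i, hi, hφ⟩ :=
    exists_intertwines_exponentGamma hp c.isGammaFunction (c.thetaCard_eq.symm.trans hB)
  exact ⟨i, hi, (c.nonempty_iso_iff (stdChart hp i)).mpr hφ⟩

/-- The exponents of the representatives whose multiplicative group is isomorphic to `G`. -/
def indexSet (G : Type*) [Group G] : Set (ℕ × ℕ × ℕ) :=
  {i ∈ exponentsM p ∪ exponentsC | Nonempty (StdBrace hp i ≃* G)}

variable {G : Type*} [Group G]

theorem indexSet_eq_exponentsM (e : G ≃* Heis p) : indexSet hp G = exponentsM p := by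
  ext i
  refine ⟨fun ⟨hi, ⟨f⟩⟩ => hi.resolve_right fun hC => ?_, fun hi => ⟨.inl hi, ?_⟩⟩
  · obtain ⟨g⟩ := (isSkewBraceOfType_stdBrace_elemAb (hp := hp) hC).1
    exact not_nonempty_mulEquiv_elemAb ⟨(e.symm.trans f.symm).trans g⟩
  · exact (isSkewBraceOfType_stdBrace_heis hi).1.map fun g => g.trans e.symm

theorem indexSet_eq_exponentsC (e : G ≃* ElemAb p) : indexSet hp G = exponentsC := by
  ext i
  refine ⟨fun ⟨hi, ⟨f⟩⟩ => hi.resolve_left fun hM => ?_, fun hi => ⟨.inr hi, ?_⟩⟩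
  · obtain ⟨g⟩ := (isSkewBraceOfType_stdBrace_heis (hp := hp) hM).1
    exact not_nonempty_mulEquiv_elemAb ⟨(g.symm.trans f).trans e⟩
  · exact (isSkewBraceOfType_stdBrace_elemAb hi).1.map fun g => g.trans e.symm

theorem isSkewBraceOfType_and_thetaCard_eq_iff {B : Type*} [SkewBrace B] :
    IsSkewBraceOfType B G (Heis p) ∧ SkewBrace.thetaCard B = p ↔
      ∃ i ∈ indexSet hp G, Nonempty (SkewBraceIso B (StdBrace hp i)) := by
  constructor
  · rintro ⟨⟨⟨e⟩, he⟩, hB⟩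
    obtain ⟨i, hi, ⟨f⟩⟩ := exists_stdBrace_iso hp he hB
    exact ⟨i, ⟨hi, ⟨f.mulEquiv.symm.trans e⟩⟩, ⟨f⟩⟩
  · rintro ⟨i, ⟨hi, ⟨e⟩⟩, ⟨f⟩⟩
    exact ⟨⟨⟨f.mulEquiv.trans e⟩, ⟨f.addEquiv.trans (stdChart hp i).addEquiv⟩⟩,
      thetaCard_of_stdBrace_iso hi f⟩

theorem ncard_skewBraceClasses :
    (skewBraceClasses.{w} G (Heis p) p).ncard = (indexSet hp G).ncard := by
  let F (i : ℕ × ℕ × ℕ) : Quotient BundledSkewBrace.setoid.{w} :=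
    Quotient.mk _ ⟨ULift.{w} (StdBrace hp i)⟩
  have hF : skewBraceClasses.{w} G (Heis p) p = F '' indexSet hp G := by
    ext q
    constructor
    · rintro ⟨B, rfl, hB⟩
      obtain ⟨i, hi, ⟨f⟩⟩ := (isSkewBraceOfType_and_thetaCard_eq_iff hp).mp hB
      exact ⟨i, hi, Quotient.sound ⟨(SkewBraceIso.ulift _).trans f.symm⟩⟩
    · rintro ⟨i, hi, rfl⟩
      exact ⟨_, rfl,
        (isSkewBraceOfType_and_thetaCard_eq_iff hp).mpr ⟨i, hi, ⟨SkewBraceIso.ulift _⟩⟩⟩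
  have hinj : Set.InjOn F (indexSet hp G) := by
    intro i hi j hj hij
    obtain ⟨f⟩ := Quotient.exact hij
    exact eq_of_stdBrace_iso hi.1 hj.1
      ⟨((SkewBraceIso.ulift _).symm.trans f).trans (SkewBraceIso.ulift _)⟩
  rw [hF, hinj.ncard_image]

end Heis

/-- The exponents in `exponentsM p` as a finite set. -/
def exponentsFinsetM (p : ℕ) : Finset (ℕ × ℕ × ℕ) :=
  insert (1, 0, 0) (insert (0, 1, 0) ({0} ×ˢ {0, 1} ×ˢ Finset.Ico 2 p))

theorem coe_exponentsFinsetM (p : ℕ) : (exponentsFinsetM p : Set (ℕ × ℕ × ℕ)) = exponentsM p := by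
  ext ⟨a, b, c⟩
  simp only [exponentsFinsetM, exponentsM, Finset.coe_insert, Finset.coe_product,
    Set.mem_insert_iff, Set.mem_prod, SetLike.mem_coe, Finset.mem_singleton, Finset.mem_Ico,
    Set.mem_ofPred_eq, Prod.mk.injEq]
  constructor
  · rintro (h | h | ⟨ha, hb, hc⟩)
    · exact .inl h
    · exact .inr (.inl h)
    · exact .inr (.inr ⟨c, hc.1, hc.2, by tauto⟩)
  · rintro (h | h | ⟨c, h₁, h₂, h⟩) <;> omega

theorem sum_exponentsFinsetM (p : ℕ) (f : ℕ × ℕ × ℕ → ℕ) :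
    ∑ i ∈ exponentsFinsetM p, f i = f (1, 0, 0) + (f (0, 1, 0) +
      ∑ c ∈ Finset.Ico 2 p, (f (0, 0, c) + f (0, 1, c))) := by
  rw [exponentsFinsetM, Finset.sum_insert (by simp), Finset.sum_insert (by simp),
    Finset.sum_product, Finset.sum_singleton, Finset.sum_product_right]
  simp

theorem ncard_exponentsM {p : ℕ} (hp : 1 < p) : (exponentsM p).ncard = 2 * (p - 1) := by
  rw [← coe_exponentsFinsetM, Set.ncard_coe_finset, Finset.card_eq_sum_ones, sum_exponentsFinsetM]
  simp only [Finset.sum_const, Nat.card_Ico, smul_eq_mul]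
  omega

theorem ncard_exponentsC : exponentsC.ncard = 2 :=
  Set.ncard_pair (by simp)

end Classification

section RepresentativeAutomorphisms

namespace Heis

variable {p : ℕ} [Fact p.Prime] (hp : 3 < p)

theorem exponentGamma_alpha1 : exponentGamma hp (1, 0, 0) = unipGamma hp ⟨0, 1, 0⟩ := by
  simp [exponentGamma, UnipParam.ofExponents]

theorem exponentGamma_alpha3 (c : ℕ) : exponentGamma hp (0, 0, c) = unipGamma hp ⟨0, 0, c⟩ := by
  simp [exponentGamma, UnipParam.ofExponents]

theorem exponentGamma_alpha2_alpha3 (c : ℕ) :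
    exponentGamma hp (0, 1, c) = unipGamma hp ⟨1, 0, c⟩ := by
  simp [exponentGamma, UnipParam.ofExponents]

theorem range_autHom_stdBrace_alpha1 :
    Set.range (Hol.Brace.autHom _ (isRegular_holSubgroup (hp := hp) (i := (1, 0, 0)))) =
      {α | ∃ (r₁ r₃ b₁ b₃ : ZMod p) (A : GL (Fin 2) (ZMod p)), A.val = !![b₁, 0; b₃, b₁] ∧
        α = alpha1 hp ^ r₁.val * alpha3 hp ^ r₃.val * alphaGL hp A} := by
  rw [Hol.Brace.range_autHom _ right_eq_of_mem_holSubgroup, exponentGamma_alpha1,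
    setOf_intertwines_alpha1 hp one_ne_zero, setOf_alphaGL_scalar_eq_range]

theorem range_autHom_stdBrace_alpha3 {c : ℕ} (hc : (c : ZMod p) ≠ 0) :
    Set.range (Hol.Brace.autHom _ (isRegular_holSubgroup (hp := hp) (i := (0, 0, c)))) =
      {α | ∃ (r₁ r₃ b₁ b₄ : ZMod p) (A : GL (Fin 2) (ZMod p)), A.val = !![b₁, 0; 0, b₄] ∧
        α = alpha1 hp ^ r₁.val * alpha3 hp ^ r₃.val * alphaGL hp A} := by
  rw [Hol.Brace.range_autHom _ right_eq_of_mem_holSubgroup, exponentGamma_alpha3,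
    setOf_intertwines_alpha3 hp hc, setOf_alphaGL_diagonal_eq_range]

theorem range_autHom_stdBrace_alpha2_alpha3 (c : ℕ) :
    Set.range (Hol.Brace.autHom _ (isRegular_holSubgroup (hp := hp) (i := (0, 1, c)))) =
      {α | ∃ (r₁ b₁ b₃ : ZMod p) (A : GL (Fin 2) (ZMod p)), A.val = !![b₁, 0; b₃, b₁ ^ 2] ∧
        α = alpha1 hp ^ r₁.val *
          alpha3 hp ^ ((c : ZMod p) * b₁⁻¹ * b₃ + 2⁻¹ * (b₁ - 1) * (c + 1)).val *
          alphaGL hp A} := by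
  rw [Hol.Brace.range_autHom _ right_eq_of_mem_holSubgroup, exponentGamma_alpha2_alpha3,
    setOf_intertwines_alpha2_alpha3, setOf_alphaGL_sq_eq_range hp
      fun b₁ b₃ => c * b₁⁻¹ * b₃ + 2⁻¹ * (b₁ - 1) * (c + 1)]

theorem range_autHom_stdBrace_alpha2 :
    Set.range (Hol.Brace.autHom _ (isRegular_holSubgroup (hp := hp) (i := (0, 1, 0)))) =
      {α | ∃ (r₁ b₁ b₃ : ZMod p) (A : GL (Fin 2) (ZMod p)), A.val = !![b₁, 0; b₃, b₁ ^ 2] ∧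
        α = alpha1 hp ^ r₁.val * alpha3 hp ^ (2⁻¹ * (b₁ - 1)).val * alphaGL hp A} := by
  simpa using range_autHom_stdBrace_alpha2_alpha3 hp 0

theorem card_aut_stdBrace_alpha1 :
    Nat.card (SkewBraceIso (StdBrace hp (1, 0, 0)) (StdBrace hp (1, 0, 0))) =
      (p - 1) * p ^ 3 := by
  rw [Nat.card_congr ((stdChart hp _).isoEquiv (stdChart hp _)), exponentGamma_alpha1,
    card_intertwines_alpha1 hp one_ne_zero]

theorem card_aut_stdBrace_alpha3 {c : ℕ} (hc : (c : ZMod p) ≠ 0) :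
    Nat.card (SkewBraceIso (StdBrace hp (0, 0, c)) (StdBrace hp (0, 0, c))) =
      (p - 1) ^ 2 * p ^ 2 := by
  rw [Nat.card_congr ((stdChart hp _).isoEquiv (stdChart hp _)), exponentGamma_alpha3,
    card_intertwines_alpha3 hp hc]

theorem card_aut_stdBrace_alpha2_alpha3 (c : ℕ) :
    Nat.card (SkewBraceIso (StdBrace hp (0, 1, c)) (StdBrace hp (0, 1, c))) =
      (p - 1) * p ^ 2 := by
  rw [Nat.card_congr ((stdChart hp _).isoEquiv (stdChart hp _)), exponentGamma_alpha2_alpha3,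
    card_intertwines_alpha2_alpha3]

end Heis

end RepresentativeAutomorphisms

section RegularSubgroupCount

namespace PermBrace

variable {G : Type*} [Group G]

theorem carrier_add {N : Subgroup (Equiv.Perm G)} {hN : IsRegularPerm N}
    {hl : IsNormalisedByLeft N} (n : N) {x : Carrier N hN hl} (hx : orbitEquiv N hN n = x)
    (y : Carrier N hN hl) : x + y = (n : Equiv.Perm G) y := by
  change orbitEquiv N hN ((orbitEquiv N hN).symm x * (orbitEquiv N hN).symm y) = _
  rw [← hx, Equiv.symm_apply_apply]
  exact congrArg n.1 ((orbitEquiv N hN).apply_symm_apply y)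

/-- The multiplicative group of the skew brace of a regular subgroup of `Perm G` is `G`. -/
def carrierMulEquiv (N : Subgroup (Equiv.Perm G)) (hN : IsRegularPerm N)
    (hl : IsNormalisedByLeft N) : Carrier N hN hl ≃* G :=
  MulEquiv.refl G

/-- The additive group of the skew brace of a regular subgroup `N` of `Perm G` is `N`. -/
noncomputable def carrierAddEquiv (N : Subgroup (Equiv.Perm G)) (hN : IsRegularPerm N)
    (hl : IsNormalisedByLeft N) : Carrier N hN hl ≃+ Additive N where
  toEquiv := (orbitEquiv N hN).symm.trans Additive.ofMul
  map_add' x y := (orbitEquiv N hN).symm_apply_apply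
    ((orbitEquiv N hN).symm x * (orbitEquiv N hN).symm y)

theorem isSkewBraceOfType_carrier_iff {M : Type*} [Group M] {N : Subgroup (Equiv.Perm G)}
    (hN : IsRegularPerm N) (hl : IsNormalisedByLeft N) :
    IsSkewBraceOfType (Carrier N hN hl) G M ↔ Nonempty (N ≃* M) :=
  ⟨fun h => h.2.map fun f => MulEquiv.toAdditive.symm ((carrierAddEquiv N hN hl).symm.trans f),
    fun h => ⟨⟨carrierMulEquiv N hN hl⟩,
      h.map fun f => (carrierAddEquiv N hN hl).trans (MulEquiv.toAdditive f)⟩⟩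

variable {B : Type*} [SkewBrace B]

/-- The group of the additive translations of `B`, transported to permutations of `G` along an
isomorphism `f` of `G` with the multiplicative group of `B`. -/
def translationSubgroup (f : G ≃* B) : Subgroup (Equiv.Perm G) where
  carrier := {n | ∃ b : B, ∀ x, f (n x) = b + f x}
  one_mem' := ⟨0, fun x => (zero_add _).symm⟩
  mul_mem' := by
    rintro m n ⟨b, hb⟩ ⟨c, hc⟩
    exact ⟨b + c, fun x => by rw [Equiv.Perm.mul_apply, hb, hc, add_assoc]⟩
  inv_mem' := by
    rintro n ⟨b, hb⟩
    refine ⟨-b, fun x => ?_⟩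
    rw [eq_neg_add_iff_add_eq, ← hb, ← Equiv.Perm.mul_apply, mul_inv_cancel, Equiv.Perm.one_apply]

theorem isRegularPerm_translationSubgroup (f : G ≃* B) :
    IsRegularPerm (translationSubgroup f) := by
  intro x y
  refine ⟨(f.toEquiv.trans (Equiv.addLeft (f y - f x))).trans f.toEquiv.symm,
    ⟨⟨f y - f x, fun z => f.apply_symm_apply _⟩, ?_⟩, ?_⟩
  · change f.symm (f y - f x + f x) = y
    rw [sub_add_cancel, f.symm_apply_apply]
  · rintro n ⟨⟨b, hb⟩, rfl⟩
    ext z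
    change n z = f.symm (f (n x) - f x + f z)
    rw [hb, add_sub_cancel_right, ← hb, f.symm_apply_apply]

theorem isNormalisedByLeft_translationSubgroup (f : G ≃* B) :
    IsNormalisedByLeft (translationSubgroup f) := by
  rintro g n ⟨b, hb⟩
  refine ⟨f g * b - f g, fun x => ?_⟩
  change f (g * n (g⁻¹ * x)) = _
  rw [map_mul, hb, SkewBrace.brace_property, ← map_mul, mul_inv_cancel_left, sub_eq_add_neg]

theorem translationSubgroup_eq_iff {N : Subgroup (Equiv.Perm G)} (hN : IsRegularPerm N)
    (hl : IsNormalisedByLeft N) (f : G ≃* B) :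
    translationSubgroup f = N ↔
      ∀ x y : Carrier N hN hl, f (x + y : Carrier N hN hl) = f x + f y := by
  constructor
  · intro h x y
    obtain ⟨n, rfl⟩ := (orbitEquiv N hN).surjective x
    obtain ⟨b, hb⟩ : (n : Equiv.Perm G) ∈ translationSubgroup f := h ▸ n.2
    have hfb : f (orbitEquiv N hN n) = b := by
      change f ((n : Equiv.Perm G) 1) = b
      rw [hb, map_one, SkewBrace.one_eq_zero, add_zero]
    rw [carrier_add n rfl, hfb]
    exact hb y
  · intro h
    have hle : N ≤ translationSubgroup f := fun n hn =>
      ⟨f (n 1), fun y => (congrArg f (carrier_add ⟨n, hn⟩ rfl y)).symm.trans (h _ _)⟩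
    refine le_antisymm (fun n hn => ?_) hle
    obtain ⟨m, ⟨hm, hm1⟩, -⟩ := hN 1 (n 1)
    rwa [← (isRegularPerm_translationSubgroup f 1 (n 1)).unique ⟨hle hm, hm1⟩ ⟨hn, rfl⟩]

/-- The isomorphisms `G ≃* B` which transport the additive translations of `B` to `N` are the
isomorphisms of the skew brace of `N` with `B`. -/
noncomputable def fiberEquiv {N : Subgroup (Equiv.Perm G)} (hN : IsRegularPerm N)
    (hl : IsNormalisedByLeft N) :
    {f : G ≃* B // translationSubgroup f = N} ≃ SkewBraceIso (Carrier N hN hl) B where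
  toFun f :=
    { toEquiv := f.1.toEquiv
      map_add' := (translationSubgroup_eq_iff hN hl f.1).mp f.2
      map_mul' := f.1.map_mul' }
  invFun f := ⟨(carrierMulEquiv N hN hl).symm.trans f.mulEquiv,
    (translationSubgroup_eq_iff hN hl _).mpr f.map_add'⟩
  left_inv _ := rfl
  right_inv _ := rfl

variable (G B) in
/-- The regular subgroups of `Perm G` normalised by the left translations whose skew brace is
isomorphic to `B`. -/
def subgroupsOfBrace : Set (Subgroup (Equiv.Perm G)) :=
  {N | ∃ (hN : IsRegularPerm N) (hl : IsNormalisedByLeft N),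
    Nonempty (SkewBraceIso (Carrier N hN hl) B)}

theorem translationSubgroup_mem_subgroupsOfBrace (f : G ≃* B) :
    translationSubgroup f ∈ subgroupsOfBrace G B :=
  ⟨isRegularPerm_translationSubgroup f, isNormalisedByLeft_translationSubgroup f,
    ⟨fiberEquiv _ _ ⟨f, rfl⟩⟩⟩

/- The map `translationSubgroup` from the isomorphisms `G ≃* B` onto `subgroupsOfBrace G B` has
the automorphism group of `B` as each of its fibres. -/
theorem card_subgroupsOfBrace_mul (e : G ≃* B) :
    Nat.card (subgroupsOfBrace G B) * Nat.card (SkewBraceIso B B) = Nat.card (MulAut G) := by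
  let T (f : G ≃* B) : subgroupsOfBrace G B := ⟨_, translationSubgroup_mem_subgroupsOfBrace f⟩
  have fiber (N : subgroupsOfBrace G B) : Nonempty ({f // T f = N} ≃ SkewBraceIso B B) := by
    obtain ⟨N, hN, hl, ⟨f⟩⟩ := N
    exact ⟨((Equiv.subtypeEquivRight fun _ => Subtype.ext_iff).trans (fiberEquiv hN hl)).trans
      f.congrLeft⟩
  rw [← Nat.card_prod, ← Nat.card_congr (Equiv.sigmaEquivProdOfEquiv fun N => (fiber N).some),
    Nat.card_congr (Equiv.sigmaFiberEquiv T)]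
  exact Nat.card_congr
    { toFun f := f.trans e.symm
      invFun f := f.trans e
      left_inv f := by ext; simp
      right_inv f := by ext; simp }

theorem card_subgroupsOfBrace_of_mul_eq [Finite G] (e : G ≃* B) {k : ℕ}
    (h : k * Nat.card (SkewBraceIso B B) = Nat.card (MulAut G)) :
    Nat.card (subgroupsOfBrace G B) = k := by
  have : Finite B := Finite.of_equiv G e.toEquiv
  exact Nat.eq_of_mul_eq_mul_right Nat.card_pos ((card_subgroupsOfBrace_mul e).trans h.symm)

end PermBrace

end RegularSubgroupCount

section Counts

namespace Heis

open PermBrace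

variable {p : ℕ} [Fact p.Prime] {hp : 3 < p} {G : Type*} [Group G]

variable (hp G) in
theorem subgroupsOfType_eq_biUnion :
    subgroupsOfType G (Heis p) p = ⋃ i ∈ indexSet hp G, subgroupsOfBrace G (StdBrace hp i) := by
  ext N
  simp only [Set.mem_iUnion, exists_prop]
  constructor
  · rintro ⟨hN, hl, hNp, hr⟩
    obtain ⟨i, hi, hf⟩ := (isSkewBraceOfType_and_thetaCard_eq_iff hp).mp
      ⟨(isSkewBraceOfType_carrier_iff hN hl).mpr hNp, hr⟩
    exact ⟨i, hi, hN, hl, hf⟩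
  · rintro ⟨i, hi, hN, hl, hf⟩
    obtain ⟨hNp, hr⟩ := (isSkewBraceOfType_and_thetaCard_eq_iff hp).mpr ⟨i, hi, hf⟩
    exact ⟨hN, hl, (isSkewBraceOfType_carrier_iff hN hl).mp hNp, hr⟩

theorem pairwiseDisjoint_subgroupsOfBrace :
    (indexSet hp G).PairwiseDisjoint fun i => subgroupsOfBrace G (StdBrace hp i) := by
  rintro i ⟨hi, -⟩ j ⟨hj, -⟩ hij
  refine Set.disjoint_left.mpr ?_
  rintro N ⟨hN, hl, ⟨f⟩⟩ ⟨_, _, ⟨g⟩⟩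
  exact hij (eq_of_stdBrace_iso hi hj ⟨f.symm.trans g⟩)

theorem ncard_subgroupsOfType [Finite G] {S : Finset (ℕ × ℕ × ℕ)} (hS : S = indexSet hp G) :
    (subgroupsOfType G (Heis p) p).ncard =
      ∑ i ∈ S, Nat.card (subgroupsOfBrace G (StdBrace hp i)) := by
  rw [subgroupsOfType_eq_biUnion hp, ← hS, ← Nat.card_coe_set_eq, Nat.card_congr
    (Set.biUnionEqSigmaOfDisjoint (hS ▸ pairwiseDisjoint_subgroupsOfBrace)), Nat.card_sigma]
  exact Finset.sum_coe_sort S fun i => Nat.card (subgroupsOfBrace G (StdBrace hp i))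

theorem card_subgroupsOfBrace_stdBrace [Finite G] {i : ℕ × ℕ × ℕ} (hi : i ∈ indexSet hp G) {k : ℕ}
    (h : k * Nat.card (SkewBraceIso (StdBrace hp i) (StdBrace hp i)) = Nat.card (MulAut G)) :
    Nat.card (subgroupsOfBrace G (StdBrace hp i)) = k :=
  hi.2.elim fun e => card_subgroupsOfBrace_of_mul_eq e.symm h

theorem ncard_subgroupsOfType_heis (hp : 3 < p) (e : G ≃* Heis p) :
    (subgroupsOfType G (Heis p) p).ncard = (p ^ 3 - p ^ 2 - 1) * (p + 1) := by
  have : Finite G := Finite.of_equiv _ e.symm.toEquiv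
  have hG : Nat.card (MulAut G) = (p - 1) ^ 2 * (p + 1) * p ^ 3 :=
    (Nat.card_congr (MulAut.congr e).toEquiv).trans (card_mulAut hp)
  have hI : indexSet hp G = exponentsM p := indexSet_eq_exponentsM hp e
  have card_alpha1 : Nat.card (subgroupsOfBrace G (StdBrace hp (1, 0, 0))) = (p - 1) * (p + 1) :=
    card_subgroupsOfBrace_stdBrace (hI ▸ .inl rfl) (by rw [card_aut_stdBrace_alpha1, hG]; ring)
  have card_alpha2_alpha3 {c : ℕ} (hc : (0, 1, c) ∈ exponentsM p) :
      Nat.card (subgroupsOfBrace G (StdBrace hp (0, 1, c))) = (p - 1) * (p + 1) * p :=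
    card_subgroupsOfBrace_stdBrace (hI ▸ hc) (by rw [card_aut_stdBrace_alpha2_alpha3, hG]; ring)
  have card_alpha3 {c : ℕ} (hc : 2 ≤ c) (hcp : c < p) :
      Nat.card (subgroupsOfBrace G (StdBrace hp (0, 0, c))) = (p + 1) * p :=
    card_subgroupsOfBrace_stdBrace (hI ▸ .inr (.inr ⟨c, hc, hcp, .inl rfl⟩)) (by
      rw [card_aut_stdBrace_alpha3 hp (natCast_ne_zero_of_lt (by omega) hcp), hG]; ring)
  have summand (c : ℕ) (hc : c ∈ Finset.Ico 2 p) :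
      Nat.card (subgroupsOfBrace G (StdBrace hp (0, 0, c))) +
        Nat.card (subgroupsOfBrace G (StdBrace hp (0, 1, c))) =
      (p + 1) * p + (p - 1) * (p + 1) * p := by
    rw [Finset.mem_Ico] at hc
    rw [card_alpha3 hc.1 hc.2, card_alpha2_alpha3 (.inr (.inr ⟨c, hc.1, hc.2, .inr rfl⟩))]
  rw [ncard_subgroupsOfType ((coe_exponentsFinsetM p).trans hI.symm), sum_exponentsFinsetM,
    card_alpha1, card_alpha2_alpha3 (.inr (.inl rfl)), Finset.sum_congr rfl summand]
  obtain ⟨q, rfl⟩ : ∃ q, p = q + 2 := ⟨p - 2, by omega⟩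
  have hsub : (q + 2) ^ 3 - (q + 2) ^ 2 - 1 = q ^ 3 + 5 * q ^ 2 + 8 * q + 3 := by
    rw [Nat.sub_sub]
    exact Nat.sub_eq_of_eq_add (by ring)
  simp only [hsub, Finset.sum_const, Nat.card_Ico, smul_eq_mul, Nat.add_sub_cancel,
    show q + 2 - 1 = q + 1 from rfl]
  ring

variable (p) in
theorem card_mulAut_elemAb :
    Nat.card (MulAut (ElemAb p)) = (p ^ 3 - 1) * ((p - 1) ^ 2 * (p + 1) * p ^ 3) := by
  have e : MulAut (ElemAb p) ≃ GL (Fin 3) (ZMod p) :=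
    (AddEquiv.toMultiplicative.symm.trans
      { toFun := fun f => { f.toAddMonoidHom.toZModLinearMap p, f with }
        invFun := fun f => f.toAddEquiv
        left_inv := fun _ => rfl
        right_inv := fun _ => rfl }).trans
      (Matrix.GeneralLinearGroup.toLin.trans
        (LinearMap.GeneralLinearGroup.generalLinearEquiv (ZMod p) (Fin 3 → ZMod p))).symm.toEquiv
  obtain ⟨q, hq⟩ : ∃ q, p = q + 1 := ⟨p - 1, (Nat.succ_pred_prime Fact.out).symm⟩
  have h₁ : p ^ 3 - p = q * (q + 1) * (q + 2) := Nat.sub_eq_of_eq_add (by rw [hq]; ring)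
  have h₂ : p ^ 3 - p ^ 2 = q * (q + 1) ^ 2 := Nat.sub_eq_of_eq_add (by rw [hq]; ring)
  rw [Nat.card_congr e, Matrix.card_GL_field]
  simp only [Fin.prod_univ_three, ZMod.card, Fin.val_zero, Fin.val_one, Fin.val_two, pow_zero,
    pow_one, h₁, h₂]
  rw [show p - 1 = q by omega, show p + 1 = q + 2 by omega]
  nth_rw 3 [hq]
  ring

theorem ncard_subgroupsOfType_elemAb (hp : 3 < p) (e : G ≃* ElemAb p) :
    (subgroupsOfType G (Heis p) p).ncard = (p ^ 3 - 1) * (p + 1) * p ^ 2 := by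
  have : Finite G := Finite.of_equiv _ e.symm.toEquiv
  have hG : Nat.card (MulAut G) = (p ^ 3 - 1) * ((p - 1) ^ 2 * (p + 1) * p ^ 3) :=
    (Nat.card_congr (MulAut.congr e).toEquiv).trans (card_mulAut_elemAb p)
  have hI : indexSet hp G = exponentsC := indexSet_eq_exponentsC hp e
  have card_alpha3 : Nat.card (subgroupsOfBrace G (StdBrace hp (0, 0, 1))) =
      (p ^ 3 - 1) * (p + 1) * p :=
    card_subgroupsOfBrace_stdBrace (hI ▸ .inl rfl) (by
      rw [card_aut_stdBrace_alpha3 hp (natCast_ne_zero_of_lt one_pos (by omega)), hG]; ring)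
  have card_alpha2_alpha3 : Nat.card (subgroupsOfBrace G (StdBrace hp (0, 1, 1))) =
      (p ^ 3 - 1) * (p - 1) * (p + 1) * p :=
    card_subgroupsOfBrace_stdBrace (hI ▸ .inr rfl) (by
      rw [card_aut_stdBrace_alpha2_alpha3, hG]; ring)
  rw [ncard_subgroupsOfType (S := {(0, 0, 1), (0, 1, 1)}) ((Finset.coe_pair ..).trans hI.symm),
    Finset.sum_pair (by simp), card_alpha3, card_alpha2_alpha3]
  obtain ⟨q, rfl⟩ : ∃ q, p = q + 1 := ⟨p - 1, by omega⟩
  rw [Nat.add_sub_cancel]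
  ring

end Heis

end Counts

theorem lemma16 (p : ℕ) [Fact p.Prime] (hp : 3 < p) :
    -- the numbers of isomorphism classes of skew braces
    (skewBraceClasses.{w} (Heis p) (Heis p) p).ncard = 2 * (p - 1) ∧
    (skewBraceClasses.{w} (ElemAb p) (Heis p) p).ncard = 2 ∧
    -- the explicit list of representatives, with their automorphism groups
    (∃ hreg : ∀ i : ℕ × ℕ × ℕ, Hol.IsRegular (Heis.holSubgroup hp i),
      (∀ i ∈ exponentsM p,
        IsSkewBraceOfType (Hol.Brace _ (hreg i)) (Heis p) (Heis p) ∧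
          SkewBrace.thetaCard (Hol.Brace _ (hreg i)) = p) ∧
      (∀ i ∈ exponentsC,
        IsSkewBraceOfType (Hol.Brace _ (hreg i)) (ElemAb p) (Heis p) ∧
          SkewBrace.thetaCard (Hol.Brace _ (hreg i)) = p) ∧
      (∀ i ∈ exponentsM p ∪ exponentsC, ∀ j ∈ exponentsM p ∪ exponentsC,
        Nonempty (SkewBraceIso (Hol.Brace _ (hreg i)) (Hol.Brace _ (hreg j))) → i = j) ∧
      (∀ (B : Type w) [SkewBrace B], Nonempty (B ≃+ Additive (Heis p)) →
        SkewBrace.thetaCard B = p →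
          ∃ i ∈ exponentsM p ∪ exponentsC,
            Nonempty (SkewBraceIso B (Hol.Brace _ (hreg i)))) ∧
      (∀ i : ℕ × ℕ × ℕ, Function.Injective (Hol.Brace.autHom _ (hreg i))) ∧
      Set.range (Hol.Brace.autHom _ (hreg (1, 0, 0))) =
        {α | ∃ (r₁ r₃ b₁ b₃ : ZMod p) (A : GL (Fin 2) (ZMod p)),
          A.val = !![b₁, 0; b₃, b₁] ∧
          α = Heis.alpha1 hp ^ r₁.val * Heis.alpha3 hp ^ r₃.val * Heis.alphaGL hp A} ∧
      Set.range (Hol.Brace.autHom _ (hreg (0, 1, 0))) =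
        {α | ∃ (r₁ b₁ b₃ : ZMod p) (A : GL (Fin 2) (ZMod p)),
          A.val = !![b₁, 0; b₃, b₁ ^ 2] ∧
          α = Heis.alpha1 hp ^ r₁.val * Heis.alpha3 hp ^ (2⁻¹ * (b₁ - 1)).val *
            Heis.alphaGL hp A} ∧
      ∀ c : ℕ, 1 ≤ c → c < p →
        Set.range (Hol.Brace.autHom _ (hreg (0, 0, c))) =
          {α | ∃ (r₁ r₃ b₁ b₄ : ZMod p) (A : GL (Fin 2) (ZMod p)),
            A.val = !![b₁, 0; 0, b₄] ∧
            α = Heis.alpha1 hp ^ r₁.val * Heis.alpha3 hp ^ r₃.val * Heis.alphaGL hp A} ∧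
        Set.range (Hol.Brace.autHom _ (hreg (0, 1, c))) =
          {α | ∃ (r₁ b₁ b₃ : ZMod p) (A : GL (Fin 2) (ZMod p)),
            A.val = !![b₁, 0; b₃, b₁ ^ 2] ∧
            α = Heis.alpha1 hp ^ r₁.val *
              Heis.alpha3 hp ^ ((c : ZMod p) * b₁⁻¹ * b₃ + 2⁻¹ * (b₁ - 1) * (c + 1)).val *
              Heis.alphaGL hp A}) ∧
    -- the numbers of Hopf-Galois structures
    (∀ (K : Type u) (L : Type v) [Field K] [Field L] [Algebra K L] [FiniteDimensional K L]
      [IsGalois K L],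
      (Nonempty ((L ≃ₐ[K] L) ≃* Heis p) →
        (hopfGaloisClasses K L (Heis p) p).ncard = (p ^ 3 - p ^ 2 - 1) * (p + 1)) ∧
      (Nonempty ((L ≃ₐ[K] L) ≃* ElemAb p) →
        (hopfGaloisClasses K L (Heis p) p).ncard = (p ^ 3 - 1) * (p + 1) * p ^ 2)) := by
  refine ⟨?_, ?_, ⟨fun _ => Heis.isRegular_holSubgroup, ?_, ?_, ?_, ?_, ?_, ?_, ?_, ?_⟩, ?_⟩
  · rw [Heis.ncard_skewBraceClasses hp, Heis.indexSet_eq_exponentsM hp (.refl _),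
      ncard_exponentsM (by omega)]
  · rw [Heis.ncard_skewBraceClasses hp, Heis.indexSet_eq_exponentsC hp (.refl _), ncard_exponentsC]
  · exact fun i hi => ⟨Heis.isSkewBraceOfType_stdBrace_heis hi,
      Heis.thetaCard_of_stdBrace_iso (.inl hi) (.refl _)⟩
  · exact fun i hi => ⟨Heis.isSkewBraceOfType_stdBrace_elemAb hi,
      Heis.thetaCard_of_stdBrace_iso (.inr hi) (.refl _)⟩
  · exact fun i hi j hj => Heis.eq_of_stdBrace_iso hi hj
  · exact fun B _ => Heis.exists_stdBrace_iso hp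
  · exact fun i => Hol.Brace.autHom_injective _
  · exact Heis.range_autHom_stdBrace_alpha1 hp
  · exact Heis.range_autHom_stdBrace_alpha2 hp
  · exact fun c hc hcp =>
      ⟨Heis.range_autHom_stdBrace_alpha3 hp (Heis.natCast_ne_zero_of_lt hc hcp),
        Heis.range_autHom_stdBrace_alpha2_alpha3 hp c⟩
  · intro K L _ _ _ _ _
    rw [ncard_hopfGaloisClasses]
    exact ⟨fun ⟨e⟩ => Heis.ncard_subgroupsOfType_heis hp e,
      fun ⟨e⟩ => Heis.ncard_subgroupsOfType_elemAb hp e⟩
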